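/- **PN Coherence.** Let $\mathcal P$ be a set of letters. The category $\mathbf{PN}$ is defined as follows. Its objects are the formulae built with the binary connectives $\wedge,\vee$ from the letters $p\in\mathcal P$ and the negated letters $\neg p$, $p\in\mathcal P$. Its arrow terms are built, with composition $\circ$ and with $f\wedge g$, $f\vee g$, from the following primitive ones, for all formulae $A,B,C$, all letters $p$ and $\xi\in\{\wedge,\vee\}$: $$\mathbf 1_A:A\vdash A,\quad b^{\xi\to}_{A,B,C}:A\xi(B\xi C)\vdash(A\xi B)\xi C,\quad b^{\xi\leftarrow}_{A,B,C}:(A\xi B)\xi C\vdash A\xi(B\xi C),$$ $$c^\wedge_{A,B}:A\wedge B\vdash B\wedge A,\quad c^\vee_{A,B}:B\vee A\vdash A\vee B,\quad d_{A,B,C}:A\wedge(B\vee C)\vdash(A\wedge B)\vee C,$$ $$\Delta_{p,A}:A\vdash A\wedge(\neg p\vee p),\quad \Sigma_{p,A}:(p\wedge\neg p)\vee A\vdash A.$$ The arrows are the classes of arrow terms under the least equivalence relation that is compatible with $\circ,\wedge,\vee$ and that satisfies the category axioms, the functoriality of $\wedge$ and $\vee$ in both arguments, the naturality of $b^{\xi\to},c^\wedge,c^\vee,d$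 in all indices and of $\Delta_{p,A},\Sigma_{p,A}$ in $A$, and the equations below. Here $d^R_{C,B,A}=c^\vee_{C,B\wedge A}\circ(c^\wedge_{A,B}\vee\mathbf 1_C)\circ d_{A,B,C}\circ(\mathbf 1_A\wedge c^\vee_{B,C})\circ c^\wedge_{C\vee B,A}$, $\Sigma^\wedge_{p,A}=c^\wedge_{A,\neg p\vee p}\circ\Delta_{p,A}$, $\Delta^\vee_{p,A}=\Sigma_{p,A}\circ c^\vee_{p\wedge\neg p,A}$, $\Delta'_{p,A}=(\mathbf 1_A\wedge c^\vee_{p,\neg p})\circ\Delta_{p,A}$ and $\Sigma'_{p,A}=\Sigma_{p,A}\circ(c^\wedge_{\neg p,p}\vee\mathbf 1_A)$. * $b^{\xi\to}_{A,B,C}$ and $b^{\xi\leftarrow}_{A,B,C}$ are mutually inverse, $c^\wedge_{B,A}\circ c^\wedge_{A,B}=\mathbf 1_{A\wedge B}$, $c^\vee_{A,B}\circ c^\vee_{B,A}=\mathbf 1_{A\vee B}$; * $b^{\xi\leftarrow}_{A,B,C\xi D}\circ b^{\xi\leftarrow}_{A\xi B,C,D}=(\mathbf 1_A\,\xi\,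 b^{\xi\leftarrow}_{B,C,D})\circ b^{\xi\leftarrow}_{A,B\xi C,D}\circ(b^{\xi\leftarrow}_{A,B,C}\,\xi\,\mathbf 1_D)$; * $(\mathbf 1_B\wedge c^\wedge_{C,A})\circ b^{\wedge\leftarrow}_{B,C,A}\circ c^\wedge_{A,B\wedge C}\circ b^{\wedge\leftarrow}_{A,B,C}\circ(c^\wedge_{B,A}\wedge\mathbf 1_C)=b^{\wedge\leftarrow}_{B,A,C}$; * $(\mathbf 1_B\vee c^\vee_{A,C})\circ b^{\vee\leftarrow}_{B,C,A}\circ c^\vee_{B\vee C,A}\circ b^{\vee\leftarrow}_{A,B,C}\circ(c^\vee_{A,B}\vee\mathbf 1_C)=b^{\vee\leftarrow}_{B,A,C}$; * $(b^{\wedge\leftarrow}_{A,B,C}\vee\mathbf 1_D)\circ d_{A\wedge B,C,D}=d_{A,B\wedge C,D}\circ(\mathbf 1_A\wedge d_{B,C,D})\circ b^{\wedge\leftarrow}_{A,B,C\vee D}$; * $d_{D,C,B\vee A}\circ(\mathbf 1_D\wedge b^{\vee\leftarrow}_{C,B,A})=b^{\vee\leftarrow}_{D\wedge C,B,A}\circ(d_{D,C,B}\vee\mathbf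 1_A)\circ d_{D,C\vee B,A}$; * $d^R_{A\wedge B,C,D}\circ(d_{A,B,C}\wedge\mathbf 1_D)=d_{A,B,C\wedge D}\circ(\mathbf 1_A\wedge d^R_{B,C,D})\circ b^{\wedge\leftarrow}_{A,B\vee C,D}$; * $(\mathbf 1_D\vee d_{C,B,A})\circ d^R_{D,C,B\vee A}=b^{\vee\leftarrow}_{D,C\wedge B,A}\circ(d^R_{D,C,B}\vee\mathbf 1_A)\circ d_{D\vee C,B,A}$; * $b^{\wedge\leftarrow}_{A,B,\neg p\vee p}\circ\Delta_{p,A\wedge B}=\mathbf 1_A\wedge\Delta_{p,B}$, $\quad\Sigma_{p,B\vee A}\circ b^{\vee\leftarrow}_{p\wedge\neg p,B,A}=\Sigma_{p,B}\vee\mathbf 1_A$; * $d_{\neg p\vee p,B,C}\circ\Sigma^\wedge_{p,B\vee C}=\Sigma^\wedge_{p,B}\vee\mathbf 1_C$, $\quad\Delta^\vee_{p,C\wedge B}\circ d_{C,B,p\wedge\neg p}=\mathbf 1_C\wedge\Delta^\vee_{p,B}$; * $\Sigma_{p,p}\circ d_{p,\neg p,p}\circ\Delta_{p,p}=\mathbf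 1_p$, $\quad\Sigma'_{p,\neg p}\circ d_{\neg p,p,\neg p}\circ\Delta'_{p,\neg p}=\mathbf 1_{\neg p}$. The category $\mathit{Br}$ has the finite ordinals as objects. An arrow $R:m\vdash n$ is an equivalence relation on the disjoint union $m^s\cup n^t$ of (a copy of) the source $m$ and (a copy of) the target $n$, all of whose classes have exactly two elements. The composition $P\ast R:m\vdash k$ of $R:m\vdash n$ and $P:n\vdash k$ is the restriction to $m^s\cup k^t$ of the transitive closure of the union of $R$ and $P$ on $m^s\cup n\cup k^t$, where the target of $R$ is identified with the source of $P$. The identity of $n$ has the classes $\{i_s,i_t\}$, $i<n$. The functor $G:\mathbf{PN}\to\mathit{Br}$ sends a formula $A$ to its number $GA$ of occurrences of letters. It sends $\mathbf 1$, $b^{\xi\to}$, $b^{\xi\leftarrow}$ and $d$ to identities, and $c^\wedge_{A,B}$ and $c^\vee_{B,A}$ to the transposition of the first $GA$ and the last $GB$ positions. $G\Delta_{p,A}$ has the classes $\{i_s,i_t\}$ for $i<GA$ and $\{(GA)_t,(GA+1)_t\}$; $G\Sigma_{p,A}$ has the classes $\{0_s,1_s\}$ and $\{(i+2)_s,i_t\}$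 for $i<GA$. Moreover $G(f\circ g)=Gf\ast Gg$, and for $f:A\vdash D$ and $g:B\vdash E$ both $G(f\wedge g)$ and $G(f\vee g)$ are the union of $Gf$ with the copy of $Gg$ shifted by $GA$ in the source and by $GD$ in the target. Then $G$ is faithful: if $f,g:A\vdash B$ are arrows of $\mathbf{PN}$ with $Gf=Gg$, then $f=g$ in $\mathbf{PN}$. -/

import Mathlib

open CategoryTheory

universe u

/-! ### Split equivalences -/

/-- A split equivalence `R : X ⊢ Y`: an equivalence relation on the disjoint union of the source
`X` and the target `Y`. -/
abbrev SplitEq (X Y : Type*) := Setoid (X ⊕ Y)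

namespace SplitEq

/-- A split equivalence is Brauerian when every class of its partition has exactly two elements. -/
def IsBrauerian {X Y : Type*} (R : SplitEq X Y) : Prop :=
  ∀ c ∈ R.classes, c.ncard = 2

/-- The union of `R` (with its target moved to the middle) and of `P` (with its source moved to
the middle), a relation on the disjoint union of `X`, `Y` and `Z`. -/
inductive Glue {X Y Z : Type*} (P : SplitEq Y Z) (R : SplitEq X Y) :
    X ⊕ (Y ⊕ Z) → X ⊕ (Y ⊕ Z) → Prop
  | lower {u v : X ⊕ Y} : R u v → Glue P R (Sum.map id Sum.inl u) (Sum.map id Sum.inl v)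
  | upper {u v : Y ⊕ Z} : P u v → Glue P R (Sum.inr u) (Sum.inr v)

theorem Glue.symm {X Y Z : Type*} {P : SplitEq Y Z} {R : SplitEq X Y} {u v : X ⊕ (Y ⊕ Z)}
    (h : Glue P R u v) : Glue P R v u := by
  cases h with
  | lower h => exact .lower (R.symm h)
  | upper h => exact .upper (P.symm h)

theorem Glue.refl {X Y Z : Type*} (P : SplitEq Y Z) (R : SplitEq X Y) (u : X ⊕ (Y ⊕ Z)) :
    Glue P R u u := by
  rcases u with x | u
  · exact Glue.lower (u := Sum.inl x) (v := Sum.inl x) (R.refl _)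
  · exact .upper (P.refl _)

/-- The transitive closure of `Glue P R`, an equivalence relation on `X ⊕ (Y ⊕ Z)`. -/
def glueSetoid {X Y Z : Type*} (P : SplitEq Y Z) (R : SplitEq X Y) : Setoid (X ⊕ (Y ⊕ Z)) where
  r := Relation.TransGen (Glue P R)
  iseqv :=
    { refl := fun u => .single (Glue.refl P R u)
      symm := fun h => by
        induction h with
        | single h => exact .single h.symm
        | tail _ h ih => exact .head h.symm ih
      trans := fun h h' => h.trans h' }

/-- The composition `P ∗ R`: the transitive closure of the union of `R` and `P`, restricted to
`X ⊕ Z`. -/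
def star {X Y Z : Type*} (P : SplitEq Y Z) (R : SplitEq X Y) : SplitEq X Z :=
  (glueSetoid P R).comap (Sum.map id Sum.inr)

/-- The split equivalence of a bijection `e`, whose classes are the sets `{x, e x}`. -/
def ofEquiv {X Y : Type*} (e : X ≃ Y) : SplitEq X Y := Setoid.ker (Sum.elim e id)

/-- The disjoint union of two equivalence relations. -/
def sumSetoid {X Y : Type*} (r : Setoid X) (s : Setoid Y) : Setoid (X ⊕ Y) where
  r := Sum.LiftRel r s
  iseqv :=
    { refl := fun u => by
        rcases u with u | u
        · exact .inl (r.refl u)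
        · exact .inr (s.refl u)
      symm := fun h => by
        cases h with
        | inl h => exact .inl (r.symm h)
        | inr h => exact .inr (s.symm h)
      trans := fun h h' => by
        cases h with
        | inl h => cases h' with
          | inl h' => exact .inl (r.trans h h')
        | inr h => cases h' with
          | inr h' => exact .inr (s.trans h h') }

/-- The bijection that cuts the source and the target of a split equivalence into an initial and a
final segment. -/
def cut (a b d e : ℕ) :
    Fin (a + b) ⊕ Fin (d + e) ≃ (Fin a ⊕ Fin d) ⊕ (Fin b ⊕ Fin e) :=
  (Equiv.sumCongr finSumFinEquiv.symm finSumFinEquiv.symm).trans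
    (Equiv.sumSumSumComm (Fin a) (Fin b) (Fin d) (Fin e))

/-- `R` and `S` side by side: the union of `R` with the copy of `S` that is shifted by `a` in the
source and by `d` in the target. -/
def tensor {a b d e : ℕ} (R : SplitEq (Fin a) (Fin d)) (S : SplitEq (Fin b) (Fin e)) :
    SplitEq (Fin (a + b)) (Fin (d + e)) :=
  (sumSetoid R S).comap (cut a b d e)

/-! #### Split equivalences through the predicates that they respect -/

/-- The pair of predicates `φ`, `χ` is constant on the classes of `R`. -/
def Sat {X Y : Type*} (R : SplitEq X Y) (φ : X → Prop) (χ : Y → Prop) : Prop :=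
  ∀ u v, R u v → Sum.elim φ χ u = Sum.elim φ χ v

theorem ext_sat {X Y : Type*} {R S : SplitEq X Y} (h : ∀ φ χ, Sat R φ χ ↔ Sat S φ χ) : R = S := by
  have key : ∀ {R S : SplitEq X Y}, (∀ φ χ, Sat S φ χ → Sat R φ χ) → ∀ u v, R u v → S u v := by
    intro R S h u v huv
    have h1 := h (fun x => S u (Sum.inl x)) (fun y => S u (Sum.inr y)) ?_ u v huv
    · have e : ∀ w, Sum.elim (fun x => S u (Sum.inl x)) (fun y => S u (Sum.inr y)) w = S u w := by
        rintro (w | w) <;> rfl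
      rw [e, e] at h1
      exact h1 ▸ S.refl u
    · intro w w' hw
      have e : ∀ w, Sum.elim (fun x => S u (Sum.inl x)) (fun y => S u (Sum.inr y)) w = S u w := by
        rintro (w | w) <;> rfl
      rw [e, e]
      exact propext ⟨fun h => S.trans h hw, fun h => S.trans h (S.symm hw)⟩
  ext u v
  exact ⟨key (fun φ χ => (h φ χ).2) u v, key (fun φ χ => (h φ χ).1) u v⟩

theorem sat_star {X Y Z : Type*} (P : SplitEq Y Z) (R : SplitEq X Y) (φ : X → Prop)
    (χ : Z → Prop) : Sat (star P R) φ χ ↔ ∃ ψ, Sat R φ ψ ∧ Sat P ψ χ := by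
  constructor
  · intro h
    let ψ : Y → Prop := fun y => ∃ a : X ⊕ Z, Sum.elim φ χ a ∧
      glueSetoid P R (Sum.map id Sum.inr a) (Sum.inr (Sum.inl y))
    let θ : X ⊕ (Y ⊕ Z) → Prop := fun w => ∃ a : X ⊕ Z, Sum.elim φ χ a ∧
      glueSetoid P R (Sum.map id Sum.inr a) w
    have hθ : ∀ a : X ⊕ Z, θ (Sum.map id Sum.inr a) = Sum.elim φ χ a := by
      intro a
      apply propext
      constructor
      · rintro ⟨b, hb, hba⟩
        exact h b a hba ▸ hb
      · intro ha
        exact ⟨a, ha, (glueSetoid P R).refl _⟩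
    have hg : ∀ u v, Glue P R u v → θ u = θ v := by
      intro u v huv
      have huv' : glueSetoid P R u v := Relation.TransGen.single huv
      apply propext
      constructor
      · rintro ⟨a, ha, h1⟩
        exact ⟨a, ha, (glueSetoid P R).trans h1 huv'⟩
      · rintro ⟨a, ha, h1⟩
        exact ⟨a, ha, (glueSetoid P R).trans h1 ((glueSetoid P R).symm huv')⟩
    refine ⟨ψ, ?_, ?_⟩
    · intro u v huv
      have e : ∀ w : X ⊕ Y, Sum.elim φ ψ w = θ (Sum.map id Sum.inl w) := by
        rintro (w | w)
        · exact (hθ (Sum.inl w)).symm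
        · rfl
      rw [e, e]
      exact hg _ _ (.lower huv)
    · intro u v huv
      have e : ∀ w : Y ⊕ Z, Sum.elim ψ χ w = θ (Sum.inr w) := by
        rintro (w | w)
        · rfl
        · exact (hθ (Sum.inr w)).symm
      rw [e, e]
      exact hg _ _ (.upper huv)
  · rintro ⟨ψ, h1, h2⟩ u v huv
    have hg : ∀ {w w'}, Relation.TransGen (Glue P R) w w' →
        Sum.elim φ (Sum.elim ψ χ) w = Sum.elim φ (Sum.elim ψ χ) w' := by
      have hs : ∀ {w w'}, Glue P R w w' →
          Sum.elim φ (Sum.elim ψ χ) w = Sum.elim φ (Sum.elim ψ χ) w' := by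
        intro w w' hw
        cases hw with
        | @lower u v h =>
          have := h1 _ _ h
          rcases u with u | u <;> rcases v with v | v <;> exact this
        | upper h => exact h2 _ _ h
      intro w w' hw
      induction hw with
      | single h => exact hs h
      | tail _ h ih => exact ih.trans (hs h)
    have := hg huv
    rcases u with u | u <;> rcases v with v | v <;> exact this

theorem sat_ofEquiv {X Y : Type*} (e : X ≃ Y) (φ : X → Prop) (χ : Y → Prop) :
    Sat (ofEquiv e) φ χ ↔ φ = χ ∘ e := by
  constructor
  · intro h
    funext x
    exact h (Sum.inl x) (Sum.inr (e x)) rfl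
  · rintro rfl u v huv
    have e' : ∀ w : X ⊕ Y, Sum.elim (χ ∘ e) χ w = χ (Sum.elim e id w) := by
      rintro (w | w) <;> rfl
    rw [e', e']
    exact congrArg χ huv

theorem sat_tensor {a b d e : ℕ} (R : SplitEq (Fin a) (Fin d)) (S : SplitEq (Fin b) (Fin e))
    (φ : Fin (a + b) → Prop) (χ : Fin (d + e) → Prop) :
    Sat (tensor R S) φ χ ↔
      Sat R (φ ∘ Fin.castAdd b) (χ ∘ Fin.castAdd e) ∧
        Sat S (φ ∘ Fin.natAdd a) (χ ∘ Fin.natAdd d) := by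
  have e1 : ∀ w, Sum.elim φ χ ((cut a b d e).symm (Sum.inl w)) =
      Sum.elim (φ ∘ Fin.castAdd b) (χ ∘ Fin.castAdd e) w := by
    rintro (w | w) <;> rfl
  have e2 : ∀ w, Sum.elim φ χ ((cut a b d e).symm (Sum.inr w)) =
      Sum.elim (φ ∘ Fin.natAdd a) (χ ∘ Fin.natAdd d) w := by
    rintro (w | w) <;> rfl
  constructor
  · intro h
    constructor
    · intro u v huv
      rw [← e1, ← e1]
      apply h
      change Sum.LiftRel R S _ _
      simpa using huv
    · intro u v huv
      rw [← e2, ← e2]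
      apply h
      change Sum.LiftRel R S _ _
      simpa using huv
  · rintro ⟨h1, h2⟩ u v huv
    obtain ⟨u, rfl⟩ := (cut a b d e).symm.surjective u
    obtain ⟨v, rfl⟩ := (cut a b d e).symm.surjective v
    change Sum.LiftRel R S _ _ at huv
    simp only [Equiv.apply_symm_apply] at huv
    cases huv with
    | inl h => rw [e1, e1]; exact h1 _ _ h
    | inr h => rw [e2, e2]; exact h2 _ _ h

theorem star_assoc {X Y Z W : Type*} (Q : SplitEq Z W) (P : SplitEq Y Z) (R : SplitEq X Y) :
    star Q (star P R) = star (star Q P) R := by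
  apply ext_sat
  intro φ χ
  simp only [sat_star]
  constructor
  · rintro ⟨ψ, ⟨ρ, h1, h2⟩, h3⟩
    exact ⟨ρ, h1, ψ, h2, h3⟩
  · rintro ⟨ρ, h1, ψ, h2, h3⟩
    exact ⟨ψ, ⟨ρ, h1, h2⟩, h3⟩

theorem star_refl {X Y : Type*} (R : SplitEq X Y) : star R (ofEquiv (Equiv.refl X)) = R := by
  apply ext_sat
  intro φ χ
  simp [sat_star, sat_ofEquiv]

theorem refl_star {X Y : Type*} (R : SplitEq X Y) : star (ofEquiv (Equiv.refl Y)) R = R := by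
  apply ext_sat
  intro φ χ
  simp [sat_star, sat_ofEquiv]

end SplitEq

namespace SplitEq

theorem isBrauerian_iff {X Y : Type*} (R : SplitEq X Y) :
    R.IsBrauerian ↔ ∀ u, ∃! v, v ≠ u ∧ R u v := by
  constructor
  · intro h u
    have h2 := h {w | R w u} (R.mem_classes u)
    obtain ⟨p, q, hpq, hs⟩ := Set.ncard_eq_two.1 h2
    have hm : ∀ w, R w u ↔ w = p ∨ w = q := fun w => by
      have := Set.ext_iff.1 hs w
      simpa using this
    rcases (hm u).1 (R.refl u) with rfl | rfl
    · refine ⟨q, ⟨hpq.symm, R.symm ((hm q).2 (.inr rfl))⟩, ?_⟩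
      rintro w ⟨hw, hw'⟩
      exact ((hm w).1 (R.symm hw')).resolve_left hw
    · refine ⟨p, ⟨hpq, R.symm ((hm p).2 (.inl rfl))⟩, ?_⟩
      rintro w ⟨hw, hw'⟩
      exact ((hm w).1 (R.symm hw')).resolve_right hw
  · rintro h c ⟨u, rfl⟩
    obtain ⟨v, ⟨hv, hv'⟩, huniq⟩ := h u
    refine Set.ncard_eq_two.2 ⟨u, v, hv.symm, ?_⟩
    ext w
    simp only [Set.mem_ofPred_eq, Set.mem_insert_iff, Set.mem_singleton_iff]
    constructor
    · intro hw
      by_cases hwu : w = u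
      · exact .inl hwu
      · exact .inr (huniq w ⟨hwu, R.symm hw⟩)
    · rintro (rfl | rfl)
      · exact R.refl _
      · exact R.symm hv'

/-- Two involutions `s`, `t` of a finite set without common fixed points: in each class of the
equivalence relation that they generate, the points fixed by `s` or `t` come in pairs. -/
theorem exists_unique_end {V : Type*} [Finite V] (J : Setoid V) (s t : Equiv.Perm V)
    (hs : ∀ v, s (s v) = v) (ht : ∀ v, t (t v) = v) (hst : ∀ v, s v = v → t v ≠ v)
    (hJs : ∀ v, J v (s v)) (hJt : ∀ v, J v (t v))
    (hJ : ∀ θ : V → Prop, (∀ v, θ v → θ (s v) ∧ θ (t v)) → ∀ u v, J u v → θ u → θ v)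
    (x : V) (hx : t x = x) :
    ∃! y, y ≠ x ∧ (s y = y ∨ t y = y) ∧ J x y := by
  let g : Equiv.Perm V := t * s
  let o : ℤ → V := fun k => (g ^ k) • x
  have o0 : o 0 = x := by simp [o]
  have hgs : ∀ v, g v = t (s v) := fun v => rfl
  have o1 : ∀ k, o (k + 1) = g (o k) := by
    intro k
    simp only [o, Equiv.Perm.smul_def, add_comm k 1, zpow_add, zpow_one, Equiv.Perm.mul_apply]
  have htn : ∀ k : ℤ, t (o k) = o (-k) := by
    have hp : ∀ k : ℤ, t (o k) = o (-k) → t (o (k + 1)) = o (-(k + 1)) := by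
      intro k hk
      apply g.injective
      have h1 := o1 (-(k + 1))
      rw [show -(k + 1) + 1 = -k by ring] at h1
      rw [← h1, o1, hgs, hgs, ht, hs, hk]
    have hm : ∀ k : ℤ, t (o (k + 1)) = o (-(k + 1)) → t (o k) = o (-k) := by
      intro k hk
      have h1 := o1 (-(k + 1))
      rw [show -(k + 1) + 1 = -k by ring] at h1
      rw [h1, ← hk, o1, hgs, hgs, ht, hs]
    intro k
    induction k with
    | zero => simp [o0, hx]
    | succ k ih => exact hp _ ih
    | pred k ih =>
      apply hm
      rw [show (-(k : ℤ) - 1 + 1) = -k by ring]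
      exact ih
  have hsn : ∀ k : ℤ, s (o k) = o (-k - 1) := by
    intro k
    have h1 : t (g (o k)) = s (o k) := by rw [hgs, ht]
    rw [← h1, ← o1, htn]
    congr 1
    ring
  let n := MulAction.period g x
  have hn : 0 < n := MulAction.period_pos_of_orderOf_pos (orderOf_pos g) x
  have heq : ∀ j : ℤ, o j = x ↔ (n : ℤ) ∣ j := fun j =>
    MulAction.zpow_smul_eq_iff_period_dvd
  have heq2 : ∀ j k : ℤ, o j = o k ↔ (n : ℤ) ∣ j - k := by
    intro j k
    rw [← heq]
    simp only [o, sub_eq_neg_add, zpow_add, mul_smul, zpow_neg]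
    rw [inv_smul_eq_iff]
  have hend : ∀ k : ℤ, (s (o k) = o k ∨ t (o k) = o k) ↔
      ((n : ℤ) ∣ 2 * k + 1 ∨ (n : ℤ) ∣ 2 * k) := by
    intro k
    rw [hsn, htn, eq_comm, heq2, eq_comm, heq2]
    ring_nf
  have hn1 : n ≠ 1 := by
    intro h
    have h1 : s (o 0) = o 0 := by
      rw [hsn, heq2, h]
      simp
    rw [o0] at h1
    exact hst x h1 hx
  have hcl : ∀ y, J x y → ∃ k : ℕ, k < n ∧ y = o k := by
    intro y hy
    obtain ⟨j, hj⟩ := hJ (fun v => ∃ k : ℤ, v = o k)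
      (by
        rintro v ⟨k, rfl⟩
        exact ⟨⟨_, hsn k⟩, ⟨_, htn k⟩⟩) x y hy ⟨0, o0.symm⟩
    have hn' : (0 : ℤ) < n := by exact_mod_cast hn
    have h1 := Int.emod_nonneg j hn'.ne'
    have h2 := Int.emod_lt_of_pos j hn'
    refine ⟨(j % n).toNat, by omega, ?_⟩
    rw [hj, heq2, Int.toNat_of_nonneg h1]
    exact Int.dvd_self_sub_emod
  have hreach : ∀ k : ℕ, J x (o k) := by
    intro k
    induction k with
    | zero => simp [o0]
    | succ k ih =>
      push_cast
      rw [o1]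
      exact J.trans ih (J.trans (hJs _) (hJt _))
  refine ⟨o (n / 2 : ℕ), ⟨?_, ?_, hreach _⟩, ?_⟩
  · rw [Ne, heq]
    intro h
    have h' : n ∣ n / 2 := by exact_mod_cast h
    have := Nat.le_of_dvd (by omega) h'
    omega
  · rw [hend]
    rcases Nat.even_or_odd' n with ⟨m, hm | hm⟩
    · right
      rw [hm]
      simp
    · left
      rw [hm]
      have : (2 * m + 1) / 2 = m := by omega
      rw [this]
      push_cast
      exact dvd_rfl
  · rintro y ⟨hy, hye, hxy⟩
    obtain ⟨k, hk, rfl⟩ := hcl y hxy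
    rw [hend] at hye
    have hk0 : k ≠ 0 := by
      rintro rfl
      exact hy (by simpa using o0)
    have : k = n / 2 := by
      rcases hye with h | h
      · have h' : n ∣ 2 * k + 1 := by exact_mod_cast h
        obtain ⟨c, hc⟩ := h'
        have : c = 1 := by
          have h3 : 0 < c := by
            rcases Nat.eq_zero_or_pos c with rfl | h
            · omega
            · exact h
          have h4 : c < 2 := by
            by_contra h
            have := Nat.mul_le_mul_left n (not_lt.1 h)
            omega
          omega
        subst this
        omega
      · have h' : n ∣ 2 * k := by exact_mod_cast h
        obtain ⟨c, hc⟩ := h'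
        have : c = 1 := by
          have h3 : 0 < c := by
            rcases Nat.eq_zero_or_pos c with rfl | h
            · omega
            · exact h
          have h4 : c < 2 := by
            by_contra h
            have := Nat.mul_le_mul_left n (not_lt.1 h)
            omega
          omega
        subst this
        omega
    rw [this]

theorem IsBrauerian.star {X Y Z : Type*} [Finite X] [Finite Y] [Finite Z] {P : SplitEq Y Z}
    {R : SplitEq X Y} (hP : P.IsBrauerian) (hR : R.IsBrauerian) : (star P R).IsBrauerian := by
  rw [isBrauerian_iff] at hP hR ⊢
  choose σ hσ hσu using hR
  choose τ hτ hτu using hP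
  have hσ2 : ∀ u, σ (σ u) = u := fun u => (hσu _ u ⟨(hσ u).1.symm, R.symm (hσ u).2⟩).symm
  have hτ2 : ∀ u, τ (τ u) = u := fun u => (hτu _ u ⟨(hτ u).1.symm, P.symm (hτ u).2⟩).symm
  let i : X ⊕ Y → X ⊕ (Y ⊕ Z) := Sum.map id Sum.inl
  have hi : Function.Injective i := Sum.map_injective.2 ⟨fun _ _ h => h, Sum.inl_injective⟩
  let s0 : X ⊕ (Y ⊕ Z) → X ⊕ (Y ⊕ Z) := fun w =>
    match w with
    | .inl x => i (σ (.inl x))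
    | .inr (.inl y) => i (σ (.inr y))
    | .inr (.inr z) => .inr (.inr z)
  let t0 : X ⊕ (Y ⊕ Z) → X ⊕ (Y ⊕ Z) := fun w =>
    match w with
    | .inl x => .inl x
    | .inr w => .inr (τ w)
  have hsi : ∀ u, s0 (i u) = i (σ u) := by
    rintro (u | u) <;> rfl
  have hs : ∀ w, s0 (s0 w) = w := by
    rintro (x | y | z)
    · exact (hsi _).trans (congrArg i (hσ2 (.inl x)))
    · exact (hsi _).trans (congrArg i (hσ2 (.inr y)))
    · rfl
  have ht : ∀ w, t0 (t0 w) = w := by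
    rintro (x | w)
    · rfl
    · exact congrArg Sum.inr (hτ2 w)
  let s : Equiv.Perm (X ⊕ (Y ⊕ Z)) := ⟨s0, s0, hs, hs⟩
  let t : Equiv.Perm (X ⊕ (Y ⊕ Z)) := ⟨t0, t0, ht, ht⟩
  have hsx : ∀ u, s (i u) ≠ i u := fun u h => (hσ u).1 (hi ((hsi u).symm.trans h))
  have htx : ∀ u, t (.inr u) ≠ .inr u := fun u h => (hτ u).1 (Sum.inr_injective h)
  have hst : ∀ v, s v = v → t v ≠ v := by
    rintro (x | v) h
    · exact absurd h (hsx (.inl x))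
    · exact htx v
  have hJs : ∀ v, glueSetoid P R v (s v) := by
    have : ∀ u, glueSetoid P R (i u) (s (i u)) := fun u => by
      change glueSetoid P R (i u) (s0 (i u))
      rw [hsi]
      exact .single (.lower (hσ u).2)
    rintro (x | y | z)
    · exact this (.inl x)
    · exact this (.inr y)
    · exact (glueSetoid P R).refl _
  have hJt : ∀ v, glueSetoid P R v (t v) := by
    rintro (x | v)
    · exact (glueSetoid P R).refl _
    · exact .single (.upper (hτ v).2)
  have hg : ∀ u v, Glue P R u v → v = u ∨ v = s u ∨ v = t u := by
    intro u v h
    cases h with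
    | @lower u v h =>
      by_cases huv : v = u
      · exact .inl (by rw [huv])
      · refine .inr (.inl ?_)
        rw [hσu u v ⟨huv, h⟩]
        exact (hsi u).symm
    | @upper u v h =>
      by_cases huv : v = u
      · exact .inl (by rw [huv])
      · refine .inr (.inr ?_)
        rw [hτu u v ⟨huv, h⟩]
        rfl
  have hJ : ∀ θ : X ⊕ (Y ⊕ Z) → Prop, (∀ v, θ v → θ (s v) ∧ θ (t v)) →
      ∀ u v, glueSetoid P R u v → θ u → θ v := by
    intro θ hθ u v huv hu
    have step : ∀ u v, Glue P R u v → θ u → θ v := by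
      intro u v h hu
      rcases hg u v h with rfl | rfl | rfl
      · exact hu
      · exact (hθ u hu).1
      · exact (hθ u hu).2
    have huv' : Relation.TransGen (Glue P R) u v := huv
    induction huv' with
    | single h => exact step _ _ h hu
    | tail h h' ih => exact step _ _ h' (ih h)
  let j : X ⊕ Z → X ⊕ (Y ⊕ Z) := Sum.map id Sum.inr
  have hj : Function.Injective j := Sum.map_injective.2 ⟨fun _ _ h => h, Sum.inr_injective⟩
  have hjt : ∀ w, (s w = w ∨ t w = w) ↔ ∃ v, j v = w := by
    rintro (x | y | z)
    · exact ⟨fun _ => ⟨.inl x, rfl⟩, fun _ => .inr rfl⟩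
    · constructor
      · rintro (h | h)
        · exact absurd h (hsx (.inr y))
        · exact absurd h (htx _)
      · rintro ⟨v | v, hv⟩
        · cases hv
        · exact absurd (Sum.inr_injective hv) (by simp)
    · exact ⟨fun _ => ⟨.inr z, rfl⟩, fun _ => .inl rfl⟩
  have main : ∀ u, ∃! w, w ≠ j u ∧ (s w = w ∨ t w = w) ∧ glueSetoid P R (j u) w := by
    rintro (x | z)
    · exact exists_unique_end _ s t hs ht hst hJs hJt hJ _ rfl
    · have := exists_unique_end _ t s ht hs (fun v h h' => hst v h' h) hJt hJs
        (fun θ h => hJ θ (fun v hv => (h v hv).symm)) (j (.inr z)) rfl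
      simpa only [or_comm] using this
  intro u
  obtain ⟨w, ⟨hw1, hw2, hw3⟩, hw⟩ := main u
  obtain ⟨v, rfl⟩ := (hjt w).1 hw2
  refine ⟨v, ⟨fun h => hw1 (congrArg j h), hw3⟩, ?_⟩
  rintro v' ⟨h1, h2⟩
  exact hj (hw (j v') ⟨fun h => h1 (hj h), (hjt _).2 ⟨v', rfl⟩, h2⟩)

theorem IsBrauerian.ofEquiv {X Y : Type*} (e : X ≃ Y) : (ofEquiv e).IsBrauerian := by
  rw [isBrauerian_iff]
  rintro (x | y)
  · refine ⟨.inr (e x), ⟨Sum.inr_ne_inl, rfl⟩, ?_⟩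
    rintro (w | w) ⟨h, h'⟩
    · exact absurd (congrArg Sum.inl (e.injective h')).symm h
    · exact congrArg Sum.inr (Eq.symm h')
  · refine ⟨.inl (e.symm y), ⟨Sum.inl_ne_inr, (e.apply_symm_apply y).symm⟩, ?_⟩
    rintro (w | w) ⟨h, h'⟩
    · exact congrArg Sum.inl ((Equiv.eq_symm_apply e).2 (Eq.symm h'))
    · exact absurd (congrArg Sum.inr (Eq.symm h')) h

theorem IsBrauerian.tensor {a b d e : ℕ} {R : SplitEq (Fin a) (Fin d)}
    {S : SplitEq (Fin b) (Fin e)} (hR : R.IsBrauerian) (hS : S.IsBrauerian) :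
    (tensor R S).IsBrauerian := by
  rw [isBrauerian_iff] at hR hS ⊢
  intro u
  obtain ⟨w, rfl⟩ := (cut a b d e).symm.surjective u
  have key : ∀ w w', SplitEq.tensor R S ((cut a b d e).symm w) ((cut a b d e).symm w') ↔
      Sum.LiftRel R S w w' := by
    intro w w'
    change Sum.LiftRel R S _ _ ↔ _
    simp
  rcases w with w | w
  · obtain ⟨v, ⟨h1, h2⟩, h3⟩ := hR w
    refine ⟨(cut a b d e).symm (.inl v), ⟨fun h => h1 (Sum.inl_injective
      ((cut a b d e).symm.injective h)), (key _ _).2 (.inl h2)⟩, ?_⟩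
    rintro v' ⟨h4, h5⟩
    obtain ⟨v', rfl⟩ := (cut a b d e).symm.surjective v'
    cases (key _ _).1 h5 with
    | @inl _ v' h => rw [h3 v' ⟨fun h => h4 (by rw [h]), h⟩]
  · obtain ⟨v, ⟨h1, h2⟩, h3⟩ := hS w
    refine ⟨(cut a b d e).symm (.inr v), ⟨fun h => h1 (Sum.inr_injective
      ((cut a b d e).symm.injective h)), (key _ _).2 (.inr h2)⟩, ?_⟩
    rintro v' ⟨h4, h5⟩
    obtain ⟨v', rfl⟩ := (cut a b d e).symm.surjective v'
    cases (key _ _).1 h5 with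
    | @inr _ v' h => rw [h3 v' ⟨fun h => h4 (by rw [h]), h⟩]

end SplitEq

namespace SplitEq

/-- The split equivalence `a ⊢ a + 2` with the transversals `{m_s, m_t}` for `m < a` and the cap
`{a_t, (a + 1)_t}`: the identity of `a` beside the split equivalence `0 ⊢ 2` with one class. -/
def capRight (a : ℕ) : SplitEq (Fin a) (Fin (a + (1 + 1))) :=
  tensor (a := a) (b := 0) (ofEquiv (Equiv.refl (Fin a))) (⊤ : SplitEq (Fin 0) (Fin (1 + 1)))

/-- The split equivalence `2 + a ⊢ a` with the cup `{0_s, 1_s}` and the transversals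
`{(m + 2)_s, m_t}` for `m < a`: the split equivalence `2 ⊢ 0` with one class beside the identity
of `a`, where the target `0 + a` is identified with `a`. -/
def cupLeft (a : ℕ) : SplitEq (Fin (1 + 1 + a)) (Fin a) :=
  star (ofEquiv (finCongr (Nat.zero_add a)))
    (tensor (⊤ : SplitEq (Fin (1 + 1)) (Fin 0)) (ofEquiv (Equiv.refl (Fin a))))

theorem IsBrauerian.capRight (a : ℕ) : (capRight a).IsBrauerian := by
  refine IsBrauerian.tensor (.ofEquiv _) ?_
  rw [isBrauerian_iff]
  rintro (u | u)
  · exact u.elim0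
  · refine ⟨.inr (Fin.rev u), ⟨?_, trivial⟩, ?_⟩
    · fin_cases u <;> simp [Fin.rev]
    · rintro (v | v) ⟨h, -⟩
      · exact v.elim0
      · fin_cases u <;> fin_cases v <;> simp_all [Fin.rev]

theorem IsBrauerian.cupLeft (a : ℕ) : (cupLeft a).IsBrauerian := by
  refine IsBrauerian.star (.ofEquiv _) (IsBrauerian.tensor ?_ (.ofEquiv _))
  rw [isBrauerian_iff]
  rintro (u | u)
  · refine ⟨.inl (Fin.rev u), ⟨?_, trivial⟩, ?_⟩
    · fin_cases u <;> simp [Fin.rev]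
    · rintro (v | v) ⟨h, -⟩
      · fin_cases u <;> fin_cases v <;> simp_all [Fin.rev]
      · exact v.elim0
  · exact u.elim0

end SplitEq

/-! ### The category of Brauerian split equivalences of finite ordinals -/

/-- An object of `Br` is a finite ordinal. -/
structure Br where
  of ::
  card : ℕ

namespace Br

/-- The identity arrow of the ordinal `n` has the classes `{m_s, m_t}` for `m < n`, and composition
is `SplitEq.star`. -/
instance category : Category Br where
  Hom m n := {R : SplitEq (Fin m.card) (Fin n.card) // R.IsBrauerian}
  id n := ⟨SplitEq.ofEquiv (Equiv.refl (Fin n.card)), SplitEq.IsBrauerian.ofEquiv _⟩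
  comp R P := ⟨SplitEq.star P.1 R.1, P.2.star R.2⟩
  id_comp R := Subtype.ext (SplitEq.star_refl R.1)
  comp_id R := Subtype.ext (SplitEq.refl_star R.1)
  assoc R P Q := Subtype.ext (SplitEq.star_assoc Q.1 P.1 R.1)

end Br

/-! ### Formulae, arrow terms and equations of `PN` -/

/-- The binary connectives `∧` and `∨`. -/
inductive Conn : Type
  | and
  | or

/-- Formulae generated with `∧` and `∨` from the letters in `P` and their negations. -/
inductive PNFormula (P : Type u) : Type u
  | letter (p : P)
  | negLetter (p : P)
  | bin (ξ : Conn) (A B : PNFormula P)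

namespace PNFormula

infixr:66 " ⋏ " => PNFormula.bin Conn.and
infixr:65 " ⋎ " => PNFormula.bin Conn.or

/-- The number of occurrences of letters in a formula. -/
def len {P : Type u} : PNFormula P → ℕ
  | letter _ => 1
  | negLetter _ => 1
  | bin _ A B => A.len + B.len

/-- The crown `¬p ∨ p`. -/
abbrev top {P : Type u} (p : P) : PNFormula P := negLetter p ⋎ letter p

/-- The crown `p ∧ ¬p`. -/
abbrev bot {P : Type u} (p : P) : PNFormula P := letter p ⋏ negLetter p

end PNFormula

open PNFormula in
/-- The arrow terms of `PN`; `PNTerm A B` is the type of arrow terms `f : A ⊢ B`. -/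
inductive PNTerm {P : Type u} : PNFormula P → PNFormula P → Type u
  | one (A : PNFormula P) : PNTerm A A
  /-- `b→ : A ξ (B ξ C) ⊢ (A ξ B) ξ C` -/
  | b (ξ : Conn) (A B C : PNFormula P) : PNTerm (bin ξ A (bin ξ B C)) (bin ξ (bin ξ A B) C)
  /-- `b← : (A ξ B) ξ C ⊢ A ξ (B ξ C)` -/
  | bInv (ξ : Conn) (A B C : PNFormula P) : PNTerm (bin ξ (bin ξ A B) C) (bin ξ A (bin ξ B C))
  | cAnd (A B : PNFormula P) : PNTerm (A ⋏ B) (B ⋏ A)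
  | cOr (A B : PNFormula P) : PNTerm (B ⋎ A) (A ⋎ B)
  | d (A B C : PNFormula P) : PNTerm (A ⋏ (B ⋎ C)) ((A ⋏ B) ⋎ C)
  /-- `Δ∧ : A ⊢ A ∧ (¬p ∨ p)` -/
  | Del (p : P) (A : PNFormula P) : PNTerm A (A ⋏ top p)
  /-- `Σ∨ : (p ∧ ¬p) ∨ A ⊢ A` -/
  | Sig (p : P) (A : PNFormula P) : PNTerm (bot p ⋎ A) A
  | comp {A B C : PNFormula P} (f : PNTerm B C) (g : PNTerm A B) : PNTerm A C
  | map (ξ : Conn) {A B D E : PNFormula P} (f : PNTerm A D) (g : PNTerm B E) :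
      PNTerm (bin ξ A B) (bin ξ D E)

namespace PNTerm

infixr:60 " ⊙ " => PNTerm.comp
infixr:66 " ⩓ " => PNTerm.map Conn.and
infixr:65 " ⩔ " => PNTerm.map Conn.or

variable {P : Type u}

open PNFormula

/-- `d^R : (C ∨ B) ∧ A ⊢ C ∨ (B ∧ A)` -/
def dR (C B A : PNFormula P) : PNTerm ((C ⋎ B) ⋏ A) (C ⋎ (B ⋏ A)) :=
  cOr C (B ⋏ A) ⊙ (cAnd A B ⩔ one C) ⊙ d A B C ⊙ (one A ⩓ cOr B C) ⊙ cAnd (C ⋎ B) A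

/-- `Σ∧ : A ⊢ (¬p ∨ p) ∧ A` -/
def SigAnd (p : P) (A : PNFormula P) : PNTerm A (top p ⋏ A) :=
  cAnd A (top p) ⊙ Del p A

/-- `Δ∨ : A ∨ (p ∧ ¬p) ⊢ A` -/
def DelOr (p : P) (A : PNFormula P) : PNTerm (A ⋎ bot p) A :=
  Sig p A ⊙ cOr (bot p) A

/-- `Δ∧' : A ⊢ A ∧ (p ∨ ¬p)` -/
def Del' (p : P) (A : PNFormula P) : PNTerm A (A ⋏ (letter p ⋎ negLetter p)) :=
  (one A ⩓ cOr (letter p) (negLetter p)) ⊙ Del p A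

/-- `Σ∨' : (¬p ∧ p) ∨ A ⊢ A` -/
def Sig' (p : P) (A : PNFormula P) : PNTerm ((negLetter p ⋏ letter p) ⋎ A) A :=
  Sig p A ⊙ (cAnd (negLetter p) (letter p) ⩔ one A)

/-- The equations of `PN`: `Eqn f g` means that `f = g` is one of them. -/
inductive Eqn : ∀ {A B : PNFormula P}, PNTerm A B → PNTerm A B → Prop
  | refl {A B} (f : PNTerm A B) : Eqn f f
  | symm {A B} {f g : PNTerm A B} : Eqn f g → Eqn g f
  | trans {A B} {f g h : PNTerm A B} : Eqn f g → Eqn g h → Eqn f h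
  | cong_comp {A B C} {f f₁ : PNTerm B C} {g g₁ : PNTerm A B} :
      Eqn f f₁ → Eqn g g₁ → Eqn (f ⊙ g) (f₁ ⊙ g₁)
  | cong_map (ξ : Conn) {A B D E} {f f₁ : PNTerm A D} {g g₁ : PNTerm B E} :
      Eqn f f₁ → Eqn g g₁ → Eqn (map ξ f g) (map ξ f₁ g₁)
  -- categorial equations
  | comp_one {A B} (f : PNTerm A B) : Eqn (f ⊙ one A) f
  | one_comp {A B} (f : PNTerm A B) : Eqn (one B ⊙ f) f
  | assoc {A B C D} (h : PNTerm C D) (g : PNTerm B C) (f : PNTerm A B) :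
      Eqn (h ⊙ (g ⊙ f)) ((h ⊙ g) ⊙ f)
  -- bifunctorial equations
  | map_one (ξ : Conn) (A B) : Eqn (map ξ (one A) (one B)) (one (bin ξ A B))
  | map_comp (ξ : Conn) {A₁ B₁ C₁ A₂ B₂ C₂} (g₁ : PNTerm B₁ C₁) (f₁ : PNTerm A₁ B₁)
      (g₂ : PNTerm B₂ C₂) (f₂ : PNTerm A₂ B₂) :
      Eqn (map ξ (g₁ ⊙ f₁) (g₂ ⊙ f₂)) (map ξ g₁ g₂ ⊙ map ξ f₁ f₂)
  -- naturality equations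
  | b_nat (ξ : Conn) {A B C D E F} (f : PNTerm A D) (g : PNTerm B E) (h : PNTerm C F) :
      Eqn (map ξ (map ξ f g) h ⊙ b ξ A B C) (b ξ D E F ⊙ map ξ f (map ξ g h))
  | cAnd_nat {A B D E} (f : PNTerm A D) (g : PNTerm B E) :
      Eqn ((g ⩓ f) ⊙ cAnd A B) (cAnd D E ⊙ (f ⩓ g))
  | cOr_nat {A B D E} (f : PNTerm A D) (g : PNTerm B E) :
      Eqn ((g ⩔ f) ⊙ cOr B A) (cOr E D ⊙ (f ⩔ g))
  | d_nat {A B C D E F} (f : PNTerm A D) (g : PNTerm B E) (h : PNTerm C F) :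
      Eqn (((f ⩓ g) ⩔ h) ⊙ d A B C) (d D E F ⊙ (f ⩓ (g ⩔ h)))
  -- associativity and commutativity
  | bInv_b (ξ : Conn) (A B C) : Eqn (bInv ξ A B C ⊙ b ξ A B C) (one (bin ξ A (bin ξ B C)))
  | b_bInv (ξ : Conn) (A B C) : Eqn (b ξ A B C ⊙ bInv ξ A B C) (one (bin ξ (bin ξ A B) C))
  | pentagon (ξ : Conn) (A B C D) :
      Eqn (bInv ξ A B (bin ξ C D) ⊙ bInv ξ (bin ξ A B) C D)
        (map ξ (one A) (bInv ξ B C D) ⊙ bInv ξ A (bin ξ B C) D ⊙ map ξ (bInv ξ A B C) (one D))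
  | cAnd_cAnd (A B) : Eqn (cAnd B A ⊙ cAnd A B) (one (A ⋏ B))
  | cOr_cOr (A B) : Eqn (cOr A B ⊙ cOr B A) (one (A ⋎ B))
  | hexagonAnd (A B C) :
      Eqn ((one B ⩓ cAnd C A) ⊙ bInv .and B C A ⊙ cAnd A (B ⋏ C) ⊙ bInv .and A B C ⊙
          (cAnd B A ⩓ one C))
        (bInv .and B A C)
  | hexagonOr (A B C) :
      Eqn ((one B ⩔ cOr A C) ⊙ bInv .or B C A ⊙ cOr (B ⋎ C) A ⊙ bInv .or A B C ⊙
          (cOr A B ⩔ one C))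
        (bInv .or B A C)
  -- equations for `d`
  | d_and (A B C D) :
      Eqn ((bInv .and A B C ⩔ one D) ⊙ d (A ⋏ B) C D)
        (d A (B ⋏ C) D ⊙ (one A ⩓ d B C D) ⊙ bInv .and A B (C ⋎ D))
  | d_or (A B C D) :
      Eqn (d D C (B ⋎ A) ⊙ (one D ⩓ bInv .or C B A))
        (bInv .or (D ⋏ C) B A ⊙ (d D C B ⩔ one A) ⊙ d D (C ⋎ B) A)
  | d_bAnd (A B C D) :
      Eqn (dR (A ⋏ B) C D ⊙ (d A B C ⩓ one D))
        (d A B (C ⋏ D) ⊙ (one A ⩓ dR B C D) ⊙ bInv .and A (B ⋎ C) D)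
  | d_bOr (A B C D) :
      Eqn ((one D ⩔ d C B A) ⊙ dR D C (B ⋎ A))
        (bInv .or D (C ⋏ B) A ⊙ (dR D C B ⩔ one A) ⊙ d (D ⋎ C) B A)
  -- equations for `Δ` and `Σ`
  | Del_nat (p : P) {A D} (f : PNTerm A D) :
      Eqn ((f ⩓ one (top p)) ⊙ Del p A) (Del p D ⊙ f)
  | Sig_nat (p : P) {A D} (f : PNTerm A D) :
      Eqn (f ⊙ Sig p A) (Sig p D ⊙ (one (bot p) ⩔ f))
  | b_Del (p : P) (A B) :
      Eqn (bInv .and A B (top p) ⊙ Del p (A ⋏ B)) (one A ⩓ Del p B)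
  | b_Sig (p : P) (A B) :
      Eqn (Sig p (B ⋎ A) ⊙ bInv .or (bot p) B A) (Sig p B ⩔ one A)
  | d_SigAnd (p : P) (B C) :
      Eqn (d (top p) B C ⊙ SigAnd p (B ⋎ C)) (SigAnd p B ⩔ one C)
  | d_DelOr (p : P) (B C) :
      Eqn (DelOr p (C ⋏ B) ⊙ d C B (bot p)) (one C ⩓ DelOr p B)
  | Sig_Del (p : P) :
      Eqn (Sig p (letter p) ⊙ d (letter p) (negLetter p) (letter p) ⊙ Del p (letter p))
        (one (letter p))
  | Sig'_Del' (p : P) :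
      Eqn (Sig' p (negLetter p) ⊙ d (negLetter p) (letter p) (negLetter p) ⊙
          Del' p (negLetter p))
        (one (negLetter p))

/-- The split equivalence `G f` of an arrow term `f`. -/
def graph : ∀ {A B : PNFormula P}, PNTerm A B → SplitEq (Fin A.len) (Fin B.len)
  | _, _, one _ => SplitEq.ofEquiv (Equiv.refl _)
  | _, _, b _ A B C => SplitEq.ofEquiv (finCongr (Nat.add_assoc A.len B.len C.len).symm)
  | _, _, bInv _ A B C => SplitEq.ofEquiv (finCongr (Nat.add_assoc A.len B.len C.len))
  | _, _, cAnd A B => SplitEq.ofEquiv (finAddFlip (m := A.len) (n := B.len))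
  | _, _, cOr A B => SplitEq.ofEquiv (finAddFlip (m := B.len) (n := A.len))
  | _, _, d A B C => SplitEq.ofEquiv (finCongr (Nat.add_assoc A.len B.len C.len).symm)
  | _, _, Del _ A => SplitEq.capRight A.len
  | _, _, Sig _ A => SplitEq.cupLeft A.len
  | _, _, comp f g => SplitEq.star f.graph g.graph
  | _, _, map _ f g => SplitEq.tensor f.graph g.graph

end PNTerm

namespace SplitEq

theorem star_ofEquiv {X Y Z : Type*} (e : X ≃ Y) (f : Y ≃ Z) :
    star (ofEquiv f) (ofEquiv e) = ofEquiv (e.trans f) := by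
  apply ext_sat
  intro φ χ
  simp only [sat_star, sat_ofEquiv]
  constructor
  · rintro ⟨ψ, rfl, rfl⟩
    rfl
  · rintro rfl
    exact ⟨χ ∘ f, rfl, rfl⟩

/-- Two bijections side by side. -/
def tensorEquiv {a b d e : ℕ} (f : Fin a ≃ Fin d) (g : Fin b ≃ Fin e) :
    Fin (a + b) ≃ Fin (d + e) :=
  (finSumFinEquiv.symm.trans (Equiv.sumCongr f g)).trans finSumFinEquiv

theorem tensor_ofEquiv {a b d e : ℕ} (f : Fin a ≃ Fin d) (g : Fin b ≃ Fin e) :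
    tensor (ofEquiv f) (ofEquiv g) = ofEquiv (tensorEquiv f g) := by
  apply ext_sat
  intro φ χ
  simp only [sat_tensor, sat_ofEquiv]
  constructor
  · rintro ⟨h1, h2⟩
    funext k
    refine Fin.addCases (fun k => ?_) (fun k => ?_) k
    · have := congrFun h1 k
      simpa [tensorEquiv] using this
    · have := congrFun h2 k
      simpa [tensorEquiv] using this
  · rintro rfl
    constructor <;> funext k <;> simp [tensorEquiv]

theorem finAddFlip_val {a b : ℕ} (k : Fin (a + b)) :
    (finAddFlip k : ℕ) = if (k : ℕ) < a then (k : ℕ) + b else k - a := by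
  refine Fin.addCases (fun k => ?_) (fun k => ?_) k
  · simp [add_comm]
  · simp

theorem sat_star_ofEquiv {X Y Z : Type*} (R : SplitEq X Y) (e : Y ≃ Z) (φ : X → Prop)
    (χ : Z → Prop) : Sat (star (ofEquiv e) R) φ χ ↔ Sat R φ (χ ∘ e) := by
  simp [sat_star, sat_ofEquiv]

theorem tensor_star {a₁ b₁ c₁ a₂ b₂ c₂ : ℕ} (P₁ : SplitEq (Fin b₁) (Fin c₁))
    (R₁ : SplitEq (Fin a₁) (Fin b₁)) (P₂ : SplitEq (Fin b₂) (Fin c₂))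
    (R₂ : SplitEq (Fin a₂) (Fin b₂)) :
    tensor (star P₁ R₁) (star P₂ R₂) = star (tensor P₁ P₂) (tensor R₁ R₂) := by
  apply ext_sat
  intro φ χ
  simp only [sat_star, sat_tensor]
  constructor
  · rintro ⟨⟨ψ, h1, h2⟩, ⟨ρ, h3, h4⟩⟩
    refine ⟨fun k => Sum.elim ψ ρ (finSumFinEquiv.symm k), ?_⟩
    have e1 : (fun k => Sum.elim ψ ρ (finSumFinEquiv.symm k)) ∘ Fin.castAdd b₂ = ψ := by
      funext k
      simp
    have e2 : (fun k => Sum.elim ψ ρ (finSumFinEquiv.symm k)) ∘ Fin.natAdd b₁ = ρ := by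
      funext k
      simp
    rw [e1, e2]
    exact ⟨⟨h1, h3⟩, h2, h4⟩
  · rintro ⟨ψ, ⟨h1, h3⟩, h2, h4⟩
    exact ⟨⟨_, h1, h2⟩, ⟨_, h3, h4⟩⟩

theorem sat_capRight {a : ℕ} (φ : Fin a → Prop) (χ : Fin (a + (1 + 1)) → Prop) :
    Sat (capRight a) φ χ ↔
      φ = χ ∘ Fin.castAdd (1 + 1) ∧ χ (Fin.natAdd a 0) = χ (Fin.natAdd a 1) := by
  have h : Sat (capRight a) φ χ ↔ _ := sat_tensor (a := a) (b := 0) _ _ φ χ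
  rw [h, sat_ofEquiv]
  refine and_congr Iff.rfl ?_
  constructor
  · intro h
    exact h (.inr 0) (.inr 1) trivial
  · rintro h (u | u) (v | v) -
    · exact u.elim0
    · exact u.elim0
    · exact v.elim0
    · fin_cases u <;> fin_cases v <;> first | rfl | exact h | exact h.symm

theorem sat_cupLeft {a : ℕ} (φ : Fin (1 + 1 + a) → Prop) (χ : Fin a → Prop) :
    Sat (cupLeft a) φ χ ↔
      φ (Fin.castAdd a 0) = φ (Fin.castAdd a 1) ∧ φ ∘ Fin.natAdd (1 + 1) = χ := by
  rw [cupLeft, sat_star_ofEquiv, sat_tensor, sat_ofEquiv]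
  have e : (χ ∘ finCongr (Nat.zero_add a)) ∘ Fin.natAdd 0 = χ := by
    funext k
    exact congrArg χ (Fin.ext (by simp))
  rw [e]
  refine and_congr ?_ Iff.rfl
  constructor
  · intro h
    exact h (.inl 0) (.inl 1) trivial
  · rintro h (u | u) (v | v) -
    · fin_cases u <;> fin_cases v <;> first | rfl | exact h | exact h.symm
    · exact v.elim0
    · exact u.elim0
    · exact u.elim0

/-- `R` is the split equivalence of a bijection that is given by the function `f` on numbers. -/
def Tracks {m n : ℕ} (R : SplitEq (Fin m) (Fin n)) (f : ℕ → ℕ) : Prop :=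
  ∃ e : Fin m ≃ Fin n, R = ofEquiv e ∧ ∀ k : Fin m, (e k : ℕ) = f k

theorem Tracks.eq {m n : ℕ} {R S : SplitEq (Fin m) (Fin n)} {f g : ℕ → ℕ} (hR : Tracks R f)
    (hS : Tracks S g) (h : ∀ k < m, f k = g k) : R = S := by
  obtain ⟨e, rfl, he⟩ := hR
  obtain ⟨e', rfl, he'⟩ := hS
  congr 1
  ext k
  rw [he, he', h k k.isLt]

theorem tracks_refl (n : ℕ) : Tracks (ofEquiv (Equiv.refl (Fin n))) (fun k => k) :=
  ⟨_, rfl, fun _ => rfl⟩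

theorem tracks_finCongr {m n : ℕ} (h : m = n) : Tracks (ofEquiv (finCongr h)) (fun k => k) :=
  ⟨_, rfl, fun _ => rfl⟩

theorem tracks_flip (a b : ℕ) : Tracks (ofEquiv (finAddFlip (m := a) (n := b)))
    (fun k => if k < a then k + b else k - a) :=
  ⟨_, rfl, finAddFlip_val⟩

theorem Tracks.star {a b c : ℕ} {P : SplitEq (Fin b) (Fin c)} {R : SplitEq (Fin a) (Fin b)}
    {f g : ℕ → ℕ} (hP : Tracks P g) (hR : Tracks R f) :
    Tracks (star P R) (fun k => g (f k)) := by
  obtain ⟨e, rfl, he⟩ := hR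
  obtain ⟨e', rfl, he'⟩ := hP
  exact ⟨_, star_ofEquiv e e', fun k => by simp [he, he']⟩

theorem Tracks.tensor {a b d e : ℕ} {R : SplitEq (Fin a) (Fin d)} {S : SplitEq (Fin b) (Fin e)}
    {f g : ℕ → ℕ} (hR : Tracks R f) (hS : Tracks S g) :
    Tracks (tensor R S) (fun k => if k < a then f k else d + g (k - a)) := by
  obtain ⟨r, rfl, hr⟩ := hR
  obtain ⟨s, rfl, hs⟩ := hS
  refine ⟨_, tensor_ofEquiv r s, fun k => ?_⟩
  refine Fin.addCases (fun k => ?_) (fun k => ?_) k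
  · simp [tensorEquiv, hr]
  · simp [tensorEquiv, hs]

/-- The predicates `φ` and `χ` on numbers, restricted to the source and the target of `R`, are
constant on the classes of `R`. -/
def SatN {m n : ℕ} (R : SplitEq (Fin m) (Fin n)) (φ χ : ℕ → Prop) : Prop :=
  Sat R (fun k => φ k) (fun k => χ k)

theorem exists_extension {n : ℕ} (φ : Fin n → Prop) : ∃ φ' : ℕ → Prop, φ = fun k : Fin n => φ' k :=
  ⟨fun k => ∃ h : k < n, φ ⟨k, h⟩, by
    funext k
    exact propext ⟨fun h => ⟨k.isLt, h⟩, fun ⟨_, h⟩ => h⟩⟩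

theorem ext_satN {m n : ℕ} {R S : SplitEq (Fin m) (Fin n)}
    (h : ∀ φ χ, SatN R φ χ ↔ SatN S φ χ) : R = S := by
  apply ext_sat
  intro φ χ
  obtain ⟨φ, rfl⟩ := exists_extension φ
  obtain ⟨χ, rfl⟩ := exists_extension χ
  exact h φ χ

theorem satN_congr {m n : ℕ} (R : SplitEq (Fin m) (Fin n)) {φ φ' χ χ' : ℕ → Prop}
    (h : ∀ k < m, φ k = φ' k) (h' : ∀ k < n, χ k = χ' k) : SatN R φ χ ↔ SatN R φ' χ' := by
  have e : (fun k : Fin m => φ k) = fun k : Fin m => φ' k := funext fun k => h k k.isLt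
  have e' : (fun k : Fin n => χ k) = fun k : Fin n => χ' k := funext fun k => h' k k.isLt
  rw [SatN, SatN, e, e']

theorem satN_star {a b c : ℕ} (P : SplitEq (Fin b) (Fin c)) (R : SplitEq (Fin a) (Fin b))
    (φ χ : ℕ → Prop) : SatN (star P R) φ χ ↔ ∃ ψ, SatN R φ ψ ∧ SatN P ψ χ := by
  rw [SatN, sat_star]
  constructor
  · rintro ⟨ψ, h⟩
    obtain ⟨ψ, rfl⟩ := exists_extension ψ
    exact ⟨ψ, h⟩
  · rintro ⟨ψ, h⟩
    exact ⟨_, h⟩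

theorem satN_tensor {a b d e : ℕ} (R : SplitEq (Fin a) (Fin d)) (S : SplitEq (Fin b) (Fin e))
    (φ χ : ℕ → Prop) : SatN (tensor R S) φ χ ↔
      SatN R φ χ ∧ SatN S (fun k => φ (a + k)) (fun k => χ (d + k)) :=
  sat_tensor R S _ _

theorem satN_refl {n : ℕ} (φ χ : ℕ → Prop) :
    SatN (ofEquiv (Equiv.refl (Fin n))) φ χ ↔ ∀ k < n, φ k = χ k := by
  rw [SatN, sat_ofEquiv, funext_iff, Fin.forall_iff]
  rfl

theorem satN_capRight {a : ℕ} (φ χ : ℕ → Prop) :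
    SatN (capRight a) φ χ ↔ (∀ k < a, φ k = χ k) ∧ χ a = χ (a + 1) := by
  rw [SatN, sat_capRight, funext_iff, Fin.forall_iff]
  rfl

theorem satN_cupLeft {a : ℕ} (φ χ : ℕ → Prop) :
    SatN (cupLeft a) φ χ ↔ φ 0 = φ 1 ∧ ∀ k < a, φ (2 + k) = χ k := by
  rw [SatN, sat_cupLeft, funext_iff, Fin.forall_iff]
  rfl

/-- Exchange of the first `a` arguments of a predicate with the next `b`. -/
def swap (a b : ℕ) (φ : ℕ → Prop) : ℕ → Prop := fun k => if k < b then φ (a + k) else φ (k - b)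

theorem satN_star_finCongr {a b c : ℕ} (h : b = c) (R : SplitEq (Fin a) (Fin b))
    (φ χ : ℕ → Prop) : SatN (star (ofEquiv (finCongr h)) R) φ χ ↔ SatN R φ χ := by
  subst h
  rw [SatN, sat_star_ofEquiv]
  rfl

theorem satN_finCongr_star {a b c : ℕ} (h : a = b) (R : SplitEq (Fin b) (Fin c))
    (φ χ : ℕ → Prop) : SatN (star R (ofEquiv (finCongr h))) φ χ ↔ SatN R φ χ := by
  subst h
  have : star R (ofEquiv (finCongr rfl)) = R := star_refl R
  rw [this]

theorem satN_flip {a b : ℕ} (φ χ : ℕ → Prop) :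
    SatN (ofEquiv (finAddFlip (m := a) (n := b))) φ χ ↔ ∀ k < a + b, φ k = swap b a χ k := by
  rw [SatN, sat_ofEquiv, funext_iff, Fin.forall_iff]
  refine forall_congr' fun k => forall_congr' fun hk => ?_
  have : (fun j : Fin (b + a) => χ j) (finAddFlip ⟨k, hk⟩) = swap b a χ k := by
    simp only [finAddFlip_val, swap]
    split_ifs
    · rw [add_comm]
    · rfl
  rw [← this]
  rfl

theorem swap_swap (a b : ℕ) (φ : ℕ → Prop) (k : ℕ) (h : k < a + b) :
    swap b a (swap a b φ) k = φ k := by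
  simp only [swap]
  split_ifs <;> first | omega | (congr 1; omega)

theorem satN_star_flip {a b c : ℕ} (R : SplitEq (Fin c) (Fin (a + b))) (φ χ : ℕ → Prop) :
    SatN (star (ofEquiv (finAddFlip (m := a) (n := b))) R) φ χ ↔ SatN R φ (swap b a χ) := by
  rw [satN_star]
  constructor
  · rintro ⟨ψ, h1, h2⟩
    rw [satN_flip] at h2
    exact (satN_congr R (fun _ _ => rfl) h2).1 h1
  · intro h
    exact ⟨_, h, (satN_flip _ _).2 fun _ _ => rfl⟩

theorem satN_flip_star {a b c : ℕ} (R : SplitEq (Fin (b + a)) (Fin c)) (φ χ : ℕ → Prop) :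
    SatN (star R (ofEquiv (finAddFlip (m := a) (n := b)))) φ χ ↔ SatN R (swap a b φ) χ := by
  rw [satN_star]
  constructor
  · rintro ⟨ψ, h1, h2⟩
    rw [satN_flip] at h1
    refine (satN_congr R (fun k hk => ?_) (fun _ _ => rfl)).1 h2
    simp only [swap]
    split_ifs with h3
    · rw [h1 (a + k) (by omega)]
      simp [swap]
    · rw [h1 (k - b) (by omega), swap, if_pos (by omega), show b + (k - b) = k by omega]
  · intro h
    exact ⟨_, (satN_flip _ _).2 fun k hk => (swap_swap a b φ k hk).symm, h⟩

theorem assoc_nat {a b c d e f : ℕ} (R : SplitEq (Fin a) (Fin d)) (S : SplitEq (Fin b) (Fin e))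
    (T : SplitEq (Fin c) (Fin f)) :
    star (tensor (tensor R S) T) (ofEquiv (finCongr (Nat.add_assoc a b c).symm)) =
      star (ofEquiv (finCongr (Nat.add_assoc d e f).symm)) (tensor R (tensor S T)) := by
  apply ext_satN
  intro φ χ
  simp only [satN_star_finCongr, satN_finCongr_star, satN_tensor, and_assoc, Nat.add_assoc]

theorem flip_nat {a b d e : ℕ} (R : SplitEq (Fin a) (Fin d)) (S : SplitEq (Fin b) (Fin e)) :
    star (tensor S R) (ofEquiv (finAddFlip (m := a) (n := b))) =
      star (ofEquiv (finAddFlip (m := d) (n := e))) (tensor R S) := by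
  apply ext_satN
  intro φ χ
  simp only [satN_star_flip, satN_flip_star, satN_tensor]
  rw [and_comm]
  refine and_congr (satN_congr R ?_ ?_) (satN_congr S ?_ ?_) <;> intro k hk <;> simp [swap, hk]

theorem capRight_nat {a d : ℕ} (R : SplitEq (Fin a) (Fin d)) :
    star (tensor R (ofEquiv (Equiv.refl (Fin (1 + 1))))) (capRight a) = star (capRight d) R := by
  apply ext_satN
  intro φ χ
  simp only [satN_star, satN_capRight, satN_tensor, satN_refl]
  constructor
  · rintro ⟨ψ, ⟨h1, h2⟩, h3, h4⟩
    refine ⟨χ, (satN_congr R (fun k hk => (h1 k hk).symm) fun _ _ => rfl).1 h3, fun _ _ => rfl, ?_⟩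
    exact (h4 0 (by omega)).symm.trans (h2.trans (h4 1 (by omega)))
  · rintro ⟨ψ, h1, h2, h3⟩
    refine ⟨fun k => if k < a then φ k else χ (d + (k - a)), ⟨fun k hk => by simp [hk], ?_⟩, ?_, ?_⟩
    · simpa using h3
    · exact (satN_congr R (fun k hk => by simp [hk]) h2).1 h1
    · intro k _
      simp

theorem cupLeft_nat {a d : ℕ} (R : SplitEq (Fin a) (Fin d)) :
    star R (cupLeft a) = star (cupLeft d) (tensor (ofEquiv (Equiv.refl (Fin (1 + 1)))) R) := by
  apply ext_satN
  intro φ χ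
  simp only [satN_star, satN_cupLeft, satN_tensor, satN_refl]
  constructor
  · rintro ⟨ψ, ⟨h1, h2⟩, h3⟩
    refine ⟨fun k => if k < 2 then φ k else χ (k - 2), ⟨fun k hk => ?_, ?_⟩, ?_, ?_⟩
    · simp [hk]
    · exact (satN_congr R (fun k hk => (h2 k hk).symm) (fun k _ => by
        dsimp only
        rw [if_neg (by omega), show 1 + 1 + k - 2 = k by omega])).1 h3
    · simpa using h1
    · intro k _
      dsimp only
      rw [if_neg (by omega), show 2 + k - 2 = k by omega]
  · rintro ⟨ψ, ⟨h1, h2⟩, h3, h4⟩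
    refine ⟨fun k => φ (2 + k), ⟨?_, fun _ _ => rfl⟩, ?_⟩
    · exact (h1 0 (by omega)).trans (h3.trans (h1 1 (by omega)).symm)
    · exact (satN_congr R (fun _ _ => rfl) h4).1 h2

theorem forall_lt_add {a b : ℕ} {p : ℕ → Prop} :
    (∀ k < a + b, p k) ↔ (∀ k < a, p k) ∧ ∀ k < b, p (a + k) := by
  constructor
  · exact fun h => ⟨fun k hk => h k (by omega), fun k hk => h _ (by omega)⟩
  · rintro ⟨h1, h2⟩ k hk
    by_cases h : k < a
    · exact h1 k h
    · have := h2 (k - a) (by omega)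
      rwa [show a + (k - a) = k by omega] at this

theorem assoc_capRight (a b : ℕ) :
    star (ofEquiv (finCongr (Nat.add_assoc a b (1 + 1)))) (capRight (a + b)) =
      tensor (ofEquiv (Equiv.refl (Fin a))) (capRight b) := by
  apply ext_satN
  intro φ χ
  simp only [satN_star_finCongr, satN_capRight, satN_tensor, satN_refl, forall_lt_add, and_assoc,
    Nat.add_assoc]

theorem cupLeft_assoc (a b : ℕ) :
    star (cupLeft (b + a)) (ofEquiv (finCongr (Nat.add_assoc (1 + 1) b a))) =
      tensor (cupLeft b) (ofEquiv (Equiv.refl (Fin a))) := by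
  apply ext_satN
  intro φ χ
  simp only [satN_finCongr_star, satN_cupLeft, satN_tensor, satN_refl, forall_lt_add, and_assoc,
    ← Nat.add_assoc]

theorem dist_capLeft (b c : ℕ) :
    star (ofEquiv (finCongr (Nat.add_assoc (1 + 1) b c).symm))
        (star (ofEquiv (finAddFlip (m := b + c) (n := 1 + 1))) (capRight (b + c))) =
      tensor (star (ofEquiv (finAddFlip (m := b) (n := 1 + 1))) (capRight b))
        (ofEquiv (Equiv.refl (Fin c))) := by
  apply ext_satN
  intro φ χ
  simp only [satN_star_finCongr, satN_star_flip, satN_capRight, satN_tensor, satN_refl,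
    forall_lt_add]
  have h1 : swap (1 + 1) (b + c) χ (b + c) = χ 0 := by simp [swap]
  have h2 : swap (1 + 1) (b + c) χ (b + c + 1) = χ 1 := by simp [swap]
  have h3 : swap (1 + 1) b χ b = χ 0 := by simp [swap]
  have h4 : swap (1 + 1) b χ (b + 1) = χ 1 := by simp [swap]
  have h5 : ∀ k < b, swap (1 + 1) (b + c) χ k = χ (2 + k) := fun k hk => if_pos (by omega)
  have h6 : ∀ k < c, swap (1 + 1) (b + c) χ (b + k) = χ (2 + b + k) := fun k hk =>
    (if_pos (by omega)).trans (by rw [← Nat.add_assoc])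
  have h7 : ∀ k < b, swap (1 + 1) b χ k = χ (2 + k) := fun k hk => if_pos (by omega)
  rw [h1, h2, h3, h4]
  constructor
  · rintro ⟨⟨ha, hb⟩, hc⟩
    exact ⟨⟨fun k hk => (ha k hk).trans ((h5 k hk).trans (h7 k hk).symm), hc⟩,
      fun k hk => (hb k hk).trans (h6 k hk)⟩
  · rintro ⟨⟨ha, hc⟩, hb⟩
    exact ⟨⟨fun k hk => (ha k hk).trans ((h7 k hk).trans (h5 k hk).symm),
      fun k hk => (hb k hk).trans (h6 k hk).symm⟩, hc⟩

theorem cupRight_dist (b c : ℕ) :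
    star (star (cupLeft (c + b)) (ofEquiv (finAddFlip (m := c + b) (n := 1 + 1))))
        (ofEquiv (finCongr (Nat.add_assoc c b (1 + 1)).symm)) =
      tensor (ofEquiv (Equiv.refl (Fin c)))
        (star (cupLeft b) (ofEquiv (finAddFlip (m := b) (n := 1 + 1)))) := by
  apply ext_satN
  intro φ χ
  simp only [satN_finCongr_star, satN_flip_star, satN_cupLeft, satN_tensor, satN_refl,
    forall_lt_add]
  have h1 : swap (c + b) (1 + 1) φ 0 = φ (c + b) := by simp [swap]
  have h2 : swap (c + b) (1 + 1) φ 1 = φ (c + b + 1) := by simp [swap]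
  have h3 : swap b (1 + 1) (fun k => φ (c + k)) 0 = φ (c + b) := by simp [swap]
  have h4 : swap b (1 + 1) (fun k => φ (c + k)) 1 = φ (c + b + 1) := by
    simp [swap, Nat.add_assoc]
  have h5 : ∀ k, swap (c + b) (1 + 1) φ (2 + k) = φ k := fun k =>
    (if_neg (by omega)).trans (by rw [show 2 + k - (1 + 1) = k by omega])
  have h6 : ∀ k, swap b (1 + 1) (fun k => φ (c + k)) (2 + k) = φ (c + k) := fun k =>
    (if_neg (by omega)).trans (by rw [show 2 + k - (1 + 1) = k by omega])
  simp only [h1, h2, h3, h4, h5, h6]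
  exact and_left_comm

theorem snake :
    star (cupLeft 1) (star (ofEquiv (finCongr (Nat.add_assoc 1 1 1).symm)) (capRight 1)) =
      ofEquiv (Equiv.refl (Fin 1)) := by
  apply ext_satN
  intro φ χ
  constructor
  · intro h
    obtain ⟨ψ, h, h'⟩ := (satN_star _ _ _ _).1 h
    rw [satN_star_finCongr, satN_capRight] at h
    rw [satN_cupLeft] at h'
    rw [satN_refl]
    intro k hk
    obtain rfl : k = 0 := by omega
    exact (h.1 0 hk).trans (h'.1.trans (h.2.trans (h'.2 0 hk)))
  · intro h
    rw [satN_refl] at h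
    refine (satN_star _ _ _ _).2 ⟨fun _ => φ 0, ?_, ?_⟩
    · rw [satN_star_finCongr, satN_capRight]
      refine ⟨fun k hk => ?_, rfl⟩
      obtain rfl : k = 0 := by omega
      rfl
    · rw [satN_cupLeft]
      refine ⟨rfl, fun k hk => ?_⟩
      obtain rfl : k = 0 := by omega
      exact h 0 hk

theorem snake' :
    star (star (cupLeft 1)
          (tensor (ofEquiv (finAddFlip (m := 1) (n := 1))) (ofEquiv (Equiv.refl (Fin 1)))))
        (star (ofEquiv (finCongr (Nat.add_assoc 1 1 1).symm))
          (star (tensor (ofEquiv (Equiv.refl (Fin 1))) (ofEquiv (finAddFlip (m := 1) (n := 1))))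
            (capRight 1))) =
      ofEquiv (Equiv.refl (Fin 1)) := by
  have hflip : ∀ φ χ, SatN (ofEquiv (finAddFlip (m := 1) (n := 1))) φ χ ↔
      φ 0 = χ 1 ∧ φ 1 = χ 0 := by
    intro φ χ
    rw [satN_flip]
    constructor
    · intro h
      exact ⟨h 0 (by omega), h 1 (by omega)⟩
    · rintro ⟨h1, h2⟩ k hk
      obtain rfl | rfl : k = 0 ∨ k = 1 := by omega
      · exact h1
      · exact h2
  have hrefl : ∀ φ χ, SatN (ofEquiv (Equiv.refl (Fin 1))) φ χ ↔ φ 0 = χ 0 := by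
    intro φ χ
    rw [satN_refl]
    simp
  apply ext_satN
  intro φ χ
  constructor
  · intro h
    obtain ⟨ψ, h, h'⟩ := (satN_star _ _ _ _).1 h
    rw [satN_star_finCongr] at h
    obtain ⟨ρ, h1, h2⟩ := (satN_star _ _ _ _).1 h
    obtain ⟨σ, h3, h4⟩ := (satN_star _ _ _ _).1 h'
    rw [satN_capRight] at h1
    rw [satN_cupLeft] at h4
    rw [satN_tensor, hrefl, hflip] at h2
    rw [satN_tensor, hrefl, hflip] at h3
    rw [hrefl]
    have e1 := h1.1 0 (by omega)
    have e2 := h4.2 0 (by omega)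
    exact e1.trans (h2.1.trans (h3.1.1.trans (h4.1.symm.trans (h3.1.2.symm.trans
      (h2.2.2.symm.trans (h1.2.symm.trans (h2.2.1.trans (h3.2.trans e2))))))))
  · intro h
    rw [hrefl] at h
    refine (satN_star _ _ _ _).2 ⟨fun _ => φ 0, ?_, (satN_star _ _ _ _).2 ⟨fun _ => φ 0, ?_, ?_⟩⟩
    · rw [satN_star_finCongr]
      refine (satN_star _ _ _ _).2 ⟨fun _ => φ 0, ?_, ?_⟩
      · rw [satN_capRight]
        refine ⟨fun k hk => ?_, rfl⟩
        obtain rfl : k = 0 := by omega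
        rfl
      · rw [satN_tensor, hrefl, hflip]
        exact ⟨rfl, rfl, rfl⟩
    · rw [satN_tensor, hrefl, hflip]
      exact ⟨⟨rfl, rfl⟩, rfl⟩
    · rw [satN_cupLeft]
      refine ⟨rfl, fun k hk => ?_⟩
      obtain rfl : k = 0 := by omega
      exact h

end SplitEq

namespace PNTerm

variable {P : Type u}

open SplitEq PNFormula

/-- The function on numbers that underlies the graph of an arrow term without `Δ` and `Σ`. -/
def num : ∀ {A B : PNFormula P}, PNTerm A B → ℕ → ℕ
  | _, _, cAnd A B => fun k => if k < A.len then k + B.len else k - A.len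
  | _, _, cOr A B => fun k => if k < B.len then k + A.len else k - B.len
  | _, _, comp f g => fun k => f.num (g.num k)
  | _, _, @map _ _ A _ D _ f g => fun k => if k < A.len then f.num k else D.len + g.num (k - A.len)
  | _, _, _ => fun k => k

/-- Neither `Δ` nor `Σ` occurs in the arrow term. -/
def NoCrown : ∀ {A B : PNFormula P}, PNTerm A B → Prop
  | _, _, Del _ _ => False
  | _, _, Sig _ _ => False
  | _, _, comp f g => f.NoCrown ∧ g.NoCrown
  | _, _, map _ f g => f.NoCrown ∧ g.NoCrown
  | _, _, _ => True

theorem tracks_graph {A B : PNFormula P} (f : PNTerm A B) (h : f.NoCrown) :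
    Tracks f.graph f.num := by
  induction f with
  | one A => exact tracks_refl _
  | b ξ A B C => exact tracks_finCongr _
  | bInv ξ A B C => exact tracks_finCongr _
  | cAnd A B => exact tracks_flip _ _
  | cOr A B => exact tracks_flip _ _
  | d A B C => exact tracks_finCongr _
  | Del p A => exact h.elim
  | Sig p A => exact h.elim
  | comp f g ihf ihg => exact (ihf h.1).star (ihg h.2)
  | map ξ f g ihf ihg => exact (ihf h.1).tensor (ihg h.2)

theorem graph_eq {A B : PNFormula P} {f g : PNTerm A B} (h : Eqn f g) : f.graph = g.graph := by
  induction h with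
  | refl f => rfl
  | symm _ ih => exact ih.symm
  | trans _ _ ih ih' => exact ih.trans ih'
  | cong_comp _ _ ih ih' => exact congrArg₂ star ih ih'
  | cong_map ξ _ _ ih ih' => exact congrArg₂ tensor ih ih'
  | comp_one f => exact star_refl _
  | one_comp f => exact refl_star _
  | assoc h g f => exact star_assoc _ _ _
  | map_comp ξ g₁ f₁ g₂ f₂ => exact tensor_star _ _ _ _
  | b_nat ξ f g h => exact assoc_nat _ _ _
  | cAnd_nat f g => exact flip_nat _ _
  | cOr_nat f g => exact flip_nat _ _
  | d_nat f g h => exact assoc_nat _ _ _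
  | Del_nat p f => exact capRight_nat _
  | Sig_nat p f => exact cupLeft_nat _
  | b_Del p A B => exact assoc_capRight _ _
  | b_Sig p A B => exact cupLeft_assoc _ _
  | d_SigAnd p B C => exact dist_capLeft _ _
  | d_DelOr p B C => exact cupRight_dist _ _
  | Sig_Del p => exact snake
  | Sig'_Del' p => exact snake'
  | _ =>
    refine Tracks.eq (tracks_graph _ ?_) (tracks_graph _ ?_) ?_
    · simp [NoCrown, dR]
    · simp [NoCrown, dR]
    · intro k hk
      simp only [len] at hk
      simp only [num, dR, len]
      try grind

end PNTerm

namespace PNTerm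

variable {P : Type u}

open SplitEq PNFormula

theorem graph_isBrauerian {A B : PNFormula P} (f : PNTerm A B) : f.graph.IsBrauerian := by
  induction f with
  | one A => exact .ofEquiv _
  | b ξ A B C => exact .ofEquiv _
  | bInv ξ A B C => exact .ofEquiv _
  | cAnd A B => exact .ofEquiv _
  | cOr A B => exact .ofEquiv _
  | d A B C => exact .ofEquiv _
  | Del p A => exact .capRight _
  | Sig p A => exact .cupLeft _
  | comp f g ihf ihg => exact ihf.star ihg
  | map ξ f g ihf ihg => exact ihf.tensor ihg

/-- Equality of arrow terms in `PN`. -/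
def eqnSetoid (A B : PNFormula P) : Setoid (PNTerm A B) where
  r := Eqn
  iseqv := ⟨Eqn.refl, Eqn.symm, Eqn.trans⟩

end PNTerm

/-! ### The category `PN` and the functor `G` -/

/-- The objects of the category `PN` over the set of letters `P` are formulae. -/
abbrev PN (P : Type u) := PNFormula P

/-- The arrows of `PN` are the classes of arrow terms modulo the equations of `PN`. -/
instance PN.category (P : Type u) : Category (PN P) where
  Hom A B := Quotient (PNTerm.eqnSetoid A B)
  id A := Quotient.mk _ (PNTerm.one A)
  comp g f := Quotient.map₂ (fun g f => PNTerm.comp f g)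
    (fun _ _ hg _ _ hf => PNTerm.Eqn.cong_comp hf hg) g f
  id_comp f := Quotient.inductionOn f fun f => Quotient.sound (PNTerm.Eqn.comp_one f)
  comp_id f := Quotient.inductionOn f fun f => Quotient.sound (PNTerm.Eqn.one_comp f)
  assoc f g h := Quotient.inductionOn₃ f g h fun f g h =>
    Quotient.sound (PNTerm.Eqn.assoc h g f)

/-- The functor `G` from `PN` to `Br`: on objects, the number of occurrences of letters; on arrows,
the split equivalence of any arrow term in the class. -/
def PN.G (P : Type u) : PN P ⥤ Br where
  obj A := Br.of A.len
  map f := Quotient.lift (fun f : PNTerm _ _ => (⟨f.graph, f.graph_isBrauerian⟩ : Br.of _ ⟶ Br.of _))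
    (fun _ _ h => Subtype.ext (PNTerm.graph_eq h)) f
  map_id _ := rfl
  map_comp f g := by
    obtain ⟨f, rfl⟩ := Quotient.exists_rep f
    obtain ⟨g, rfl⟩ := Quotient.exists_rep g
    rfl

/-! Faithfulness follows from cut elimination and from the uniqueness of cut-free proofs of formulae
in which no letter is repeated with the same sign.

There is no unit for `∧`, so a proof of `B` cannot be an arrow from a unit to `B`. Its place is
taken by an element, `El B`: a natural family of arrows `Z ⟶ Z ⋏ B` that behaves like the insertion
of a crown. Arrows act on elements, and elements of `A ∨ Γ` and `B ∨ Δ` have a tensor, an element of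
`(A ∧ B) ∨ Δ ∨ Γ`. Since `∨` has no unit either, the contexts `Γ` and `Δ` are optional formulae. The
cut-free proofs, `CF`, are the elements generated from the crowns by tensor and by rearrangement of
disjuncts.

Cut elimination is `Adm.all`: every arrow, acting on one disjunct in any context, takes cut-free
proofs to cut-free proofs. `CF.disjunct_induction` follows the disjunct back to the step that
introduces it, so only that step has to be examined. For `Σ` this reduces to an atomic cut against
an axiom, which `Adm.ax_cut` removes by a triangular equation between `Δ` and `Σ`.

By `exists_dual`, every `A` has a dual `A'`, with an element of `A ∨ A'` and a coelement of `A' ∧ A`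
that satisfy triangular identities. Hence `- ∧ A` is left adjoint to `- ∨ A'`, and by
`Dual.act_injective` an arrow `A ⟶ C` is determined by the element of `C ∨ A'` that corresponds to
it. This element is a cut-free proof.

A linear formula has at most one cut-free proof, `CF.eq_of_linear`. If one proof ends with a tensor,
then its premisses have no letter in common, because in a provable formula every letter is balanced.
This separation of letters allows any other proof to be rearranged so that it ends with the same
tensor, with the same division of the context (`CF.splits`), and induction applies. The
rearrangements themselves cause no ambiguity, by coherence of associativity and commutativity for
distinct disjuncts, `AC.eq_of_nodup`.

Finally, let two arrows `A ⟶ B` have the same graph. Label each occurrence of a letter with its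
class. Both arrows lift to the labelled formulae (`exists_lift`). Each class has two elements, so a
labelled letter occurs at most twice in source and target together, and balance makes the
disjunction of the labelled `B` with the dual of the labelled `A` linear. So the lifts are equal,
and erasing the labels gives the equality of the original arrows. -/

namespace PN

open PNFormula

variable {P : Type u}

/-! ### The structure of the category `PN` -/

/-- The action of a connective on arrows. -/
def bmap (ξ : Conn) {A B D E : PN P} (f : A ⟶ D) (g : B ⟶ E) :
    (bin ξ A B : PN P) ⟶ bin ξ D E :=
  Quotient.map₂ (PNTerm.map ξ) (fun _ _ hf _ _ hg => PNTerm.Eqn.cong_map ξ hf hg) f g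

infixr:81 " ⊼ " => PN.bmap Conn.and
infixr:81 " ⊻ " => PN.bmap Conn.or

/-- The class of an arrow term. -/
def mk {A B : PN P} (f : PNTerm A B) : A ⟶ B := Quotient.mk (PNTerm.eqnSetoid A B) f

theorem sound {A B : PN P} {f g : PNTerm A B} (h : PNTerm.Eqn f g) : mk f = mk g :=
  Quotient.sound h

theorem mk_comp {A B C : PN P} (f : PNTerm B C) (g : PNTerm A B) :
    mk (PNTerm.comp f g) = mk g ≫ mk f := rfl

theorem mk_map (ξ : Conn) {A B D E : PN P} (f : PNTerm A D) (g : PNTerm B E) :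
    mk (PNTerm.map ξ f g) = bmap ξ (mk f) (mk g) := rfl

theorem mk_one (A : PN P) : mk (PNTerm.one A) = 𝟙 A := rfl

theorem mk_surjective {A B : PN P} (f : A ⟶ B) : ∃ t : PNTerm A B, mk t = f :=
  Quotient.exists_rep f

@[simp] theorem bmap_id (ξ : Conn) (A B : PN P) : bmap ξ (𝟙 A) (𝟙 B) = 𝟙 _ :=
  sound (PNTerm.Eqn.map_one ξ A B)

theorem bmap_comp (ξ : Conn) {A₁ B₁ C₁ A₂ B₂ C₂ : PN P} (f₁ : A₁ ⟶ B₁) (g₁ : B₁ ⟶ C₁)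
    (f₂ : A₂ ⟶ B₂) (g₂ : B₂ ⟶ C₂) :
    bmap ξ f₁ f₂ ≫ bmap ξ g₁ g₂ = bmap ξ (f₁ ≫ g₁) (f₂ ≫ g₂) := by
  obtain ⟨f₁, rfl⟩ := mk_surjective f₁
  obtain ⟨f₂, rfl⟩ := mk_surjective f₂
  obtain ⟨g₁, rfl⟩ := mk_surjective g₁
  obtain ⟨g₂, rfl⟩ := mk_surjective g₂
  exact (sound (PNTerm.Eqn.map_comp ξ g₁ f₁ g₂ f₂)).symm

theorem bmap_comp_assoc (ξ : Conn) {A₁ B₁ C₁ A₂ B₂ C₂ D : PN P} (f₁ : A₁ ⟶ B₁) (g₁ : B₁ ⟶ C₁)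
    (f₂ : A₂ ⟶ B₂) (g₂ : B₂ ⟶ C₂) (h : bin ξ C₁ C₂ ⟶ D) :
    bmap ξ f₁ f₂ ≫ bmap ξ g₁ g₂ ≫ h = bmap ξ (f₁ ≫ g₁) (f₂ ≫ g₂) ≫ h := by
  rw [← Category.assoc, bmap_comp]

/-- Associativity of a connective. -/
def as (ξ : Conn) (A B C : PN P) :
    (bin ξ (bin ξ A B) C : PN P) ≅ bin ξ A (bin ξ B C) where
  hom := mk (PNTerm.bInv ξ A B C)
  inv := mk (PNTerm.b ξ A B C)
  hom_inv_id := sound (PNTerm.Eqn.b_bInv ξ A B C)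
  inv_hom_id := sound (PNTerm.Eqn.bInv_b ξ A B C)

/-- Commutativity of a connective. -/
def co : ∀ (ξ : Conn) (A B : PN P), (bin ξ A B : PN P) ≅ bin ξ B A
  | .and, A, B => ⟨mk (PNTerm.cAnd A B), mk (PNTerm.cAnd B A), sound (PNTerm.Eqn.cAnd_cAnd A B),
      sound (PNTerm.Eqn.cAnd_cAnd B A)⟩
  | .or, A, B => ⟨mk (PNTerm.cOr B A), mk (PNTerm.cOr A B), sound (PNTerm.Eqn.cOr_cOr A B),
      sound (PNTerm.Eqn.cOr_cOr B A)⟩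

/-- Distribution. -/
def di (A B C : PN P) : (A ⋏ (B ⋎ C) : PN P) ⟶ (A ⋏ B) ⋎ C := mk (PNTerm.d A B C)

theorem co_inv (ξ : Conn) (A B : PN P) : (co ξ A B).inv = (co ξ B A).hom := by
  cases ξ <;> rfl

@[simp] theorem co_co (ξ : Conn) (A B : PN P) : (co ξ A B).hom ≫ (co ξ B A).hom = 𝟙 _ := by
  rw [← co_inv ξ A B, Iso.hom_inv_id]

@[simp] theorem co_co_assoc (ξ : Conn) (A B : PN P) {C : PN P} (h : bin ξ A B ⟶ C) :
    (co ξ A B).hom ≫ (co ξ B A).hom ≫ h = h := by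
  rw [← Category.assoc, co_co, Category.id_comp]

theorem as_inv_nat (ξ : Conn) {A B C D E F : PN P} (f : A ⟶ D) (g : B ⟶ E) (h : C ⟶ F) :
    (as ξ A B C).inv ≫ bmap ξ (bmap ξ f g) h = bmap ξ f (bmap ξ g h) ≫ (as ξ D E F).inv := by
  obtain ⟨f, rfl⟩ := mk_surjective f
  obtain ⟨g, rfl⟩ := mk_surjective g
  obtain ⟨h, rfl⟩ := mk_surjective h
  exact sound (PNTerm.Eqn.b_nat ξ f g h)

theorem as_nat (ξ : Conn) {A B C D E F : PN P} (f : A ⟶ D) (g : B ⟶ E) (h : C ⟶ F) :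
    bmap ξ (bmap ξ f g) h ≫ (as ξ D E F).hom = (as ξ A B C).hom ≫ bmap ξ f (bmap ξ g h) := by
  rw [← Iso.inv_comp_eq, ← Category.assoc, as_inv_nat, Category.assoc, Iso.inv_hom_id,
    Category.comp_id]

theorem as_nat_assoc (ξ : Conn) {A B C D E F X : PN P} (f : A ⟶ D) (g : B ⟶ E) (h : C ⟶ F)
    (k : bin ξ D (bin ξ E F) ⟶ X) :
    bmap ξ (bmap ξ f g) h ≫ (as ξ D E F).hom ≫ k =
      (as ξ A B C).hom ≫ bmap ξ f (bmap ξ g h) ≫ k := by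
  rw [← Category.assoc, as_nat, Category.assoc]

theorem as_inv_nat_assoc (ξ : Conn) {A B C D E F X : PN P} (f : A ⟶ D) (g : B ⟶ E) (h : C ⟶ F)
    (k : bin ξ (bin ξ D E) F ⟶ X) :
    (as ξ A B C).inv ≫ bmap ξ (bmap ξ f g) h ≫ k =
      bmap ξ f (bmap ξ g h) ≫ (as ξ D E F).inv ≫ k := by
  rw [← Category.assoc, as_inv_nat, Category.assoc]

theorem co_nat (ξ : Conn) {A B D E : PN P} (f : A ⟶ D) (g : B ⟶ E) :
    (co ξ A B).hom ≫ bmap ξ g f = bmap ξ f g ≫ (co ξ D E).hom := by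
  obtain ⟨f, rfl⟩ := mk_surjective f
  obtain ⟨g, rfl⟩ := mk_surjective g
  cases ξ
  · exact sound (PNTerm.Eqn.cAnd_nat f g)
  · exact sound (PNTerm.Eqn.cOr_nat f g)

theorem co_nat_assoc (ξ : Conn) {A B D E X : PN P} (f : A ⟶ D) (g : B ⟶ E)
    (k : bin ξ E D ⟶ X) :
    (co ξ A B).hom ≫ bmap ξ g f ≫ k = bmap ξ f g ≫ (co ξ D E).hom ≫ k := by
  rw [← Category.assoc, co_nat, Category.assoc]

theorem di_nat {A B C D E F : PN P} (f : A ⟶ D) (g : B ⟶ E) (h : C ⟶ F) :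
    di A B C ≫ ((f ⊼ g) ⊻ h) = (f ⊼ (g ⊻ h)) ≫ di D E F := by
  obtain ⟨f, rfl⟩ := mk_surjective f
  obtain ⟨g, rfl⟩ := mk_surjective g
  obtain ⟨h, rfl⟩ := mk_surjective h
  exact sound (PNTerm.Eqn.d_nat f g h)

theorem di_nat_assoc {A B C D E F X : PN P} (f : A ⟶ D) (g : B ⟶ E) (h : C ⟶ F)
    (k : (D ⋏ E) ⋎ F ⟶ X) :
    di A B C ≫ ((f ⊼ g) ⊻ h) ≫ k = (f ⊼ (g ⊻ h)) ≫ di D E F ≫ k := by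
  rw [← Category.assoc, di_nat, Category.assoc]

theorem pentagon (ξ : Conn) (A B C D : PN P) :
    (as ξ (bin ξ A B) C D).hom ≫ (as ξ A B (bin ξ C D)).hom =
      bmap ξ (as ξ A B C).hom (𝟙 D) ≫ (as ξ A (bin ξ B C) D).hom ≫
        bmap ξ (𝟙 A) (as ξ B C D).hom := by
  have h := sound (PNTerm.Eqn.pentagon ξ A B C D)
  simp only [mk_comp, mk_map, mk_one, Category.assoc] at h
  exact h

theorem hexagon (ξ : Conn) (A B C : PN P) :
    bmap ξ (co ξ B A).hom (𝟙 C) ≫ (as ξ A B C).hom ≫ (co ξ A (bin ξ B C)).hom ≫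
      (as ξ B C A).hom ≫ bmap ξ (𝟙 B) (co ξ C A).hom = (as ξ B A C).hom := by
  cases ξ
  · have h := sound (PNTerm.Eqn.hexagonAnd A B C)
    simp only [mk_comp, mk_map, mk_one, Category.assoc] at h
    exact h
  · have h := sound (PNTerm.Eqn.hexagonOr A B C)
    simp only [mk_comp, mk_map, mk_one, Category.assoc] at h
    exact h

/-- The distribution `(C ∨ B) ∧ A ⊢ C ∨ (B ∧ A)`. -/
def diR (C B A : PN P) : ((C ⋎ B) ⋏ A : PN P) ⟶ C ⋎ (B ⋏ A) :=
  (co .and (C ⋎ B) A).hom ≫ (𝟙 A ⊼ (co .or C B).hom) ≫ di A B C ≫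
    ((co .and A B).hom ⊻ 𝟙 C) ≫ (co .or (B ⋏ A) C).hom

theorem mk_dR (C B A : PN P) : mk (PNTerm.dR C B A) = diR C B A := by
  simp only [PNTerm.dR, mk_comp, mk_map, mk_one, Category.assoc]
  rfl

theorem di_as_and (A B C D : PN P) :
    di (A ⋏ B) C D ≫ ((as .and A B C).hom ⊻ 𝟙 D) =
      (as .and A B (C ⋎ D)).hom ≫ (𝟙 A ⊼ di B C D) ≫ di A (B ⋏ C) D := by
  have h := sound (PNTerm.Eqn.d_and A B C D)
  simp only [mk_comp, mk_map, mk_one, Category.assoc] at h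
  exact h

theorem di_as_or (A B C D : PN P) :
    (𝟙 D ⊼ (as .or C B A).hom) ≫ di D C (B ⋎ A) =
      di D (C ⋎ B) A ≫ (di D C B ⊻ 𝟙 A) ≫ (as .or (D ⋏ C) B A).hom := by
  have h := sound (PNTerm.Eqn.d_or A B C D)
  simp only [mk_comp, mk_map, mk_one, Category.assoc] at h
  exact h

theorem diR_di_and (A B C D : PN P) :
    (di A B C ⊼ 𝟙 D) ≫ diR (A ⋏ B) C D =
      (as .and A (B ⋎ C) D).hom ≫ (𝟙 A ⊼ diR B C D) ≫ di A B (C ⋏ D) := by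
  have h := sound (PNTerm.Eqn.d_bAnd A B C D)
  simp only [mk_comp, mk_map, mk_one, mk_dR, Category.assoc] at h
  exact h

theorem diR_di_or (A B C D : PN P) :
    diR D C (B ⋎ A) ≫ (𝟙 D ⊻ di C B A) =
      di (D ⋎ C) B A ≫ (diR D C B ⊻ 𝟙 A) ≫ (as .or D (C ⋏ B) A).hom := by
  have h := sound (PNTerm.Eqn.d_bOr A B C D)
  simp only [mk_comp, mk_map, mk_one, mk_dR, Category.assoc] at h
  exact h

/-- Insertion of the crown `¬p ∨ p`. -/
def del (p : P) (A : PN P) : A ⟶ A ⋏ top p := mk (PNTerm.Del p A)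

/-- Deletion of the crown `p ∧ ¬p`. -/
def sig (p : P) (A : PN P) : (bot p ⋎ A : PN P) ⟶ A := mk (PNTerm.Sig p A)

theorem del_nat (p : P) {A D : PN P} (f : A ⟶ D) :
    del p A ≫ (f ⊼ 𝟙 (top p)) = f ≫ del p D := by
  obtain ⟨f, rfl⟩ := mk_surjective f
  exact sound (PNTerm.Eqn.Del_nat p f)

theorem sig_nat (p : P) {A D : PN P} (f : A ⟶ D) :
    sig p A ≫ f = (𝟙 (bot p) ⊻ f) ≫ sig p D := by
  obtain ⟨f, rfl⟩ := mk_surjective f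
  exact sound (PNTerm.Eqn.Sig_nat p f)

theorem sig_nat_assoc (p : P) {A D X : PN P} (f : A ⟶ D) (g : D ⟶ X) :
    sig p A ≫ f ≫ g = (𝟙 (bot p) ⊻ f) ≫ sig p D ≫ g := by
  rw [← Category.assoc, sig_nat, Category.assoc]

theorem del_as (p : P) (A B : PN P) :
    del p (A ⋏ B) ≫ (as .and A B (top p)).hom = 𝟙 A ⊼ del p B :=
  sound (PNTerm.Eqn.b_Del p A B)

theorem as_sig (p : P) (A B : PN P) :
    (as .or (bot p) B A).hom ≫ sig p (B ⋎ A) = sig p B ⊻ 𝟙 A :=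
  sound (PNTerm.Eqn.b_Sig p A B)

theorem del_di (p : P) (B C : PN P) :
    del p (B ⋎ C) ≫ (co .and _ _).hom ≫ di (top p) B C =
      (del p B ≫ (co .and _ _).hom) ⊻ 𝟙 C := by
  have h := sound (PNTerm.Eqn.d_SigAnd p B C)
  simp only [PNTerm.SigAnd, mk_comp, mk_map, mk_one, Category.assoc] at h
  exact h

theorem di_sig (p : P) (B C : PN P) :
    di C B (bot p) ≫ (co .or _ _).hom ≫ sig p (C ⋏ B) =
      𝟙 C ⊼ ((co .or _ _).hom ≫ sig p B) := by
  have h := sound (PNTerm.Eqn.d_DelOr p B C)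
  simp only [PNTerm.DelOr, mk_comp, mk_map, mk_one] at h
  exact h

theorem del_sig (p : P) :
    del p (letter p) ≫ di (letter p) (negLetter p) (letter p) ≫ sig p (letter p) = 𝟙 _ := by
  have h := sound (PNTerm.Eqn.Sig_Del p)
  simp only [mk_comp, mk_one, Category.assoc] at h
  exact h

theorem del_sig' (p : P) :
    del p (negLetter p) ≫ (𝟙 _ ⊼ (co .or (negLetter p) (letter p)).hom) ≫
      di (negLetter p) (letter p) (negLetter p) ≫
      ((co .and (negLetter p) (letter p)).hom ⊻ 𝟙 _) ≫ sig p (negLetter p) = 𝟙 _ := by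
  have h := sound (PNTerm.Eqn.Sig'_Del' p)
  simp only [PNTerm.Sig', PNTerm.Del', mk_comp, mk_map, mk_one, Category.assoc] at h
  exact h

/-! ### Associativity and commutativity -/

section
variable (ξ : Conn)

/-- The exchange of the last two of three formulae. -/
def sw (A L N : PN P) : (bin ξ (bin ξ A L) N : PN P) ≅ bin ξ (bin ξ A N) L where
  hom := (as ξ A L N).hom ≫ bmap ξ (𝟙 A) (co ξ L N).hom ≫ (as ξ A N L).inv
  inv := (as ξ A N L).hom ≫ bmap ξ (𝟙 A) (co ξ N L).hom ≫ (as ξ A L N).inv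
  hom_inv_id := by simp [bmap_comp_assoc]
  inv_hom_id := by simp [bmap_comp_assoc]

theorem sw_hom (A L N : PN P) : (sw ξ A L N).hom =
    (as ξ A L N).hom ≫ bmap ξ (𝟙 A) (co ξ L N).hom ≫ (as ξ A N L).inv := rfl

@[simp] theorem sw_sw (A L N : PN P) : (sw ξ A L N).hom ≫ (sw ξ A N L).hom = 𝟙 _ :=
  (sw ξ A L N).hom_inv_id

@[simp] theorem sw_sw_assoc (A L N : PN P) {X : PN P} (h : bin ξ (bin ξ A L) N ⟶ X) :
    (sw ξ A L N).hom ≫ (sw ξ A N L).hom ≫ h = h :=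
  (sw ξ A L N).hom_inv_id_assoc h

theorem sw_nat {A L N A' L' N' : PN P} (f : A ⟶ A') (g : L ⟶ L') (h : N ⟶ N') :
    bmap ξ (bmap ξ f g) h ≫ (sw ξ A' L' N').hom =
      (sw ξ A L N).hom ≫ bmap ξ (bmap ξ f h) g := by
  simp only [sw_hom, Category.assoc, as_inv_nat, as_nat_assoc, bmap_comp_assoc, co_nat,
    Category.comp_id, Category.id_comp]

theorem sw_nat_assoc {A L N A' L' N' X : PN P} (f : A ⟶ A') (g : L ⟶ L') (h : N ⟶ N')
    (k : bin ξ (bin ξ A' N') L' ⟶ X) :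
    bmap ξ (bmap ξ f g) h ≫ (sw ξ A' L' N').hom ≫ k =
      (sw ξ A L N).hom ≫ bmap ξ (bmap ξ f h) g ≫ k := by
  rw [← Category.assoc, sw_nat, Category.assoc]

/-- The hexagon, solved for the commutativity of a compound. -/
theorem as_co_left (B A C : PN P) :
    (as ξ A B C).hom ≫ (co ξ A (bin ξ B C)).hom =
      bmap ξ (co ξ A B).hom (𝟙 C) ≫ (sw ξ B A C).hom := by
  have h := hexagon ξ A B C
  rw [sw_hom, ← h]
  simp [bmap_comp_assoc]

theorem co_as_inv (A B C : PN P) :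
    (co ξ (bin ξ B C) A).hom ≫ (as ξ A B C).inv =
      (sw ξ B C A).hom ≫ bmap ξ (co ξ B A).hom (𝟙 C) := by
  rw [← cancel_epi (co ξ A (bin ξ B C)).hom, co_co_assoc,
    ← cancel_epi (as ξ A B C).hom, Iso.hom_inv_id]
  rw [reassoc_of% (as_co_left ξ B A C), sw_sw_assoc, bmap_comp]
  simp

end

/-! ### Disjunctions with an optional second disjunct -/

/-- `X ∨ R`, or `X` when `R` is missing. -/
abbrev oo (X : PN P) : Option (PN P) → PN P
  | none => X
  | some R => X ⋎ R

/-- The disjunction of two optional formulae. -/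
abbrev oplus : Option (PN P) → Option (PN P) → Option (PN P)
  | none, R => R
  | some L, R => some (oo L R)

/-- Arrows between optional formulae. -/
inductive OHom : Option (PN P) → Option (PN P) → Type u
  | none : OHom none none
  | some {R R' : PN P} (r : R ⟶ R') : OHom (some R) (some R')

/-- The functoriality of `oo`. -/
def oo2 {X Y : PN P} (f : X ⟶ Y) : ∀ {R R' : Option (PN P)}, OHom R R' → (oo X R ⟶ oo Y R')
  | _, _, .none => f
  | _, _, .some r => f ⊻ r

namespace OHom

/-- The identity of an optional formula. -/
def id : ∀ R : Option (PN P), OHom R R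
  | .none => .none
  | .some R => .some (𝟙 R)

/-- Composition of arrows between optional formulae. -/
def comp : ∀ {R S T : Option (PN P)}, OHom R S → OHom S T → OHom R T
  | _, _, _, .none, .none => .none
  | _, _, _, .some r, .some s => .some (r ≫ s)

/-- The functoriality of `oplus`. -/
def oplus : ∀ {R S R' S' : Option (PN P)}, OHom R R' → OHom S S' →
    OHom (PN.oplus R S) (PN.oplus R' S')
  | _, _, _, _, .none, s => s
  | _, _, _, _, .some r, s => .some (oo2 r s)

end OHom

/-- The functoriality of `oo` in its first argument. -/
abbrev oo1 {X Y : PN P} (f : X ⟶ Y) (R : Option (PN P)) : oo X R ⟶ oo Y R := oo2 f (OHom.id R)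

theorem oo2_comp {X Y Z : PN P} (f : X ⟶ Y) (g : Y ⟶ Z) {R S T : Option (PN P)} (r : OHom R S)
    (s : OHom S T) : oo2 f r ≫ oo2 g s = oo2 (f ≫ g) (r.comp s) := by
  cases r <;> cases s
  · rfl
  · exact bmap_comp _ _ _ _ _

@[simp] theorem oo2_id (X : PN P) (R : Option (PN P)) : oo2 (𝟙 X) (OHom.id R) = 𝟙 _ := by
  cases R
  · rfl
  · exact bmap_id _ _ _

@[simp] theorem OHom.id_comp {R S : Option (PN P)} (r : OHom R S) : (OHom.id R).comp r = r := by
  cases r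
  · rfl
  · simp [OHom.id, OHom.comp]

@[simp] theorem OHom.comp_id {R S : Option (PN P)} (r : OHom R S) : r.comp (OHom.id S) = r := by
  cases r
  · rfl
  · simp [OHom.id, OHom.comp]

/-- Associativity for optional disjuncts. -/
def asc (X : PN P) : ∀ Δ Γ : Option (PN P), oo (oo X Δ) Γ ≅ oo X (oplus Δ Γ)
  | none, _ => Iso.refl _
  | some _, none => Iso.refl _
  | some D, some G => as .or X D G

theorem asc_nat {X Y : PN P} (f : X ⟶ Y) {Δ Δ' Γ Γ' : Option (PN P)} (r : OHom Δ Δ')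
    (s : OHom Γ Γ') :
    oo2 (oo2 f r) s ≫ (asc Y Δ' Γ').hom = (asc X Δ Γ).hom ≫ oo2 f (r.oplus s) := by
  cases r
  · exact (Category.comp_id _).trans (Category.id_comp _).symm
  · cases s
    · exact (Category.comp_id _).trans (Category.id_comp _).symm
    · exact as_nat _ _ _ _

/-! ### Arrows of associativity and commutativity of disjunction -/

/-- The arrows built from associativity and commutativity of `∨`. -/
inductive AC : ∀ {S T : PN P}, (S ⟶ T) → Prop
  | id (S) : AC (𝟙 S)
  | comp {S T U} {f : S ⟶ T} {g : T ⟶ U} : AC f → AC g → AC (f ≫ g)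
  | map {S T U V} {f : S ⟶ T} {g : U ⟶ V} : AC f → AC g → AC (f ⊻ g)
  | as (A B C) : AC (as .or A B C).hom
  | co (A B) : AC (co .or A B).hom

/-- The version of `AC` for optional formulae. -/
inductive OHom.AC : ∀ {R R' : Option (PN P)}, OHom R R' → Prop
  | none : OHom.AC OHom.none
  | some {R R'} {r : R ⟶ R'} : PN.AC r → OHom.AC (OHom.some r)

/-- Two applications of the hexagon. Its use is that a class of arrows closed under composition and
containing `as` and `co` also contains the inverse of `as`, so neither `AC` nor `Adm` needs a
separate treatment of it. -/
theorem as_inv_eq (ξ : Conn) (A B C : PN P) :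
    (co ξ A (bin ξ B C)).hom ≫ (as ξ B C A).hom ≫ (co ξ B (bin ξ C A)).hom ≫ (as ξ C A B).hom ≫
      (co ξ C (bin ξ A B)).hom = (as ξ A B C).inv := by
  rw [reassoc_of% (as_co_left ξ C B A)]
  simp only [sw_hom, Category.assoc, Iso.inv_hom_id_assoc]
  rw [← co_nat, reassoc_of% (as_co_left ξ B C A), bmap_comp_assoc]
  have h := co_as_inv ξ A B C
  simp only [co_co, Category.comp_id, bmap_id, Category.id_comp]
  rw [← h, co_co_assoc]

namespace AC

theorem as_inv (A B C : PN P) : AC (PN.as .or A B C).inv := by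
  rw [← as_inv_eq]
  exact (co _ _).comp ((as _ _ _).comp ((co _ _).comp ((as _ _ _).comp (co _ _))))

theorem exists_inverse {S T : PN P} {f : S ⟶ T} (h : AC f) :
    ∃ g : T ⟶ S, AC g ∧ f ≫ g = 𝟙 S ∧ g ≫ f = 𝟙 T := by
  induction h with
  | id S => exact ⟨𝟙 S, .id S, by simp, by simp⟩
  | comp _ _ ih ih' =>
    obtain ⟨g, hg, h1, h2⟩ := ih
    obtain ⟨g', hg', h1', h2'⟩ := ih'
    exact ⟨g' ≫ g, hg'.comp hg, by simp [reassoc_of% h1', h1], by simp [reassoc_of% h2, h2']⟩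
  | map _ _ ih ih' =>
    obtain ⟨g, hg, h1, h2⟩ := ih
    obtain ⟨g', hg', h1', h2'⟩ := ih'
    exact ⟨g ⊻ g', hg.map hg', by simp [bmap_comp, h1, h1'], by simp [bmap_comp, h2, h2']⟩
  | as A B C => exact ⟨_, as_inv A B C, by simp, by simp⟩
  | co A B => exact ⟨_, co B A, by simp, by simp⟩

theorem sw (A L N : PN P) : AC (PN.sw .or A L N).hom :=
  (as _ _ _).comp ((map (id _) (co _ _)).comp (as_inv _ _ _))

theorem asc (X : PN P) (Δ Γ : Option (PN P)) : AC (PN.asc X Δ Γ).hom := by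
  cases Δ
  · exact id _
  · cases Γ
    · exact id _
    · exact as _ _ _

theorem asc_inv (X : PN P) (Δ Γ : Option (PN P)) : AC (PN.asc X Δ Γ).inv := by
  cases Δ
  · exact id _
  · cases Γ
    · exact id _
    · exact as_inv _ _ _

theorem oo2 {X Y : PN P} {f : X ⟶ Y} (hf : AC f) {R R' : Option (PN P)} {r : OHom R R'}
    (hr : r.AC) : AC (PN.oo2 f r) := by
  cases hr with
  | none => exact hf
  | some hr => exact hf.map hr

end AC

namespace OHom.AC

theorem id (R : Option (PN P)) : (OHom.id R).AC := by
  cases R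
  · exact none
  · exact some (.id _)

theorem comp {R S T : Option (PN P)} {r : OHom R S} {s : OHom S T} (hr : r.AC) (hs : s.AC) :
    (r.comp s).AC := by
  cases hr with
  | none => cases hs; exact none
  | some hr => cases hs with | some hs => exact some (hr.comp hs)

theorem oplus {R S R' S' : Option (PN P)} {r : OHom R R'} {s : OHom S S'} (hr : r.AC)
    (hs : s.AC) : (r.oplus s).AC := by
  cases hr with
  | none => exact hs
  | some hr => exact some (hr.oo2 hs)

end OHom.AC

/-! ### Disjuncts and their extraction -/

/-- The multiset of disjuncts of a formula. -/
def atoms : PN P → Multiset (PN P)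
  | letter p => {letter p}
  | negLetter p => {negLetter p}
  | bin .and A B => {bin .and A B}
  | bin .or A B => atoms A + atoms B

/-- The multiset of disjuncts of an optional formula. -/
def oatoms : Option (PN P) → Multiset (PN P)
  | none => 0
  | some R => atoms R

@[simp] theorem atoms_or (A B : PN P) : atoms (A ⋎ B) = atoms A + atoms B := rfl

@[simp] theorem atoms_oo (A : PN P) (R : Option (PN P)) : atoms (oo A R) = atoms A + oatoms R := by
  cases R
  · exact (add_zero _).symm
  · rfl

@[simp] theorem oatoms_oplus (R S : Option (PN P)) :
    oatoms (oplus R S) = oatoms R + oatoms S := by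
  cases R
  · exact (zero_add _).symm
  · exact atoms_oo _ _

theorem exists_mem_atoms (A : PN P) : ∃ a, a ∈ atoms A := by
  induction A with
  | letter p => exact ⟨_, Multiset.mem_singleton_self _⟩
  | negLetter p => exact ⟨_, Multiset.mem_singleton_self _⟩
  | bin ξ A B ihA _ =>
    cases ξ
    · exact ⟨_, Multiset.mem_singleton_self _⟩
    · obtain ⟨a, ha⟩ := ihA
      exact ⟨a, Multiset.mem_add.2 (.inl ha)⟩

theorem atoms_of_mem {A a : PN P} (h : a ∈ atoms A) : atoms a = {a} := by
  induction A with
  | letter p => rw [Multiset.mem_singleton.1 h]; rfl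
  | negLetter p => rw [Multiset.mem_singleton.1 h]; rfl
  | bin ξ A B ihA ihB =>
    cases ξ
    · rw [Multiset.mem_singleton.1 h]; rfl
    · exact (Multiset.mem_add.1 h).elim ihA ihB

/-- The hypothesis `atoms a = {a}` is the working form of "`a` is a single disjunct". It discards
the case `Ext.refl` whenever the formula at hand is a disjunction. -/
theorem ne_or_of_atoms {a : PN P} (h : atoms a = {a}) (A B : PN P) : a ≠ A ⋎ B := by
  rintro rfl
  obtain ⟨x, hx⟩ := exists_mem_atoms A
  obtain ⟨y, hy⟩ := exists_mem_atoms B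
  have h1 := congrArg Multiset.card h
  have h2 := Multiset.card_pos_iff_exists_mem.2 ⟨x, hx⟩
  have h3 := Multiset.card_pos_iff_exists_mem.2 ⟨y, hy⟩
  simp at h1
  omega

theorem AC.atoms_eq {S T : PN P} {f : S ⟶ T} (h : AC f) : atoms S = atoms T := by
  induction h with
  | id S => rfl
  | comp _ _ ih ih' => exact ih.trans ih'
  | map _ _ ih ih' => simp [ih, ih']
  | as A B C => simp [add_assoc]
  | co A B => simp [add_comm]

/-- The arrow `e : S ⊢ a ∨ R` brings an occurrence of the disjunct `a` of `S` to the front. -/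
inductive Ext (a : PN P) : ∀ (S : PN P) (R : Option (PN P)), (S ⟶ oo a R) → Prop
  | refl : Ext a a none (𝟙 a)
  | left {S R e} (M) : Ext a S R e →
      Ext a (S ⋎ M) (oplus R (some M)) ((e ⊻ 𝟙 M) ≫ (asc a R (some M)).hom)
  | right {S R e} (M) : Ext a S R e →
      Ext a (M ⋎ S) (oplus R (some M)) ((co .or M S).hom ≫ (e ⊻ 𝟙 M) ≫ (asc a R (some M)).hom)

theorem Ext.ac {a S : PN P} {R : Option (PN P)} {e : S ⟶ oo a R} (h : Ext a S R e) : AC e := by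
  induction h with
  | refl => exact .id _
  | left M _ ih => exact (ih.map (.id _)).comp (.asc _ _ _)
  | right M _ ih => exact (AC.co _ _).comp ((ih.map (.id _)).comp (.asc _ _ _))

theorem Ext.exists_of_mem {a S : PN P} (h : a ∈ atoms S) : ∃ R e, Ext a S R e := by
  induction S with
  | letter p => rw [Multiset.mem_singleton.1 h]; exact ⟨_, _, .refl⟩
  | negLetter p => rw [Multiset.mem_singleton.1 h]; exact ⟨_, _, .refl⟩
  | bin ξ A B ihA ihB =>
    cases ξ
    · rw [Multiset.mem_singleton.1 h]; exact ⟨_, _, .refl⟩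
    · rcases Multiset.mem_add.1 h with h | h
      · obtain ⟨R, e, h⟩ := ihA h
        exact ⟨_, _, h.left B⟩
      · obtain ⟨R, e, h⟩ := ihB h
        exact ⟨_, _, h.right A⟩

/-! ### Extraction of a disjunct and coherence of rearrangements. -/

theorem sw_as (ξ : Conn) (A M N : PN P) : (sw ξ A M N).hom ≫ (as ξ A N M).hom =
    (as ξ A M N).hom ≫ bmap ξ (𝟙 A) (co ξ M N).hom := by
  simp [sw_hom]

theorem as_inv_pentagon (ξ : Conn) (A B C D : PN P) :
    (as ξ (bin ξ A B) C D).inv ≫ bmap ξ (as ξ A B C).hom (𝟙 D) ≫ (as ξ A (bin ξ B C) D).hom =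
      (as ξ A B (bin ξ C D)).hom ≫ bmap ξ (𝟙 A) (as ξ B C D).inv := by
  rw [Iso.inv_comp_eq, reassoc_of% (pentagon ξ A B C D), bmap_comp, Iso.hom_inv_id,
    Category.comp_id, bmap_id, Category.comp_id]

theorem sw_pentagon (ξ : Conn) (A B C D : PN P) :
    (sw ξ (bin ξ A B) C D).hom ≫ bmap ξ (as ξ A B D).hom (𝟙 C) ≫ (as ξ A (bin ξ B D) C).hom =
      bmap ξ (as ξ A B C).hom (𝟙 D) ≫ (as ξ A (bin ξ B C) D).hom ≫
        bmap ξ (𝟙 A) (sw ξ B C D).hom := by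
  have e : bmap ξ (𝟙 A) (sw ξ B C D).hom = bmap ξ (𝟙 A) (as ξ B C D).hom ≫
      bmap ξ (𝟙 A) (bmap ξ (𝟙 B) (co ξ C D).hom) ≫ bmap ξ (𝟙 A) (as ξ B D C).inv := by
    simp [bmap_comp, sw_hom]
  rw [e, ← reassoc_of% (pentagon ξ A B C D), ← as_nat_assoc, bmap_id, sw_hom]
  simp only [Category.assoc]
  rw [as_inv_pentagon]

/-- Reassociating before extracting `a` only changes the order and grouping of what remains. This
lemma, `asc_sw` and `asc_co` settle the associativity case of `exists_ext_of_ac` when `a` lies in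
the first, second or third disjunct; for a nonempty remainder each comes down to the pentagon. -/
theorem asc_as (a : PN P) (R : Option (PN P)) (M N : PN P) :
    ∃ ρ : OHom (oplus (oplus R (some M)) (some N)) (oplus R (some (M ⋎ N))), ρ.AC ∧
      (as .or (oo a R) M N).hom ≫ (asc a R (some (M ⋎ N))).hom =
        ((asc a R (some M)).hom ⊻ 𝟙 N) ≫ (asc a (oplus R (some M)) (some N)).hom ≫
          oo2 (𝟙 a) ρ := by
  cases R with
  | none =>
    have h : (as .or a M N).hom ≫ 𝟙 _ = (𝟙 _ ⊻ 𝟙 N) ≫ (as .or a M N).hom ≫ (𝟙 a ⊻ 𝟙 (M ⋎ N)) := by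
      simp
    exact ⟨.some (𝟙 (M ⋎ N)), .some (.id _), h⟩
  | some R => exact ⟨.some (as .or R M N).hom, .some (.as _ _ _), pentagon _ _ _ _ _⟩

theorem asc_sw (a : PN P) (R : Option (PN P)) (M N : PN P) :
    ∃ ρ : OHom (oplus (oplus R (some M)) (some N)) (oplus (oplus R (some N)) (some M)), ρ.AC ∧
      (sw .or (oo a R) M N).hom ≫ ((asc a R (some N)).hom ⊻ 𝟙 M) ≫
          (asc a (oplus R (some N)) (some M)).hom =
        ((asc a R (some M)).hom ⊻ 𝟙 N) ≫ (asc a (oplus R (some M)) (some N)).hom ≫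
          oo2 (𝟙 a) ρ := by
  cases R with
  | none =>
    have h : (sw .or a M N).hom ≫ (𝟙 _ ⊻ 𝟙 M) ≫ (as .or a N M).hom =
        (𝟙 _ ⊻ 𝟙 N) ≫ (as .or a M N).hom ≫ (𝟙 a ⊻ (co .or M N).hom) := by
      simp [sw_as]
    exact ⟨.some (co .or M N).hom, .some (.co _ _), h⟩
  | some R => exact ⟨.some (sw .or R M N).hom, .some (.sw _ _ _), sw_pentagon _ _ _ _ _⟩

theorem asc_co (a : PN P) (R : Option (PN P)) (L M : PN P) :
    ∃ ρ : OHom (oplus R (some (L ⋎ M))) (oplus (oplus R (some M)) (some L)), ρ.AC ∧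
      (𝟙 (oo a R) ⊻ (co .or L M).hom) ≫ (as .or (oo a R) M L).inv ≫
        ((asc a R (some M)).hom ⊻ 𝟙 L) ≫ (asc a (oplus R (some M)) (some L)).hom =
      (asc a R (some (L ⋎ M))).hom ≫ oo2 (𝟙 a) ρ := by
  cases R with
  | none =>
    have h : (𝟙 a ⊻ (co .or L M).hom) ≫ (as .or a M L).inv ≫ (𝟙 _ ⊻ 𝟙 L) ≫ (as .or a M L).hom =
        𝟙 _ ≫ (𝟙 a ⊻ (co .or L M).hom) := by
      simp
    exact ⟨.some (co .or L M).hom, .some (.co _ _), h⟩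
  | some R =>
    have h : (𝟙 (a ⋎ R) ⊻ (co .or L M).hom) ≫ (as .or (a ⋎ R) M L).inv ≫
        ((as .or a R M).hom ⊻ 𝟙 L) ≫ (as .or a (R ⋎ M) L).hom =
        (as .or a R (L ⋎ M)).hom ≫ (𝟙 a ⊻ ((𝟙 R ⊻ (co .or L M).hom) ≫ (as .or R M L).inv)) := by
      have e : (𝟙 a ⊻ ((𝟙 R ⊻ (co .or L M).hom) ≫ (as .or R M L).inv)) =
          (𝟙 a ⊻ (𝟙 R ⊻ (co .or L M).hom)) ≫ (𝟙 a ⊻ (as .or R M L).inv) := by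
        simp [bmap_comp]
      rw [e, ← as_nat_assoc, bmap_id, as_inv_pentagon]
    exact ⟨.some ((𝟙 R ⊻ (co .or L M).hom) ≫ (as .or R M L).inv),
      .some (((AC.id _).map (.co _ _)).comp (.as_inv _ _ _)), h⟩

/-- Every arrow of associativity and commutativity takes disjuncts to disjuncts. -/
theorem exists_ext_of_ac {a : PN P} (ha : atoms a = {a}) {S T : PN P} {σ : S ⟶ T} (h : AC σ) :
    ∀ {R' : Option (PN P)} {e' : T ⟶ oo a R'}, Ext a T R' e' →
      ∃ (R : Option (PN P)) (e : S ⟶ oo a R) (ρ : OHom R R'),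
        Ext a S R e ∧ ρ.AC ∧ σ ≫ e' = e ≫ oo2 (𝟙 a) ρ := by
  have hor := ne_or_of_atoms ha
  induction h with
  | id S =>
    intro R' e' he
    exact ⟨R', e', OHom.id _, he, .id _, by simp⟩
  | comp _ _ ih ih' =>
    intro R' e' he
    obtain ⟨R₁, e₁, ρ₁, he₁, hρ₁, h₁⟩ := ih' he
    obtain ⟨R₂, e₂, ρ₂, he₂, hρ₂, h₂⟩ := ih he₁
    exact ⟨R₂, e₂, ρ₂.comp ρ₁, he₂, hρ₂.comp hρ₁, by
      rw [Category.assoc, h₁, reassoc_of% h₂, oo2_comp, Category.comp_id]⟩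
  | @map S T U V f g hf hg ih ih' =>
    intro R' e' he
    cases he with
    | refl => exact absurd rfl (hor _ _)
    | @left _ R₁ e₁ _ he =>
      obtain ⟨R, e, ρ, he, hρ, h⟩ := ih he
      refine ⟨_, _, ρ.oplus (.some g), he.left _, hρ.oplus (.some hg), ?_⟩
      have h2 := asc_nat (𝟙 a) ρ (.some g)
      rw [bmap_comp_assoc, h, Category.assoc, ← h2]
      simp only [oo2]
      rw [bmap_comp_assoc]
      simp
    | @right _ R₁ e₁ _ he =>
      obtain ⟨R, e, ρ, he, hρ, h⟩ := ih' he
      refine ⟨_, _, ρ.oplus (.some f), he.right _, hρ.oplus (.some hf), ?_⟩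
      have h2 := asc_nat (𝟙 a) ρ (.some f)
      rw [← co_nat_assoc, bmap_comp_assoc, h, Category.assoc, Category.assoc, ← h2]
      simp only [oo2]
      rw [bmap_comp_assoc]
      simp
  | as L M N =>
    intro R' e' he
    cases he with
    | refl => exact absurd rfl (hor _ _)
    | @left _ R e₁ _ he =>
      obtain ⟨ρ, hρ, h⟩ := asc_as a R M N
      refine ⟨_, _, ρ, (he.left M).left N, hρ, ?_⟩
      have h3 := as_nat_assoc Conn.or e₁ (𝟙 M) (𝟙 N) (asc a R (some (M ⋎ N))).hom
      rw [bmap_id] at h3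
      rw [← h3, h]
      simp only [Category.assoc]
      rw [bmap_comp_assoc, Category.comp_id]
    | @right _ R e₁ _ he =>
      cases he with
      | refl => exact absurd rfl (hor _ _)
      | @left _ R e₁ _ he =>
        obtain ⟨ρ, hρ, h⟩ := asc_sw a R L N
        refine ⟨_, _, ρ, (he.right L).left N, hρ, ?_⟩
        rw [reassoc_of% (as_co_left Conn.or M L N)]
        have h3 := sw_nat_assoc Conn.or e₁ (𝟙 L) (𝟙 N) (((asc a R (some N)).hom ⊻ 𝟙 L) ≫
          (asc a (oplus R (some N)) (some L)).hom)
        rw [h] at h3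
        have e : ((e₁ ⊻ 𝟙 N) ≫ (asc a R (some N)).hom) ⊻ 𝟙 L =
            ((e₁ ⊻ 𝟙 N) ⊻ 𝟙 L) ≫ ((asc a R (some N)).hom ⊻ 𝟙 L) := by simp [bmap_comp]
        rw [e]
        simp only [Category.assoc]
        rw [← h3]
        simp only [bmap_comp_assoc, Category.comp_id]
      | @right _ R e₁ _ he =>
        obtain ⟨ρ, hρ, h⟩ := asc_co a R L M
        refine ⟨_, _, ρ, he.right (L ⋎ M), hρ, ?_⟩
        have e : ((co .or M N).hom ≫ (e₁ ⊻ 𝟙 M) ≫ (asc a R (some M)).hom) ⊻ 𝟙 L =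
            ((co .or M N).hom ⊻ 𝟙 L) ≫ ((e₁ ⊻ 𝟙 M) ⊻ 𝟙 L) ≫
              ((asc a R (some M)).hom ⊻ 𝟙 L) := by simp [bmap_comp]
        rw [reassoc_of% (as_co_left Conn.or M L N), e]
        simp only [Category.assoc]
        have h4 := co_as_inv Conn.or N M L
        rw [← reassoc_of% h4, ← co_nat_assoc, as_inv_nat_assoc, ← h, bmap_comp_assoc,
          bmap_comp_assoc, bmap_id]
        simp
  | co L M =>
    intro R' e' he
    cases he with
    | refl => exact absurd rfl (hor _ _)
    | @left _ R e₁ _ he => exact ⟨_, _, OHom.id _, he.right L, .id _, by simp⟩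
    | @right _ R e₁ _ he => exact ⟨_, _, OHom.id _, he.left M, .id _, by simp⟩

/-- When the disjuncts are distinct, `a` has one place in `S`, and the place determines every step
of the extraction. The remainder is part of the data, whence the equality of dependent pairs. -/
theorem Ext.unique {a S : PN P} (ha : atoms a = {a}) {R R' : Option (PN P)} {e : S ⟶ oo a R}
    {e' : S ⟶ oo a R'} (h : Ext a S R e) (hS : (atoms S).Nodup) (h' : Ext a S R' e') :
    (⟨R, e⟩ : Σ R, S ⟶ oo a R) = ⟨R', e'⟩ := by
  have hor := ne_or_of_atoms ha
  have hmem : ∀ {S R} {e : S ⟶ oo a R}, Ext a S R e → a ∈ atoms S := by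
    intro S R e h
    rw [h.ac.atoms_eq, atoms_oo, ha]
    simp
  induction h generalizing R' with
  | refl =>
    cases h' with
    | refl => rfl
    | left => exact absurd rfl (hor _ _)
    | right => exact absurd rfl (hor _ _)
  | @left S R e M h ih =>
    rw [atoms_or, Multiset.nodup_add] at hS
    cases h' with
    | refl => exact absurd rfl (hor _ _)
    | left _ h' =>
      have := ih hS.1 h'
      cases this
      rfl
    | right _ h' => exact absurd (hmem h') (Multiset.disjoint_left.1 hS.2.2 (hmem h))
  | @right S R e M h ih =>
    rw [atoms_or, Multiset.nodup_add] at hS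
    cases h' with
    | refl => exact absurd rfl (hor _ _)
    | right _ h' =>
      have := ih hS.2.1 h'
      cases this
      rfl
    | left _ h' => exact absurd (hmem h) (Multiset.disjoint_left.1 hS.2.2 (hmem h'))

theorem card_atoms_lt {a T R : PN P} (h : atoms T = {a} + atoms R) :
    (atoms R).card < (atoms T).card := by
  rw [h]
  simp

/-- Coherence of associativity and commutativity for formulae with distinct disjuncts. -/
theorem AC.eq_of_nodup {S T : PN P} (hT : (atoms T).Nodup) {σ σ' : S ⟶ T} (h : AC σ)
    (h' : AC σ') : σ = σ' := by
  obtain ⟨a, ha⟩ := exists_mem_atoms T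
  have ha' := atoms_of_mem ha
  obtain ⟨R', e', he'⟩ := Ext.exists_of_mem ha
  obtain ⟨R₁, e₁, ρ₁, he₁, hρ₁, h₁⟩ := exists_ext_of_ac ha' h he'
  obtain ⟨R₂, e₂, ρ₂, he₂, hρ₂, h₂⟩ := exists_ext_of_ac ha' h' he'
  have hS : (atoms S).Nodup := by rwa [h.atoms_eq]
  -- Both arrows, followed by the extraction `e'`, factor through one and the same extraction from
  -- `S`. They can differ only on the remainder, which has fewer disjuncts.
  have hu := he₁.unique ha' hS he₂
  cases hu
  have hR := he'.ac.atoms_eq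
  rw [atoms_oo, ha'] at hR
  have hρ : ρ₁ = ρ₂ := by
    cases hρ₁ with
    | none => cases hρ₂; rfl
    | some hr =>
      cases hρ₂ with
      | some hr' =>
        have := card_atoms_lt hR
        rw [AC.eq_of_nodup (by
          change _ = _ + atoms _ at hR
          rw [hR, Multiset.nodup_add] at hT
          exact hT.2.1) hr hr']
  obtain ⟨g, -, hg, -⟩ := he'.ac.exists_inverse
  have e : σ ≫ e' = σ' ≫ e' := by rw [h₁, h₂, hρ]
  have := congrArg (· ≫ g) e
  simpa [hg] using this
termination_by (atoms T).card

theorem exists_mem_oatoms_of_some (R : PN P) : oatoms (some R) ≠ 0 := by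
  obtain ⟨a, ha⟩ := exists_mem_atoms R
  exact fun h => Multiset.eq_zero_iff_forall_notMem.1 h a ha

/-- Bring the same disjunct to the front on both sides and recurse on the remainders. -/
theorem exists_ac {S T : PN P} (h : atoms S = atoms T) : ∃ σ : S ⟶ T, AC σ := by
  obtain ⟨a, ha⟩ := exists_mem_atoms T
  have ha' := atoms_of_mem ha
  obtain ⟨R', e', he'⟩ := Ext.exists_of_mem ha
  obtain ⟨R, e, he⟩ := Ext.exists_of_mem (h ▸ ha : a ∈ atoms S)
  obtain ⟨g, hg, -⟩ := he'.ac.exists_inverse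
  have hR' := he'.ac.atoms_eq
  have hR := he.ac.atoms_eq
  rw [atoms_oo, ha'] at hR hR'
  have hRR : oatoms R = oatoms R' := add_left_cancel (hR.symm.trans (h.trans hR'))
  match R, R' with
  | none, none => exact ⟨e ≫ g, he.ac.comp hg⟩
  | none, some R' => exact absurd hRR.symm (exists_mem_oatoms_of_some R')
  | some R, none => exact absurd hRR (exists_mem_oatoms_of_some R)
  | some R, some R' =>
    have := card_atoms_lt hR'
    obtain ⟨σ, hσ⟩ := exists_ac (S := R) (T := R') hRR
    exact ⟨e ≫ (𝟙 a ⊻ σ) ≫ g, he.ac.comp (((AC.id a).map hσ).comp hg)⟩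
termination_by (atoms T).card

theorem exists_ohom_ac {R R' : Option (PN P)} (h : oatoms R = oatoms R') :
    ∃ ρ : OHom R R', ρ.AC := by
  match R, R' with
  | none, none => exact ⟨.none, .none⟩
  | none, some R' => exact absurd h.symm (exists_mem_oatoms_of_some R')
  | some R, none => exact absurd h (exists_mem_oatoms_of_some R)
  | some R, some R' =>
    obtain ⟨σ, hσ⟩ := exists_ac (S := R) (T := R') h
    exact ⟨.some σ, .some hσ⟩

theorem exists_oatoms_eq (m : Multiset (PN P)) (h : ∀ a ∈ m, atoms a = {a}) :
    ∃ R, oatoms R = m := by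
  induction m using Multiset.induction_on with
  | empty => exact ⟨none, rfl⟩
  | cons a m ih =>
    obtain ⟨R, hR⟩ := ih fun b hb => h b (Multiset.mem_cons_of_mem hb)
    refine ⟨some (oo a R), ?_⟩
    change atoms (oo a R) = _
    rw [atoms_oo, hR, h a (Multiset.mem_cons_self a m)]
    rfl

theorem exists_ac_of_le {A G : PN P} (h : atoms A ≤ atoms G) :
    ∃ (R : Option (PN P)) (σ : G ⟶ oo A R), AC σ := by
  obtain ⟨m, hm⟩ := Multiset.le_iff_exists_add.1 h
  obtain ⟨R, hR⟩ := exists_oatoms_eq m fun a ha =>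
    atoms_of_mem (hm ▸ Multiset.mem_add.2 (.inr ha) : a ∈ atoms G)
  exact ⟨R, exists_ac (by rw [hm, atoms_oo, hR])⟩

/-! ### Elements -/

/-- An element of `B`: a natural family of arrows `Z ⊢ Z ∧ B` that is compatible with
associativity and distribution. -/
@[ext] structure El (B : PN P) where
  app (Z : PN P) : Z ⟶ Z ⋏ B
  nat {Z W : PN P} (f : Z ⟶ W) : f ≫ app W = app Z ≫ (f ⊼ 𝟙 B)
  app_and (Z W : PN P) : app (Z ⋏ W) ≫ (as .and Z W B).hom = 𝟙 Z ⊼ app W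
  app_or (Z W : PN P) : app (Z ⋎ W) ≫ (co .and _ _).hom ≫ di B Z W =
    (app Z ≫ (co .and _ _).hom) ⊻ 𝟙 W

namespace El

/-- The element of `¬p ∨ p`. -/
def ax (p : P) : El (top p : PN P) where
  app := del p
  nat f := (del_nat p f).symm
  app_and := del_as p
  app_or := del_di p

theorem nat_assoc {B : PN P} (e : El B) {Z W X : PN P} (f : Z ⟶ W) (g : W ⋏ B ⟶ X) :
    f ≫ e.app W ≫ g = e.app Z ≫ (f ⊼ 𝟙 B) ≫ g := by
  rw [← Category.assoc, e.nat, Category.assoc]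

/-- The image of an element by an arrow. -/
def act {B C : PN P} (e : El B) (f : B ⟶ C) : El C where
  app Z := e.app Z ≫ (𝟙 Z ⊼ f)
  nat g := by
    rw [e.nat_assoc, Category.assoc, bmap_comp, bmap_comp]
    simp
  app_and Z W := by
    rw [Category.assoc, ← bmap_id, as_nat, reassoc_of% e.app_and, bmap_comp, Category.comp_id]
  app_or Z W := by
    have h := reassoc_of% (e.app_or Z W)
    have h2 := di_nat f (𝟙 Z) (𝟙 W)
    rw [bmap_id] at h2
    rw [Category.assoc, ← co_nat_assoc, ← h2, h, bmap_comp, Category.assoc, co_nat]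
    simp

@[simp] theorem act_app {B C : PN P} (e : El B) (f : B ⟶ C) (Z : PN P) :
    (e.act f).app Z = e.app Z ≫ (𝟙 Z ⊼ f) := rfl

theorem act_act {B C D : PN P} (e : El B) (f : B ⟶ C) (g : C ⟶ D) :
    (e.act f).act g = e.act (f ≫ g) := by
  ext Z
  simp [bmap_comp]

@[simp] theorem act_id {B : PN P} (e : El B) : e.act (𝟙 B) = e := by
  ext Z
  simp

/-- Between `Z` and `B` it does not matter which neighbour receives the insertion. The axiom
`app_and` only covers insertion at the far right; naturality along commutativity carries it to the
middle. -/
theorem app_bmap_as {A : PN P} (x : El A) (Z B : PN P) :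
    (x.app Z ⊼ 𝟙 B) ≫ (as .and Z A B).hom = 𝟙 Z ⊼ (x.app B ≫ (co .and B A).hom) := by
  have h1 := x.app_and Z B
  have h2 := x.nat (co .and Z B).hom
  have h3 := x.app_and B Z
  rw [← Iso.eq_comp_inv] at h3
  have h4 : x.app (Z ⋏ B) = (co .and Z B).hom ≫ x.app (B ⋏ Z) ≫ ((co .and B Z).hom ⊼ 𝟙 A) := by
    rw [reassoc_of% h2, bmap_comp]
    simp
  have h5 := reassoc_of% (co_as_inv Conn.and B Z A)
  have e : (𝟙 Z ⊼ (x.app B ≫ (co .and B A).hom)) =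
      (𝟙 Z ⊼ x.app B) ≫ (𝟙 Z ⊼ (co .and B A).hom) := by simp [bmap_comp]
  rw [e, ← h1, h4, h3]
  simp only [Category.assoc]
  rw [co_nat_assoc, h5, bmap_comp_assoc, co_co, Category.comp_id, bmap_id, Category.id_comp,
    reassoc_of% sw_as, bmap_comp, co_co, Category.comp_id, bmap_id, Category.comp_id]

/-- The pairing of elements is symmetric. -/
theorem act_app_comm {A B : PN P} (x : El A) (y : El B) :
    x.act (y.app A) = (y.act (x.app B)).act (co .and B A).hom := by
  ext Z
  -- By `app_and`, inserting `y` next to `A` is inserting it next to `Z ∧ A`; naturality of `y`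
  -- along `x.app Z` then lets `y` be inserted first.
  rw [act_act, act_app, act_app, ← y.app_and, y.nat_assoc, app_bmap_as]

end El

/-! ### The tensor of elements -/

/-- Distribution with an optional disjunct. -/
def dO (A B : PN P) : ∀ Δ : Option (PN P), A ⋏ oo B Δ ⟶ oo (A ⋏ B) Δ
  | none => 𝟙 _
  | some D => di A B D

theorem dO_nat {A B C D : PN P} (f : A ⟶ C) (g : B ⟶ D) {Δ Δ' : Option (PN P)}
    (r : OHom Δ Δ') : dO A B Δ ≫ oo2 (f ⊼ g) r = (f ⊼ oo2 g r) ≫ dO C D Δ' := by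
  cases r
  · exact (Category.id_comp _).trans (Category.comp_id _).symm
  · exact di_nat _ _ _

theorem dO_as (A B C : PN P) (Δ : Option (PN P)) :
    dO (A ⋏ B) C Δ ≫ oo1 (as .and A B C).hom Δ =
      (as .and A B (oo C Δ)).hom ≫ (𝟙 A ⊼ dO B C Δ) ≫ dO A (B ⋏ C) Δ := by
  cases Δ
  · have h : 𝟙 _ ≫ (as .and A B C).hom = (as .and A B C).hom ≫ (𝟙 A ⊼ 𝟙 (B ⋏ C)) ≫ 𝟙 _ := by simp
    exact h
  · exact di_as_and _ _ _ _

theorem dO_asc (A B C : PN P) (Δ : Option (PN P)) :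
    (𝟙 A ⊼ (asc B (some C) Δ).hom) ≫ dO A B (oplus (some C) Δ) =
      dO A (B ⋎ C) Δ ≫ oo1 (di A B C) Δ ≫ (asc (A ⋏ B) (some C) Δ).hom := by
  cases Δ
  · have h : (𝟙 A ⊼ 𝟙 (B ⋎ C)) ≫ di A B C = 𝟙 _ ≫ di A B C ≫ 𝟙 _ := by simp
    exact h
  · exact di_as_or _ _ _ _

/-- The exchange of two optional disjuncts. -/
def swo (X : PN P) : ∀ Γ Δ : Option (PN P), oo (oo X Γ) Δ ≅ oo (oo X Δ) Γ
  | none, _ => Iso.refl _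
  | some _, none => Iso.refl _
  | some G, some D => sw .or X G D

theorem AC.swo (X : PN P) (Γ Δ : Option (PN P)) : AC (PN.swo X Γ Δ).hom := by
  cases Γ
  · exact .id _
  · cases Δ
    · exact .id _
    · exact .sw _ _ _

theorem swo_nat {X Y : PN P} (f : X ⟶ Y) {Γ Γ' Δ Δ' : Option (PN P)} (r : OHom Γ Γ')
    (s : OHom Δ Δ') :
    oo2 (oo2 f r) s ≫ (swo Y Γ' Δ').hom = (swo X Γ Δ).hom ≫ oo2 (oo2 f s) r := by
  cases r
  · exact (Category.comp_id _).trans (Category.id_comp _).symm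
  · cases s
    · exact (Category.comp_id _).trans (Category.id_comp _).symm
    · exact sw_nat _ _ _ _

theorem swo_swo (X : PN P) (Γ Δ : Option (PN P)) :
    (swo X Γ Δ).hom ≫ (swo X Δ Γ).hom = 𝟙 _ := by
  cases Γ
  · cases Δ
    · exact Category.comp_id _
    · exact Category.comp_id _
  · cases Δ
    · exact Category.comp_id _
    · exact sw_sw _ _ _ _

/-- Distribution with the disjunction on the left of the conjunction. -/
def dl (A G Y : PN P) : ((A ⋎ G) ⋏ Y : PN P) ⟶ (A ⋏ Y) ⋎ G :=
  (co .and _ _).hom ≫ di Y A G ≫ ((co .and _ _).hom ⊻ 𝟙 G)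

theorem diR_eq (C B A : PN P) :
    diR C B A = ((co .or C B).hom ⊼ 𝟙 A) ≫ dl B C A ≫ (co .or (B ⋏ A) C).hom := by
  simp only [diR, dl, Category.assoc]
  rw [co_nat_assoc]

/-- The axiom relating `d` and `d^R` on disjunctions, with the outer disjuncts moved to the right:
taking out `G` and then `D`, or `D` and then `G`, gives the same up to their exchange. -/
theorem dl_di (A G B D : PN P) :
    dl A G (B ⋎ D) ≫ (di A B D ⊻ 𝟙 G) =
      di (A ⋎ G) B D ≫ (dl A G B ⊻ 𝟙 D) ≫ (sw .or _ _ _).hom := by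
  have h := diR_di_or D B A G
  rw [diR_eq, diR_eq] at h
  have e : dl A G (B ⋎ D) = ((co .or A G).hom ⊼ 𝟙 (B ⋎ D)) ≫
      (((co .or G A).hom ⊼ 𝟙 _) ≫ dl A G (B ⋎ D) ≫ (co .or (A ⋏ (B ⋎ D)) G).hom) ≫
      (co .or _ _).hom := by
    simp [bmap_comp_assoc]
  rw [e]
  simp only [Category.assoc] at h ⊢
  rw [co_nat, reassoc_of% h]
  have h1 := as_co_left Conn.or (A ⋏ B) G D
  have e2 : ((((co .or G A).hom ⊼ 𝟙 B) ≫ dl A G B ≫ (co .or (A ⋏ B) G).hom) ⊻ 𝟙 D) =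
      ((((co .or G A).hom ⊼ 𝟙 B) ⊻ 𝟙 D)) ≫ (dl A G B ⊻ 𝟙 D) ≫
        ((co .or (A ⋏ B) G).hom ⊻ 𝟙 D) := by
    simp [bmap_comp]
  rw [h1, e2]
  simp only [Category.assoc]
  rw [bmap_comp_assoc _ (co .or (A ⋏ B) G).hom, co_co, Category.id_comp, bmap_id,
    Category.id_comp, di_nat_assoc, bmap_comp_assoc, bmap_id]
  simp

namespace El

/-- Insertion of an element of `B ∨ Δ` that leaves `Δ` outside. -/
def hat {B : PN P} {Δ : Option (PN P)} (y : El (oo B Δ)) (A : PN P) : A ⟶ oo (A ⋏ B) Δ :=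
  y.app A ≫ dO A B Δ

/-- The tensor of two elements. -/
def tens {A B : PN P} {Γ Δ : Option (PN P)} (x : El (oo A Γ)) (y : El (oo B Δ)) :
    El (oo (oo (A ⋏ B) Δ) Γ) :=
  x.act (oo1 (y.hat A) Γ)

theorem hat_nat {B : PN P} {Δ : Option (PN P)} (y : El (oo B Δ)) {A A' : PN P} (f : A ⟶ A') :
    f ≫ y.hat A' = y.hat A ≫ oo1 (f ⊼ 𝟙 B) Δ := by
  rw [hat, y.nat_assoc, hat, Category.assoc, dO_nat, oo2_id]

theorem hat_act {B B' : PN P} {Δ Δ' : Option (PN P)} (y : El (oo B Δ)) (g : B ⟶ B')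
    (r : OHom Δ Δ') (A : PN P) : (y.act (oo2 g r)).hat A = y.hat A ≫ oo2 (𝟙 A ⊼ g) r := by
  rw [hat, hat, Category.assoc, dO_nat, act_app, Category.assoc]

theorem hat_and {C : PN P} {Δ : Option (PN P)} (y : El (oo C Δ)) (A B : PN P) :
    y.hat (A ⋏ B) ≫ oo1 (as .and A B C).hom Δ = (𝟙 A ⊼ y.hat B) ≫ dO A (B ⋏ C) Δ := by
  rw [hat, Category.assoc, dO_as, reassoc_of% (y.app_and A B), bmap_comp_assoc, hat]
  simp

theorem tens_act {A A' B B' : PN P} {Γ Γ' Δ Δ' : Option (PN P)} (x : El (oo A Γ))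
    (y : El (oo B Δ)) (f : A ⟶ A') (g : B ⟶ B') (r : OHom Γ Γ') (s : OHom Δ Δ') :
    tens (x.act (oo2 f r)) (y.act (oo2 g s)) = (tens x y).act (oo2 (oo2 (f ⊼ g) s) r) := by
  rw [tens, tens, act_act, act_act, oo2_comp, oo2_comp, hat_act, ← Category.assoc, hat_nat,
    Category.assoc, oo2_comp, bmap_comp]
  simp

theorem app_or' {B : PN P} (y : El B) (Z W : PN P) :
    y.app (Z ⋎ W) ≫ dl Z W B = y.app Z ⊻ 𝟙 W := by
  rw [dl, reassoc_of% (y.app_or Z W), bmap_comp]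
  simp

/-- Both sides insert one whole premiss next to the other and then distribute. The order of
insertion is irrelevant by `act_app_comm`, with `app_or'` confining an insertion to one disjunct,
and the order of distribution is irrelevant by `dl_di`. -/
theorem tens_comm {A B : PN P} {Γ Δ : Option (PN P)} (x : El (oo A Γ)) (y : El (oo B Δ)) :
    tens x y = ((tens y x).act (oo1 (oo1 (co .and B A).hom Γ) Δ)).act (swo (A ⋏ B) Γ Δ).hom := by
  rw [tens, tens]
  cases Γ with
  | none =>
    cases Δ with
    | none =>
      have h := act_app_comm (A := A) (B := B) x y
      have h2 : x.act (y.app A ≫ 𝟙 _) = ((y.act (x.app B ≫ 𝟙 _)).act (co .and B A).hom).act (𝟙 _) := by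
        simpa using h
      exact h2
    | some D =>
      have h := act_app_comm (A := A) (B := B ⋎ D) x y
      have h2 : x.act (y.app A ≫ di A B D) =
          ((y.act ((x.app B ≫ 𝟙 _) ⊻ 𝟙 D)).act ((co .and B A).hom ⊻ 𝟙 D)).act (𝟙 _) := by
        rw [← act_act, h, Category.comp_id, ← app_or', act_act, act_act, act_act, act_act]
        congr 1
        simp [dl, bmap_comp]
      exact h2
  | some G =>
    cases Δ with
    | none =>
      have h := act_app_comm (A := A ⋎ G) (B := B) x y
      have h2 : x.act ((y.app A ≫ 𝟙 _) ⊻ 𝟙 G) =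
          ((y.act (x.app B ≫ di B A G)).act ((co .and B A).hom ⊻ 𝟙 G)).act (𝟙 _) := by
        rw [Category.comp_id, ← app_or', ← act_act, h, act_act, act_act, act_act, act_act]
        congr 1
        simp [dl]
      exact h2
    | some D =>
      have h := act_app_comm (A := A ⋎ G) (B := B ⋎ D) x y
      have h2 : x.act ((y.app A ≫ di A B D) ⊻ 𝟙 G) =
          ((y.act ((x.app B ≫ di B A G) ⊻ 𝟙 D)).act (((co .and B A).hom ⊻ 𝟙 G) ⊻ 𝟙 D)).act
            (sw .or (A ⋏ B) G D).hom := by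
        have e1 : (y.app A ≫ di A B D) ⊻ 𝟙 G = (y.app A ⊻ 𝟙 G) ≫ (di A B D ⊻ 𝟙 G) := by
          simp [bmap_comp]
        have e2 : (x.app B ≫ di B A G) ⊻ 𝟙 D = (x.app B ⊻ 𝟙 D) ≫ (di B A G ⊻ 𝟙 D) := by
          simp [bmap_comp]
        rw [e1, e2, ← app_or', ← app_or', Category.assoc, ← act_act, h, dl_di]
        simp only [act_act]
        congr 1
        simp only [Category.assoc, bmap_comp_assoc, dl]
        simp
      exact h2

end El

/-! ### Cut-free proofs -/

/-- The elements that are interpretations of cut-free one-sided proofs. -/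
inductive CF : ∀ {S : PN P}, El S → Prop
  | ax (p : P) : CF (El.ax p)
  | ac {S T} {σ : S ⟶ T} {x : El S} : AC σ → CF x → CF (x.act σ)
  | tens {A B Γ Δ} {x : El (oo A Γ)} {y : El (oo B Δ)} : CF x → CF y → CF (El.tens x y)

/-- The action of `f` on a disjunct preserves cut-free proofs. -/
def Adm {A B : PN P} (f : A ⟶ B) : Prop :=
  ∀ (R : Option (PN P)) (x : El (oo A R)), CF x → CF (x.act (oo1 f R))

theorem OHom.oplus_id (R S : Option (PN P)) :
    (OHom.id R).oplus (OHom.id S) = OHom.id (PN.oplus R S) := by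
  cases R
  · rfl
  · exact congrArg OHom.some (oo2_id _ _)

namespace Adm

theorem of_ac {A B : PN P} {f : A ⟶ B} (h : AC f) : Adm f :=
  fun _ _ hx => .ac (h.oo2 (.id _)) hx

theorem comp {A B C : PN P} {f : A ⟶ B} {g : B ⟶ C} (hf : Adm f) (hg : Adm g) :
    Adm (f ≫ g) := by
  intro R x hx
  have := hg R _ (hf R x hx)
  rwa [El.act_act, oo2_comp, OHom.id_comp] at this

theorem act {A B : PN P} {f : A ⟶ B} (hf : Adm f) {x : El A} (hx : CF x) : CF (x.act f) :=
  hf none x hx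

theorem hat {B : PN P} {Δ : Option (PN P)} {y : El (oo B Δ)} (hy : CF y) (A : PN P) :
    Adm (y.hat A) := fun _ _ hx => .tens hx hy

/-- By `El.tens_comm`, inserting `x` into a proof is, up to rearrangement, the tensor in which `x`
is the first premiss. -/
theorem hat_co {A : PN P} {Γ : Option (PN P)} {x : El (oo A Γ)} (hx : CF x) (B : PN P) :
    Adm (x.hat B ≫ oo1 (co .and B A).hom Γ) := by
  intro R y hy
  have h := congrArg (fun z => z.act (swo (A ⋏ B) R Γ).hom) (El.tens_comm x y)
  simp only [El.act_act, Category.assoc, swo_swo, Category.comp_id] at h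
  have hu : El.tens y x = y.act (oo1 (x.hat B) R) := rfl
  rw [hu, El.act_act, oo2_comp, OHom.id_comp] at h
  rw [← h]
  exact .ac (.swo _ _ _) (.tens hx hy)

/-- Associativity moves `C` into the context. `Adm` quantifies over all contexts for the sake of
this argument. -/
theorem or_left {A B : PN P} {f : A ⟶ B} (hf : Adm f) (C : PN P) : Adm (f ⊻ 𝟙 C) := by
  intro R x hx
  have h := CF.ac (.asc_inv B (some C) R) (hf _ _ (.ac (.asc A (some C) R) hx))
  have e := asc_nat f (OHom.id (some C)) (OHom.id R)
  rw [OHom.oplus_id] at e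
  rw [El.act_act, El.act_act, ← reassoc_of% e, Iso.hom_inv_id,
    Category.comp_id] at h
  exact h

theorem or_right {A B : PN P} {f : A ⟶ B} (hf : Adm f) (C : PN P) : Adm (𝟙 C ⊻ f) := by
  have h := (of_ac (.co C A)).comp ((hf.or_left C).comp (of_ac (.co B C)))
  rwa [co_nat_assoc, co_co, Category.comp_id] at h

end Adm

/-! ### Ancestors of a disjunct in a cut-free proof. -/

theorem Ext.of_oo (a : PN P) (R : Option (PN P)) : Ext a (oo a R) R (𝟙 _) := by
  cases R with
  | none => exact .refl
  | some R =>
    have h := Ext.left R (.refl (a := a))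
    have e : (𝟙 a ⊻ 𝟙 R) ≫ 𝟙 _ = 𝟙 (a ⋎ R) := by simp
    exact e ▸ h

/-- The single disjunct `a` lies either in `X` or in the context. The equations are between
dependent pairs so that case analysis on them replaces the remainder and the arrow together. -/
theorem Ext.oo_cases {a X : PN P} (ha : atoms a = {a}) {Γ R : Option (PN P)} {e : oo X Γ ⟶ oo a R}
    (h : Ext a (oo X Γ) R e) :
    (∃ R' e', Ext a X R' e' ∧
      (⟨R, e⟩ : Σ R, oo X Γ ⟶ oo a R) = ⟨oplus R' Γ, oo1 e' Γ ≫ (asc a R' Γ).hom⟩) ∨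
    ∃ (G : _) (R' : _) (e' : _) (hG : Γ = some G), Ext a G R' e' ∧
      (⟨R, e⟩ : Σ R, oo X Γ ⟶ oo a R) =
        ⟨oplus R' (some X), eqToHom (by rw [hG]) ≫ (co .or X G).hom ≫ (e' ⊻ 𝟙 X) ≫
          (asc a R' (some X)).hom⟩ := by
  cases Γ with
  | none =>
    refine .inl ⟨R, e, h, ?_⟩
    cases R with
    | none =>
      have : e = e ≫ 𝟙 _ := (Category.comp_id _).symm
      exact congrArg (Sigma.mk none) this
    | some R =>
      have : e = e ≫ 𝟙 _ := (Category.comp_id _).symm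
      exact congrArg (Sigma.mk (some R)) this
  | some G =>
    cases h with
    | refl => exact absurd rfl (ne_or_of_atoms ha _ _)
    | left _ h => exact .inl ⟨_, _, h, rfl⟩
    | right _ h => exact .inr ⟨_, _, _, rfl, h, by simp⟩

theorem Ext.and_cases {a A B : PN P} {R : Option (PN P)} {e : A ⋏ B ⟶ oo a R}
    (h : Ext a (A ⋏ B) R e) :
    ∃ h : A ⋏ B = a, (⟨R, e⟩ : Σ R, A ⋏ B ⟶ oo a R) = ⟨none, eqToHom h⟩ := by
  cases h with
  | refl => exact ⟨rfl, rfl⟩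

theorem asc_as_inv (a : PN P) (R : Option (PN P)) (M N : PN P) :
    ∃ ρ : OHom (oplus R (some (M ⋎ N))) (oplus (oplus R (some M)) (some N)), ρ.AC ∧
      (as .or (oo a R) M N).inv ≫ ((asc a R (some M)).hom ⊻ 𝟙 N) ≫
        (asc a (oplus R (some M)) (some N)).hom =
      (asc a R (some (M ⋎ N))).hom ≫ oo2 (𝟙 a) ρ := by
  obtain ⟨ρ, hρ, h⟩ := asc_co a R N M
  refine ⟨((OHom.id R).oplus (.some (co .or M N).hom)).comp ρ,
    (OHom.AC.oplus (.id _) (.some (.co _ _))).comp hρ, ?_⟩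
  have h2 := asc_nat (𝟙 a) (OHom.id R) (.some (co .or M N).hom)
  have h3 := congrArg ((𝟙 (oo a R) ⊻ (co .or M N).hom) ≫ ·) h
  rw [bmap_comp_assoc, co_co, Category.comp_id, bmap_id, Category.id_comp] at h3
  rw [h3]
  rw [oo2_id] at h2
  have h4 : (𝟙 (oo a R) ⊻ (co .or M N).hom) ≫ (asc a R (some (N ⋎ M))).hom =
    (asc a R (some (M ⋎ N))).hom ≫ oo2 (𝟙 a) ((OHom.id R).oplus (.some (co .or M N).hom)) := h2
  rw [reassoc_of% h4, oo2_comp, Category.comp_id]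

/-- Needed when the disjunct comes from the context of the second premiss: the exchange produced by
`El.tens_comm` is absorbed into the extraction from `D`, up to a rearrangement of what remains. -/
theorem swo_ext (a X D : PN P) (Γ R : Option (PN P)) (e : D ⟶ oo a R) :
    ∃ ρ : OHom (oplus R (some (oo X Γ))) (oplus (oplus R (some X)) Γ), ρ.AC ∧
      (swo X Γ (some D)).hom ≫ oo1 ((co .or X D).hom ≫ (e ⊻ 𝟙 X) ≫ (asc a R (some X)).hom) Γ ≫
        (asc a (oplus R (some X)) Γ).hom =
      (co .or (oo X Γ) D).hom ≫ (e ⊻ 𝟙 _) ≫ (asc a R (some (oo X Γ))).hom ≫ oo2 (𝟙 a) ρ := by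
  cases Γ with
  | none =>
    have h : 𝟙 _ ≫ ((co .or X D).hom ≫ (e ⊻ 𝟙 X) ≫ (asc a R (some X)).hom) ≫ 𝟙 _ =
        (co .or X D).hom ≫ (e ⊻ 𝟙 _) ≫ (asc a R (some X)).hom ≫
          oo2 (𝟙 a) (OHom.id (oplus R (some X))) := by
      simp
    cases R with
    | none => exact ⟨.id _, .id _, h⟩
    | some R => exact ⟨.id _, .id _, h⟩
  | some G =>
    obtain ⟨ρ, hρ, h⟩ := asc_as_inv a R X G
    refine ⟨ρ, hρ, ?_⟩
    rw [← h]
    have h2 := co_as_inv Conn.or D X G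
    have h3 := as_inv_nat_assoc Conn.or e (𝟙 X) (𝟙 G) (((asc a R (some X)).hom ⊻ 𝟙 G) ≫
        (asc a (oplus R (some X)) (some G)).hom)
    rw [bmap_id] at h3
    have h4 : (sw .or X G D).hom ≫
        (((co .or X D).hom ≫ (e ⊻ 𝟙 X) ≫ (asc a R (some X)).hom) ⊻ 𝟙 G) ≫
        (asc a (oplus R (some X)) (some G)).hom =
      (co .or (X ⋎ G) D).hom ≫ (e ⊻ 𝟙 (X ⋎ G)) ≫ (as .or (oo a R) X G).inv ≫
        ((asc a R (some X)).hom ⊻ 𝟙 G) ≫ (asc a (oplus R (some X)) (some G)).hom := by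
      rw [← h3, reassoc_of% h2, bmap_comp_assoc, bmap_comp_assoc]
      simp
    exact h4

/-- Induction on a cut-free proof along the ancestors of one of the disjuncts that it proves. -/
theorem CF.disjunct_induction {a : PN P} (ha : atoms a = {a}) {Q : ∀ R, El (oo a R) → Prop}
    (hac : ∀ {R R'} {ρ : OHom R R'} {z}, ρ.AC → Q R z → Q R' (z.act (oo2 (𝟙 a) ρ)))
    (hadm : ∀ {R R'} {f : R ⟶ R'} {z}, Adm f → Q (some R) z → Q (some R') (z.act (𝟙 a ⊻ f)))
    (htens : ∀ {A B Γ Δ} {x : El (oo A Γ)} {y : El (oo B Δ)} (h : A ⋏ B = a), CF x → CF y →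
      Q (oplus Δ Γ) (((El.tens x y).act (oo1 (oo1 (eqToHom h) Δ) Γ)).act (asc a Δ Γ).hom))
    (hneg : ∀ p (h : negLetter p = a),
      Q (some (letter p)) ((El.ax p).act (eqToHom h ⊻ 𝟙 (letter p))))
    (hpos : ∀ p (h : letter p = a), Q (some (negLetter p))
      ((El.ax p).act ((co .or _ _).hom ≫ (eqToHom h ⊻ 𝟙 (negLetter p)))))
    {S : PN P} {x : El S} (hx : CF x) :
    ∀ {R} {e : S ⟶ oo a R}, AC e → Q R (x.act e) := by
  -- A rearrangement onto `a ∨ R` is an extraction of `a` followed by a rearrangement of the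
  -- remainder, so extractions suffice.
  have hred : ∀ {S : PN P} {x : El S}, (∀ {R} {e : S ⟶ oo a R}, Ext a S R e → Q R (x.act e)) →
      ∀ {R} {e : S ⟶ oo a R}, AC e → Q R (x.act e) := by
    intro S x h R e he
    obtain ⟨R₀, e₀, ρ, he₀, hρ, h₀⟩ := exists_ext_of_ac ha he (Ext.of_oo a R)
    rw [Category.comp_id] at h₀
    rw [h₀, ← El.act_act]
    exact hac hρ (h he₀)
  -- When `a` comes from `D`, an admissible arrow on `B` acts inside the remainder, where `hadm`
  -- applies.
  have hctx : ∀ {B D W : PN P} {k : B ⟶ W} {y : El (B ⋎ D)} {R : Option (PN P)} {e : D ⟶ oo a R},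
      Adm k → (∀ {R} {e : B ⋎ D ⟶ oo a R}, AC e → Q R (y.act e)) → Ext a D R e →
      Q (oplus R (some W)) (y.act ((k ⊻ 𝟙 D) ≫ (co .or W D).hom ≫ (e ⊻ 𝟙 W) ≫
        (asc a R (some W)).hom)) := by
    intro B D W k y R e hk hy he
    have h1 := hy ((he.right B).ac)
    have h2 := asc_nat (𝟙 a) (OHom.id R) (.some k)
    rw [oo2_id] at h2
    have h3 : (k ⊻ 𝟙 D) ≫ (co .or W D).hom ≫ (e ⊻ 𝟙 W) ≫ (asc a R (some W)).hom =
        ((co .or B D).hom ≫ (e ⊻ 𝟙 B) ≫ (asc a R (some B)).hom) ≫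
          oo2 (𝟙 a) ((OHom.id R).oplus (.some k)) := by
      have h4 : (𝟙 (oo a R) ⊻ k) ≫ (asc a R (some W)).hom =
        (asc a R (some B)).hom ≫ oo2 (𝟙 a) ((OHom.id R).oplus (.some k)) := h2
      simp only [Category.assoc]
      rw [← h4, ← co_nat_assoc, bmap_comp_assoc, bmap_comp_assoc]
      simp
    rw [h3, ← El.act_act]
    cases R with
    | none => exact hadm hk h1
    | some L => exact hadm (hk.or_right L) h1
  induction hx with
  | ax p =>
    refine @hred _ _ ?_
    intro R e he
    cases he with
    | refl => exact absurd rfl (ne_or_of_atoms ha _ _)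
    | left _ he =>
      cases he with
      | refl =>
        have h := hneg p rfl
        have e : (𝟙 (negLetter p) ⊻ 𝟙 (letter p)) ≫ 𝟙 _ =
          eqToHom rfl ⊻ 𝟙 (letter p) := by simp
        exact (congrArg (El.act _) e).symm ▸ h
    | right _ he =>
      cases he with
      | refl =>
        have h := hpos p rfl
        have e : (co .or _ _).hom ≫ (𝟙 (letter p) ⊻ 𝟙 (negLetter p)) ≫ 𝟙 _ =
          (co .or _ _).hom ≫ (eqToHom rfl ⊻ 𝟙 (negLetter p)) := by simp
        exact (congrArg (El.act _) e).symm ▸ h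
  | ac hσ _ ih =>
    intro R e he
    rw [El.act_act]
    exact ih (hσ.comp he)
  | @tens A B Γ Δ x y hx hy ihx ihy =>
    refine @hred _ _ ?_
    intro R e he
    -- The disjunct is the conjunction just introduced, or lies in `Δ`, or lies in `Γ`. In the last
    -- two cases the tensor is an admissible arrow acting on the premiss that contains the disjunct;
    -- for `Δ` the premisses are first exchanged.
    rcases he.oo_cases ha with ⟨R₁, e₁, he₁, h₁⟩ | ⟨G, R₁, e₁, rfl, he₁, h₁⟩
    · cases h₁
      rcases he₁.oo_cases ha with ⟨R₂, e₂, he₂, h₂⟩ | ⟨D, R₂, e₂, rfl, he₂, h₂⟩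
      · cases h₂
        obtain ⟨h, h₃⟩ := he₂.and_cases
        cases h₃
        have h4 := htens h hx hy
        rw [El.act_act] at h4
        have e : oo1 (oo1 (eqToHom h) Δ ≫ 𝟙 _) Γ ≫ (asc a Δ Γ).hom =
          oo1 (oo1 (eqToHom h) Δ) Γ ≫ (asc a Δ Γ).hom := by simp
        exact (congrArg (El.act _) e).symm ▸ h4
      · cases h₂
        obtain ⟨ρ, hρ, h⟩ := swo_ext a (A ⋏ B) D Γ R₂ e₂
        rw [eqToHom_refl, Category.id_comp, El.tens_comm x y, El.act_act, h]
        have h5 := hac hρ (hctx (Adm.hat_co hx B) ihy he₂)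
        rw [El.tens]
        simp only [El.act_act] at h5 ⊢
        rw [oo2_comp, OHom.id_comp]
        simp only [Category.assoc] at h5 ⊢
        exact h5
    · cases h₁
      rw [eqToHom_refl, Category.id_comp, El.tens, El.act_act]
      exact hctx (Adm.hat hy A) ihx he₁

/-! ### Balance of positive and negative occurrences of letters. -/

open Classical in
/-- The number of positive occurrences of a letter. -/
noncomputable def pos (p : P) : PN P → ℕ
  | letter q => if q = p then 1 else 0
  | negLetter _ => 0
  | bin _ A B => pos p A + pos p B

open Classical in
/-- The number of negative occurrences of a letter. -/
noncomputable def neg (p : P) : PN P → ℕ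
  | letter _ => 0
  | negLetter q => if q = p then 1 else 0
  | bin _ A B => neg p A + neg p B

theorem AC.pos_eq (p : P) {S T : PN P} {f : S ⟶ T} (h : AC f) : pos p S = pos p T := by
  induction h with
  | id S => rfl
  | comp _ _ ih ih' => exact ih.trans ih'
  | map _ _ ih ih' => simp [pos, ih, ih']
  | as A B C => simp [pos, add_assoc]
  | co A B => simp [pos, add_comm]

theorem AC.neg_eq (p : P) {S T : PN P} {f : S ⟶ T} (h : AC f) : neg p S = neg p T := by
  induction h with
  | id S => rfl
  | comp _ _ ih ih' => exact ih.trans ih'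
  | map _ _ ih ih' => simp [neg, ih, ih']
  | as A B C => simp [neg, add_assoc]
  | co A B => simp [neg, add_comm]

/-- In a provable formula each letter has as many positive as negative occurrences. -/
theorem CF.pos_eq_neg {S : PN P} {x : El S} (h : CF x) (p : P) : pos p S = neg p S := by
  induction h with
  | ax q => simp [pos, neg]
  | ac hσ _ ih => rw [← hσ.pos_eq, ← hσ.neg_eq, ih]
  | @tens A B Γ Δ _ _ _ _ ih ih' =>
    cases Γ <;> cases Δ <;> simp only [oo, pos, neg] at ih ih' ⊢ <;> omega

/-! ### Cut elimination. -/

namespace Adm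

/-- Since `g` acts on `a` alone, it commutes with everything done to the other disjuncts; the
induction leaves only the steps that introduce `a`. -/
theorem of_principal {a D : PN P} (ha : atoms a = {a}) {g : a ⟶ D}
    (htens : ∀ {A B Γ Δ} {x : El (oo A Γ)} {y : El (oo B Δ)} (h : A ⋏ B = a), CF x → CF y →
      CF ((El.tens x y).act (oo1 (oo1 (eqToHom h ≫ g) Δ) Γ)))
    (hneg : ∀ p (h : negLetter p = a), CF ((El.ax p).act ((eqToHom h ≫ g) ⊻ 𝟙 (letter p))))
    (hpos : ∀ p (h : letter p = a),
      CF ((El.ax p).act ((co .or _ _).hom ≫ ((eqToHom h ≫ g) ⊻ 𝟙 (negLetter p))))) : Adm g := by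
  intro R x hx
  have := CF.disjunct_induction ha (Q := fun R z => CF (z.act (oo1 g R))) ?_ ?_ ?_ ?_ ?_ hx
    (AC.id _)
  · simpa using this
  · intro R R' ρ z hρ h
    have := CF.ac ((AC.id D).oo2 hρ) h
    rw [El.act_act, oo2_comp] at this ⊢
    simpa using this
  · intro R R' f z hf h
    have := (hf.or_right D).act h
    rw [El.act_act] at this ⊢
    convert this using 2
    exact (bmap_comp _ _ _ _ _).trans (by
      rw [Category.id_comp, Category.comp_id]
      symm
      refine (bmap_comp _ _ _ _ _).trans ?_
      rw [Category.id_comp, Category.comp_id])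
  · intro A B Γ Δ x y h hx hy
    have := CF.ac (AC.asc _ _ _) (htens h hx hy)
    rw [El.act_act] at this ⊢
    rw [El.act_act]
    have e := asc_nat (eqToHom h ≫ g) (OHom.id Δ) (OHom.id Γ)
    have e2 := asc_nat (eqToHom h) (OHom.id Δ) (OHom.id Γ)
    rw [e] at this
    rw [reassoc_of% e2, oo2_comp, OHom.oplus_id, OHom.comp_id]
    rwa [OHom.oplus_id] at this
  · intro p h
    have := hneg p h
    rw [El.act_act]
    convert this using 2
    exact (bmap_comp _ _ _ _ _).trans (by rw [Category.id_comp])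
  · intro p h
    have := hpos p h
    rw [El.act_act, Category.assoc]
    convert this using 3
    exact (bmap_comp _ _ _ _ _).trans (by rw [Category.id_comp])

theorem of_and {A B D : PN P} {g : A ⋏ B ⟶ D}
    (h : ∀ {Γ Δ} {x : El (oo A Γ)} {y : El (oo B Δ)}, CF x → CF y →
      CF ((El.tens x y).act (oo1 (oo1 g Δ) Γ))) : Adm g := by
  refine of_principal rfl ?_ (fun p h => nomatch h) (fun p h => nomatch h)
  intro A' B' Γ Δ x y e hx hy
  cases e
  simpa using h hx hy

theorem and_left {A D : PN P} {f : A ⟶ D} (hf : Adm f) (C : PN P) : Adm (f ⊼ 𝟙 C) := by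
  refine of_and ?_
  intro Γ Δ x y hx hy
  have := CF.tens (hf Γ x hx) hy
  have e := El.tens_act x y f (𝟙 C) (OHom.id Γ) (OHom.id Δ)
  rw [oo2_id, El.act_id] at e
  rwa [e] at this

theorem and_right {A D : PN P} {f : A ⟶ D} (hf : Adm f) (C : PN P) : Adm (𝟙 C ⊼ f) := by
  refine of_and ?_
  intro Γ Δ x y hx hy
  have := CF.tens hx (hf Δ y hy)
  have e := El.tens_act x y (𝟙 C) f (OHom.id Γ) (OHom.id Δ)
  rw [oo2_id, El.act_id] at e
  rwa [e] at this

theorem co_and (A B : PN P) : Adm (co .and A B).hom := by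
  refine of_and ?_
  intro Γ Δ x y hx hy
  have h := CF.ac (AC.swo _ _ _) (CF.tens hy hx)
  rwa [El.tens_comm y x, El.act_act, swo_swo, El.act_id] at h

theorem co (ξ : Conn) (A B : PN P) : Adm (co ξ A B).hom := by
  cases ξ
  · exact co_and A B
  · exact of_ac (.co A B)

/-- Distribution adds no rule: once `C` is counted in the context of the second premiss, the tensor
already introduces `A ∧ B` and leaves `C` outside. -/
theorem di (A B C : PN P) : Adm (di A B C) := by
  refine of_and ?_
  intro Γ Δ x y hx hy
  have h := of_ac (AC.asc_inv _ _ _) Γ _ (CF.tens hx (CF.ac (AC.asc B (some C) Δ) hy))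
  have e : El.hat (y.act (asc B (some C) Δ).hom) A ≫ (asc (A ⋏ B) (some C) Δ).inv =
      y.hat A ≫ oo1 (PN.di A B C) Δ := by
    rw [El.hat, El.hat, El.act_app, Category.assoc, Category.assoc, reassoc_of% dO_asc,
      Iso.hom_inv_id, Category.comp_id, Category.assoc]
  rw [El.tens, El.act_act, oo2_comp, OHom.id_comp, e] at h
  rw [El.tens, El.act_act, oo2_comp, OHom.id_comp]
  exact h

theorem dO (A B : PN P) (Δ : Option (PN P)) : Adm (dO A B Δ) := by
  cases Δ
  · exact of_ac (.id _)
  · exact di _ _ _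

/-- By `El.hat_and`, the proof of `C` may be inserted next to `B`, inside the conjunction proved by
the first premiss, instead of next to `A ∧ B`. -/
theorem as_and (A B C : PN P) : Adm (as .and A B C).hom := by
  refine of_and ?_
  intro Γ Δ x y hx hy
  have h := (((hat hy B).and_right A).comp (dO A (B ⋏ C) Δ)) Γ x hx
  rw [← El.hat_and] at h
  rw [El.tens, El.act_act, oo2_comp, OHom.id_comp]
  exact h

theorem as (ξ : Conn) (A B C : PN P) : Adm (as ξ A B C).hom := by
  cases ξ
  · exact as_and A B C
  · exact of_ac (.as A B C)

theorem as_inv (ξ : Conn) (A B C : PN P) : Adm (PN.as ξ A B C).inv := by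
  rw [← as_inv_eq]
  exact (co _ _ _).comp ((as _ _ _ _).comp ((co _ _ _).comp ((as _ _ _ _).comp (co _ _ _))))

theorem map (ξ : Conn) {A B D E : PN P} {f : A ⟶ D} {g : B ⟶ E} (hf : Adm f) (hg : Adm g) :
    Adm (bmap ξ f g) := by
  have e : bmap ξ f g = bmap ξ f (𝟙 B) ≫ bmap ξ (𝟙 D) g := by simp [bmap_comp]
  rw [e]
  cases ξ
  · exact (hf.and_left B).comp (hg.and_right D)
  · exact (hf.or_left B).comp (hg.or_right D)

theorem del (p : P) (A : PN P) : Adm (del p A) := by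
  have h := hat (B := top p) (Δ := none) (y := El.ax p) (CF.ax p) A
  have e : PN.del p A = PN.del p A ≫ 𝟙 _ := (Category.comp_id _).symm
  rw [e]
  exact h

/-- A cut of `y` against an axiom gives back `y`. After the axiom and `y` change places, what acts
on `y` is an endomorphism of `¬p ∨ D`, and it is the identity by the triangular equation for `¬p`.
-/
theorem ax_cut {p : P} {D : PN P} (y : El (negLetter p ⋎ D)) :
    (El.ax p).act (𝟙 _ ⊻ (y.hat (Δ := some D) (letter p) ≫ sig p D)) = y := by
  have h1 : (𝟙 (negLetter p) ⊻ (y.hat (Δ := some D) (letter p) ≫ sig p D)) =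
      (PN.co .or _ _).hom ≫ (y.app (letter p) ⊻ 𝟙 _) ≫
        ((PN.di (letter p) (negLetter p) D ≫ sig p D) ⊻ 𝟙 _) ≫ (PN.co .or _ _).hom := by
    rw [bmap_comp_assoc, ← co_nat, co_co_assoc, Category.comp_id]
    simp only [El.hat, Category.assoc]
    rfl
  -- Symmetry of the pairing turns `y` inserted into the axiom into the axiom inserted into `y`.
  have h2 : (El.ax p).act (y.app (top p)) = y.act (PN.del p (negLetter p ⋎ D) ≫
      (PN.co .and _ _).hom) := by
    rw [El.act_app_comm, El.act_act]
    rfl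
  have h3 : ((PN.di (letter p) (negLetter p) D ≫ sig p D) ⊻ 𝟙 (negLetter p)) =
    (PN.di (letter p) (negLetter p) D ⊻ 𝟙 (negLetter p)) ≫ (sig p D ⊻ 𝟙 (negLetter p)) := by
    simp [bmap_comp]
  have h4 : (sw .or (bot p) (negLetter p) D).hom ≫ (sig p D ⊻ 𝟙 (negLetter p)) ≫
      (PN.co .or D (negLetter p)).hom = sig p (negLetter p) ⊻ 𝟙 D := by
    rw [← as_sig, ← as_sig, Category.assoc, reassoc_of% sw_as, ← sig_nat_assoc]
    simp
  have h5 : PN.del p (negLetter p) ≫ (PN.co .and _ _).hom ≫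
      ((PN.co .or (negLetter p) (letter p)).hom ⊼ 𝟙 (negLetter p)) ≫
      dl (letter p) (negLetter p) (negLetter p) ≫ sig p (negLetter p) = 𝟙 _ := by
    rw [dl]
    simp only [Category.assoc]
    rw [co_nat_assoc, co_co_assoc]
    exact del_sig' p
  rw [h1, ← El.app_or', h3]
  simp only [Category.assoc]
  rw [y.nat_assoc, ← El.act_act, h2, El.act_act, reassoc_of% dl_di, h4]
  have h6 := di_nat_assoc (PN.co .or (negLetter p) (letter p)).hom (𝟙 (negLetter p)) (𝟙 D)
    ((dl (letter p) (negLetter p) (negLetter p) ⊻ 𝟙 D) ≫ (sig p (negLetter p) ⊻ 𝟙 D))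
  rw [bmap_id] at h6
  simp only [Category.assoc]
  rw [← h6, reassoc_of% del_di, bmap_comp, bmap_comp, bmap_comp]
  simp only [Category.assoc]
  rw [h5]
  simp

/-- Cut on the letter `p`, moved up to the axiom that introduces this occurrence of `p`, where
`ax_cut` evaluates it. -/
theorem hat_sig {p : P} {D : PN P} {y : El (negLetter p ⋎ D)} (hy : CF y) :
    Adm (y.hat (Δ := some D) (letter p) ≫ sig p D) := by
  refine of_principal rfl (fun h => nomatch h) (fun p h => nomatch h) ?_
  intro q h
  cases h
  have h2 := CF.ac (AC.co _ _) hy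
  rw [← ax_cut y, El.act_act, ← co_nat] at h2
  simpa using h2

/-- Follow `p ∧ ¬p` to the tensor that introduces it. Deleting it there amounts to the cut of the
two premisses on `p`, which `hat_sig` eliminates. -/
theorem sig (p : P) (A : PN P) : Adm (sig p A) := by
  intro R x hx
  -- Nothing can be deleted when `p ∧ ¬p` stands alone, so the value there is immaterial; the final
  -- context contains `A`.
  let Q : ∀ R, El (oo (bot p) R) → Prop := fun R =>
    match R with
    | none => fun _ => True
    | some R => fun z => CF (z.act (PN.sig p R))
  have h := CF.disjunct_induction (a := bot p) rfl (Q := Q) ?_ ?_ ?_ (fun p h => nomatch h)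
    (fun p h => nomatch h) hx (AC.asc (bot p) (some A) R)
  · have e : (asc (bot p) (some A) R).hom ≫ PN.sig p (oo A R) = oo1 (PN.sig p A) R := by
      cases R
      · exact Category.id_comp _
      · exact as_sig _ _ _
    have h' : CF ((x.act (asc (bot p) (some A) R).hom).act (PN.sig p (oo A R))) := h
    rwa [El.act_act, e] at h'
  · intro R R' ρ z hρ h
    cases hρ with
    | none => trivial
    | some hr =>
      have := CF.ac hr h
      rw [El.act_act, sig_nat, ← El.act_act] at this
      exact this
  · intro R R' f z hf h
    have := hf.act h
    rw [El.act_act, sig_nat, ← El.act_act] at this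
    exact this
  · intro A B Γ Δ x y h hx hy
    cases h
    cases Γ with
    -- A single letter is not balanced, so neither premiss has an empty context.
    | none => exact absurd (hx.pos_eq_neg p) (by simp [pos, neg])
    | some G =>
      cases Δ with
      | none => exact absurd (hy.pos_eq_neg p) (by simp [pos, neg])
      | some D =>
        have := hat_sig hy (some G) x hx
        change CF ((((x.tens y).act _).act _).act _)
        have e0 : oo1 (oo1 (eqToHom (rfl : letter p ⋏ negLetter p = bot p)) (some D)) (some G) =
            𝟙 _ := by simp
        rw [e0, El.act_id, El.act_act]
        have e := as_sig p G D
        have e' : (asc (bot p) (some D) (some G)).hom ≫ PN.sig p (oo D (some G)) =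
          oo1 (PN.sig p D) (some G) := e
        rw [e', El.tens, El.act_act, oo2_comp, OHom.id_comp]
        exact this

/-- All arrows of `PN` preserve cut-free proofs. -/
theorem all {A B : PN P} (f : A ⟶ B) : Adm f := by
  obtain ⟨t, rfl⟩ := mk_surjective f
  induction t with
  | one A => exact of_ac (.id _)
  | b ξ A B C => exact as_inv ξ A B C
  | bInv ξ A B C => exact as ξ A B C
  | cAnd A B => exact co .and A B
  | cOr A B => exact co .or B A
  | d A B C => exact di A B C
  | Del p A => exact del p A
  | Sig p A => exact sig p A
  | comp f g ihf ihg => exact ihg.comp ihf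
  | map ξ f g ihf ihg => exact ihf.map ξ ihg

end Adm

/-! ### Reversal of the order of conjuncts and disjuncts -/

/-- Associativity respects the reversal of three factors, by the hexagon. With this, laws of `di`
turn into mirror laws of `diR`. -/
theorem as_rev (ξ : Conn) (Z W N : PN P) :
    (co ξ (bin ξ Z W) N).hom ≫ bmap ξ (𝟙 N) (co ξ Z W).hom ≫ (as ξ N W Z).inv =
      (as ξ Z W N).hom ≫ (co ξ Z (bin ξ W N)).hom ≫ bmap ξ (co ξ W N).hom (𝟙 Z) := by
  rw [reassoc_of% (as_co_left ξ W Z N), co_nat_assoc, co_as_inv]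

theorem as_inv_rev (ξ : Conn) (Z W N : PN P) :
    bmap ξ (𝟙 Z) (co ξ W N).hom ≫ (co ξ Z (bin ξ N W)).hom ≫ (as ξ N W Z).hom =
      (as ξ Z W N).inv ≫ bmap ξ (co ξ Z W).hom (𝟙 N) ≫ (co ξ (bin ξ W Z) N).hom := by
  rw [← co_nat_assoc, Iso.eq_inv_comp, ← co_nat, ← cancel_mono (as ξ N W Z).inv]
  simp only [Category.assoc, Iso.hom_inv_id, Category.comp_id]
  exact (as_rev ξ Z W N).symm

theorem diR_def (C B A : PN P) : diR C B A = (co .and (C ⋎ B) A).hom ≫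
    (𝟙 A ⊼ (co .or C B).hom) ≫ di A B C ≫ ((co .and A B).hom ⊻ 𝟙 C) ≫ (co .or (B ⋏ A) C).hom :=
  rfl

theorem diR_nat {A B C D E F : PN P} (f : A ⟶ D) (g : B ⟶ E) (h : C ⟶ F) :
    diR A B C ≫ (f ⊻ (g ⊼ h)) = ((f ⊻ g) ⊼ h) ≫ diR D E F := by
  simp only [diR, Category.assoc]
  have e1 : ((co .and C B).hom ⊻ 𝟙 A) ≫ ((g ⊼ h) ⊻ f) =
      ((h ⊼ g) ⊻ f) ≫ ((co .and F E).hom ⊻ 𝟙 D) := by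
    rw [bmap_comp, bmap_comp, co_nat, Category.id_comp, Category.comp_id]
  have e2 : (𝟙 C ⊼ (co .or A B).hom) ≫ (h ⊼ (g ⊻ f)) =
      (h ⊼ (f ⊻ g)) ≫ (𝟙 F ⊼ (co .or D E).hom) := by
    rw [bmap_comp, bmap_comp, co_nat, Category.id_comp, Category.comp_id]
  rw [co_nat, reassoc_of% e1, di_nat_assoc, reassoc_of% e2, co_nat_assoc]

theorem diR_nat_assoc {A B C D E F X : PN P} (f : A ⟶ D) (g : B ⟶ E) (h : C ⟶ F)
    (k : D ⋎ (E ⋏ F) ⟶ X) :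
    diR A B C ≫ (f ⊻ (g ⊼ h)) ≫ k = ((f ⊻ g) ⊼ h) ≫ diR D E F ≫ k := by
  rw [← Category.assoc, diR_nat, Category.assoc]

theorem co_diR (A B C : PN P) :
    (co .and C (A ⋎ B)).hom ≫ diR A B C =
      (𝟙 C ⊼ (co .or A B).hom) ≫ di C B A ≫ ((co .and C B).hom ⊻ 𝟙 A) ≫ (co .or (B ⋏ C) A).hom := by
  rw [diR, co_co_assoc]

theorem bmap_comp_left (ξ : Conn) {A B C : PN P} (f : A ⟶ B) (g : B ⟶ C) (X : PN P) :
    bmap ξ (f ≫ g) (𝟙 X) = bmap ξ f (𝟙 X) ≫ bmap ξ g (𝟙 X) := by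
  rw [bmap_comp, Category.comp_id]

theorem bmap_comp_right (ξ : Conn) {A B C : PN P} (f : A ⟶ B) (g : B ⟶ C) (X : PN P) :
    bmap ξ (𝟙 X) (f ≫ g) = bmap ξ (𝟙 X) f ≫ bmap ξ (𝟙 X) g := by
  rw [bmap_comp, Category.comp_id]

theorem bmap_exchange (ξ : Conn) {A B C D : PN P} (f : A ⟶ B) (g : C ⟶ D) :
    bmap ξ f (𝟙 C) ≫ bmap ξ (𝟙 B) g = bmap ξ (𝟙 A) g ≫ bmap ξ f (𝟙 D) := by
  simp only [bmap_comp, Category.comp_id, Category.id_comp]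

/-- The mirror image of `di_as_and`. -/
theorem diR_as_and (C Y A B : PN P) :
    (as .and (C ⋎ Y) A B).hom ≫ diR C Y (A ⋏ B) =
      (diR C Y A ⊼ 𝟙 B) ≫ diR C (Y ⋏ A) B ≫ (𝟙 C ⊻ (as .and Y A B).hom) := by
  have h1 : (as .and (C ⋎ Y) A B).hom = (co .and _ B).hom ≫ (𝟙 B ⊼ (co .and (C ⋎ Y) A).hom) ≫
      (as .and B A (C ⋎ Y)).inv ≫ ((co .and B A).hom ⊼ 𝟙 _) ≫ (co .and (A ⋏ B) _).hom := by
    have h := reassoc_of% (as_rev .and (C ⋎ Y) A B)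
    rw [h, bmap_comp_assoc]
    simp
  have h2 : (as .and B A (Y ⋎ C)).inv ≫ di (B ⋏ A) Y C =
      (𝟙 B ⊼ di A Y C) ≫ di B (A ⋏ Y) C ≫ ((as .and B A Y).inv ⊻ 𝟙 C) := by
    rw [Iso.inv_comp_eq, ← reassoc_of% di_as_and, bmap_comp]
    simp
  have h3 : (as .and B A (C ⋎ Y)).inv ≫ (𝟙 _ ⊼ (co .or C Y).hom) =
      (𝟙 B ⊼ (𝟙 A ⊼ (co .or C Y).hom)) ≫ (as .and B A (Y ⋎ C)).inv := by
    rw [← as_inv_nat, bmap_id]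
  have h4 := reassoc_of% (bmap_exchange .and (co .and B A).hom (co .or C Y).hom)
  have h5 : di (B ⋏ A) Y C ≫ (((co .and B A).hom ⊼ 𝟙 Y) ⊻ 𝟙 C) =
      ((co .and B A).hom ⊼ 𝟙 _) ≫ di (A ⋏ B) Y C := by rw [di_nat, bmap_id]
  have h6 : (diR C Y A ⊼ 𝟙 B) ≫ (co .and _ B).hom =
      (co .and _ B).hom ≫ (𝟙 B ⊼ diR C Y A) := (co_nat _ _ _).symm
  have h7 : diR C Y A ≫ (co .or C _).hom =
      (co .and _ A).hom ≫ (𝟙 A ⊼ (co .or C Y).hom) ≫ di A Y C ≫ ((co .and A Y).hom ⊻ 𝟙 C) := by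
    simp [diR]
  have h8 : (𝟙 B ⊼ diR C Y A) ≫ (𝟙 B ⊼ (co .or C _).hom) ≫ di B (Y ⋏ A) C =
      (𝟙 B ⊼ (co .and _ A).hom) ≫ (𝟙 B ⊼ 𝟙 A ⊼ (co .or C Y).hom) ≫ (𝟙 B ⊼ di A Y C) ≫
        di B (A ⋏ Y) C ≫ ((𝟙 B ⊼ (co .and A Y).hom) ⊻ 𝟙 C) := by
    rw [di_nat, bmap_comp_assoc, h7]
    simp [bmap_comp_assoc]
  have h9 : ((as .and B A Y).inv ⊻ 𝟙 C) ≫ (((co .and B A).hom ⊼ 𝟙 Y) ⊻ 𝟙 C) ≫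
      ((co .and (A ⋏ B) Y).hom ⊻ 𝟙 C) = ((𝟙 B ⊼ (co .and A Y).hom) ⊻ 𝟙 C) ≫
        ((co .and B (Y ⋏ A)).hom ⊻ 𝟙 C) ≫ ((as .and Y A B).hom ⊻ 𝟙 C) := by
    simp only [← bmap_comp_left, as_inv_rev]
  rw [h1]
  simp only [Category.assoc]
  rw [co_diR, h4, reassoc_of% h3, ← reassoc_of% h5, reassoc_of% h2, reassoc_of% h9,
    diR_def C (Y ⋏ A) B]
  simp only [Category.assoc]
  rw [reassoc_of% h6, reassoc_of% h8, co_nat]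

/-- The mirror image of `di_as_or`. -/
theorem diR_as_or (C B A' A : PN P) :
    ((as .or C B A').hom ⊼ 𝟙 A) ≫ diR C (B ⋎ A') A ≫ (𝟙 C ⊻ diR B A' A) =
      diR (C ⋎ B) A' A ≫ (as .or C B (A' ⋏ A)).hom := by
  have h1 : (as .or C B A').hom ≫ (co .or C (B ⋎ A')).hom ≫ ((co .or B A').hom ⊻ 𝟙 C) =
      (co .or (C ⋎ B) A').hom ≫ (𝟙 A' ⊻ (co .or C B).hom) ≫ (as .or A' B C).inv :=
    (as_rev _ _ _ _).symm
  have h2 : di A (B ⋎ A') C ≫ ((co .and A (B ⋎ A')).hom ⊻ 𝟙 C) ≫ (diR B A' A ⊻ 𝟙 C) =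
      (𝟙 A ⊼ ((co .or B A').hom ⊻ 𝟙 C)) ≫ di A (A' ⋎ B) C ≫ (di A A' B ⊻ 𝟙 C) ≫
        (((co .and A A').hom ⊻ 𝟙 B) ⊻ 𝟙 C) ≫ ((co .or (A' ⋏ A) B).hom ⊻ 𝟙 C) := by
    rw [← bmap_comp_left, co_diR, ← di_nat_assoc]
    simp only [bmap_comp_left]
  have h3 : (𝟙 A ⊼ (as .or A' B C).inv) ≫ di A (A' ⋎ B) C ≫ (di A A' B ⊻ 𝟙 C) =
      di A A' (B ⋎ C) ≫ (as .or (A ⋏ A') B C).inv := by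
    rw [← cancel_mono (as .or (A ⋏ A') B C).hom]
    simp only [Category.assoc, Iso.inv_hom_id, Category.comp_id]
    rw [← di_as_or, bmap_comp_assoc]
    simp
  have h4 : (as .or (A ⋏ A') B C).inv ≫ (((co .and A A').hom ⊻ 𝟙 B) ⊻ 𝟙 C) ≫
      ((co .or (A' ⋏ A) B).hom ⊻ 𝟙 C) ≫ (co .or (B ⋎ (A' ⋏ A)) C).hom =
      (𝟙 _ ⊻ (co .or B C).hom) ≫ ((co .and A A').hom ⊻ 𝟙 _) ≫ (co .or (A' ⋏ A) (C ⋎ B)).hom ≫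
        (as .or C B (A' ⋏ A)).hom := by
    have h := as_inv_rev .or (A' ⋏ A) B C
    rw [as_inv_nat_assoc, bmap_id, ← h, reassoc_of% (bmap_exchange .or)]
  have h5 : ((as .or C B A').hom ⊼ 𝟙 A) ≫ (co .and _ A).hom =
      (co .and _ A).hom ≫ (𝟙 A ⊼ (as .or C B A').hom) := (co_nat _ _ _).symm
  have h6 : di A A' (C ⋎ B) ≫ (𝟙 _ ⊻ (co .or C B).hom) =
      (𝟙 A ⊼ (𝟙 A' ⊻ (co .or C B).hom)) ≫ di A A' (B ⋎ C) := by rw [← di_nat, bmap_id]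
  have h7 : (𝟙 A ⊼ (as .or C B A').hom) ≫ (𝟙 A ⊼ (co .or C (B ⋎ A')).hom) ≫
      (𝟙 A ⊼ ((co .or B A').hom ⊻ 𝟙 C)) = (𝟙 A ⊼ (co .or (C ⋎ B) A').hom) ≫
        (𝟙 A ⊼ (𝟙 A' ⊻ (co .or C B).hom)) ≫ (𝟙 A ⊼ (as .or A' B C).inv) := by
    simp only [← bmap_comp_right, h1]
  rw [diR_def C, diR_def (C ⋎ B)]
  simp only [Category.assoc]
  rw [co_nat, reassoc_of% h5, reassoc_of% h2, reassoc_of% h7, reassoc_of% h3, h4,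
    ← reassoc_of% h6]
  have h8 : (𝟙 (A ⋏ A') ⊻ (co .or C B).hom) ≫ (𝟙 (A ⋏ A') ⊻ (co .or B C).hom) = 𝟙 _ := by
    rw [← bmap_comp_right, co_co, bmap_id]
  rw [reassoc_of% h8]

/-! ### Coelements -/

/-- A coelement of `N`: a natural family of arrows `N ∨ Z ⊢ Z` that is compatible with
associativity and distribution. -/
structure CoEl (N : PN P) where
  app (Z : PN P) : N ⋎ Z ⟶ Z
  nat {Z W : PN P} (f : Z ⟶ W) : app Z ≫ f = (𝟙 N ⊻ f) ≫ app W
  app_or (Z W : PN P) : (as .or N Z W).hom ≫ app (Z ⋎ W) = app Z ⊻ 𝟙 W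
  app_and (Z W : PN P) : di Z W N ≫ (co .or _ _).hom ≫ app (Z ⋏ W) =
    𝟙 Z ⊼ ((co .or _ _).hom ≫ app W)

namespace CoEl

/-- The coelement of `p ∧ ¬p`. -/
def ax (p : P) : CoEl (bot p : PN P) where
  app := sig p
  nat f := sig_nat p f
  app_or Z W := as_sig p W Z
  app_and Z W := di_sig p W Z

/-- The coelement with its disjunct on the right. -/
def appR {N : PN P} (e : CoEl N) (Z : PN P) : Z ⋎ N ⟶ Z := (co .or Z N).hom ≫ e.app Z

theorem appR_nat {N : PN P} (e : CoEl N) {Z W : PN P} (f : Z ⟶ W) :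
    e.appR Z ≫ f = (f ⊻ 𝟙 N) ≫ e.appR W := by
  rw [appR, Category.assoc, e.nat, appR, co_nat_assoc]

theorem appR_or {N : PN P} (e : CoEl N) (Z W : PN P) :
    (as .or Z W N).hom ≫ (𝟙 Z ⊻ e.appR W) = e.appR (Z ⋎ W) := by
  have h : e.app (Z ⋎ W) = (𝟙 N ⊻ (co .or Z W).hom) ≫ e.app (W ⋎ Z) ≫ (co .or W Z).hom := by
    rw [e.nat, bmap_comp_assoc]
    simp
  have h' := e.app_or W Z
  rw [← Iso.eq_inv_comp] at h'
  have h2 := reassoc_of% (as_rev .or Z W N)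
  rw [appR, appR, h, h', Category.assoc, h2, bmap_comp_assoc, Category.comp_id, ← co_nat]
  simp

/-- Dual to `El.app_bmap_as`: an `N` between `Z` and `W` may be deleted with either neighbour. -/
theorem appR_bmap {N : PN P} (e : CoEl N) (Z W : PN P) :
    (e.appR Z ⊻ 𝟙 W) = (as .or Z N W).hom ≫ (𝟙 Z ⊻ e.app W) := by
  have h1 : e.appR Z ⊻ 𝟙 W = ((co .or Z N).hom ⊻ 𝟙 W) ≫ (e.app Z ⊻ 𝟙 W) := by
    simp [appR, bmap_comp]
  have h2 : 𝟙 Z ⊻ e.app W = (𝟙 Z ⊻ (co .or N W).hom) ≫ (𝟙 Z ⊻ e.appR W) := by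
    simp [appR, bmap_comp]
  have h3 := e.appR_or Z W
  rw [← Iso.eq_inv_comp] at h3
  have h4 := co_as_inv .or N Z W
  rw [Iso.comp_inv_eq, Category.assoc] at h4
  have h5 := sw_hom .or Z N W
  rw [h1, h2, h3, appR, ← e.app_or, h4, ← sw_sw_assoc .or Z N W (((co .or Z N).hom ⊻ 𝟙 W) ≫ _),
    h5]
  simp only [Category.assoc]

/-- The image of a coelement by an arrow in the opposite direction. -/
def act {M N : PN P} (e : CoEl N) (f : M ⟶ N) : CoEl M where
  app Z := (f ⊻ 𝟙 Z) ≫ e.app Z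
  nat g := by
    rw [Category.assoc, e.nat, bmap_comp_assoc, bmap_comp_assoc]
    simp
  app_or Z W := by
    rw [← bmap_id, ← as_nat_assoc, e.app_or, bmap_comp, Category.comp_id]
  app_and Z W := by
    rw [co_nat_assoc, ← bmap_id, di_nat_assoc, e.app_and, bmap_comp, co_nat_assoc]
    simp

theorem act_app {M N : PN P} (e : CoEl N) (f : M ⟶ N) (Z : PN P) :
    (e.act f).app Z = (f ⊻ 𝟙 Z) ≫ e.app Z := rfl

theorem act_appR {M N : PN P} (e : CoEl N) (f : M ⟶ N) (Z : PN P) :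
    (e.act f).appR Z = (𝟙 Z ⊻ f) ≫ e.appR Z := by
  rw [appR, act_app, co_nat_assoc, appR]

end CoEl

/-! ### Dual formulae -/

/-- A duality between `A` and `A'`. -/
structure Dual (A A' : PN P) where
  el : El (A ⋎ A')
  co : CoEl (A' ⋏ A)
  -- The triangular identities of a duality; for letters they are the last two equations of `PN`.
  tri : el.app A ≫ (PN.co .and _ _).hom ≫ diR A A' A ≫ co.appR A = 𝟙 A
  tri' : el.app A' ≫ di A' A A' ≫ co.app A' = 𝟙 A'

namespace Dual

/-- The duality of `p` and `¬p`. -/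
def ax (p : P) : Dual (negLetter p : PN P) (letter p) where
  el := El.ax p
  co := CoEl.ax p
  tri := by
    rw [reassoc_of% co_diR, CoEl.appR, co_co_assoc]
    exact del_sig' p
  tri' := del_sig p

/-- Duality is symmetric. -/
def symm {A A' : PN P} (D : Dual A A') : Dual A' A where
  el := D.el.act (PN.co .or A A').hom
  co := D.co.act (PN.co .and A A').hom
  tri := by
    rw [reassoc_of% co_diR, CoEl.appR, co_co_assoc, El.act_app, Category.assoc, CoEl.act_app,
      bmap_comp_assoc, bmap_comp_assoc]
    simpa using D.tri'
  tri' := by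
    have h := D.tri
    rw [reassoc_of% co_diR, CoEl.appR, co_co_assoc] at h
    rw [El.act_app, Category.assoc, CoEl.act_app]
    exact h

variable {A A' B B' : PN P}

/-- The introduction of a pair of dual formulae. -/
def intr (D : Dual A A') (X : PN P) : X ⟶ (X ⋏ A) ⋎ A' := D.el.app X ≫ di X A A'

/-- The elimination of a pair of dual formulae. -/
def elim (D : Dual A A') (C : PN P) : (C ⋎ A') ⋏ A ⟶ C := diR C A' A ≫ D.co.appR C

theorem intr_nat (D : Dual A A') {X Y : PN P} (f : X ⟶ Y) :
    f ≫ D.intr Y = D.intr X ≫ ((f ⊼ 𝟙 A) ⊻ 𝟙 A') := by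
  rw [intr, D.el.nat_assoc, intr, Category.assoc, di_nat, bmap_id]

theorem elim_nat (D : Dual A A') {X Y : PN P} (f : X ⟶ Y) :
    D.elim X ≫ f = ((f ⊻ 𝟙 A') ⊼ 𝟙 A) ≫ D.elim Y := by
  rw [elim, elim, Category.assoc, CoEl.appR_nat, ← bmap_id, diR_nat_assoc]

/-- With `tri_or`, this makes `intr` and `elim` the unit and counit of an adjunction between `- ∧ A`
and `- ∨ A'`. The compatibility of elements and coelements with `∧` reduces it to `tri`, beside `X`.
-/
theorem tri_and (D : Dual A A') (X : PN P) :
    (D.intr X ⊼ 𝟙 A) ≫ D.elim (X ⋏ A) = 𝟙 _ := by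
  have e : D.intr X ⊼ 𝟙 A = (D.el.app X ⊼ 𝟙 A) ≫ (di X A A' ⊼ 𝟙 A) := by simp [intr, bmap_comp]
  have h := D.el.app_bmap_as X A
  have h2 := D.tri
  rw [elim, e, Category.assoc, reassoc_of% diR_di_and, reassoc_of% h]
  rw [CoEl.appR, D.co.app_and, bmap_comp, bmap_comp]
  simp only [Category.assoc, Category.comp_id]
  rw [CoEl.appR] at h2
  rw [h2, bmap_id]

theorem app_or_diR {B : PN P} (y : El B) (Z W : PN P) :
    y.app (Z ⋎ W) ≫ diR Z W B = 𝟙 Z ⊻ y.app W := by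
  have h := y.nat_assoc (PN.co .or Z W).hom (dl W Z B)
  rw [El.app_or'] at h
  rw [diR_eq, ← reassoc_of% h, ← co_nat, PN.co_co_assoc]

theorem tri_or (D : Dual A A') (C : PN P) :
    D.intr (C ⋎ A') ≫ (D.elim C ⊻ 𝟙 A') = 𝟙 _ := by
  have e : D.elim C ⊻ 𝟙 A' = (diR C A' A ⊻ 𝟙 A') ≫ (D.co.appR C ⊻ 𝟙 A') := by
    simp [elim, bmap_comp]
  have h : (D.co.appR C ⊻ 𝟙 A') = (as .or C (A' ⋏ A) A').hom ≫ (𝟙 C ⊻ D.co.app A') :=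
    D.co.appR_bmap C A'
  have h2 := app_or_diR D.el C A'
  rw [intr, e, Category.assoc, h, ← reassoc_of% diR_di_or, reassoc_of% h2, bmap_comp, bmap_comp]
  simp only [Category.comp_id]
  rw [D.tri', bmap_id]

/-- The coelement chosen for `A ∧ B` yields the counit of the composite of the two adjunctions;
`intr_and` says the same of the unit. -/
theorem elim_and (D : Dual A A') (E : Dual B B') (C : PN P) :
    ((as .or C B' A').hom ⊼ 𝟙 (A ⋏ B)) ≫ diR C (B' ⋎ A') (A ⋏ B) ≫
        (E.co.act ((as .and _ _ _).inv ≫ (D.elim B' ⊼ 𝟙 B))).appR C =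
      (as .and _ A B).inv ≫ (D.elim (C ⋎ B') ⊼ 𝟙 B) ≫ E.elim C := by
  have h1 : ((as .or C B' A').hom ⊼ 𝟙 A) ≫ diR C (B' ⋎ A') A ≫ (𝟙 C ⊻ D.elim B') =
      D.elim (C ⋎ B') := by
    rw [elim, bmap_comp_right, reassoc_of% diR_as_or, CoEl.appR_or, elim]
  have h2 : diR C (B' ⋎ A') (A ⋏ B) ≫ (𝟙 C ⊻ (as .and (B' ⋎ A') A B).inv) =
      (as .and _ A B).inv ≫ (diR C (B' ⋎ A') A ⊼ 𝟙 B) ≫ diR C ((B' ⋎ A') ⋏ A) B := by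
    rw [Iso.eq_inv_comp, reassoc_of% diR_as_and, ← bmap_comp_right]
    simp
  have h3 : ((as .or C B' A').hom ⊼ 𝟙 (A ⋏ B)) ≫ (as .and _ A B).inv =
      (as .and _ A B).inv ≫ (((as .or C B' A').hom ⊼ 𝟙 A) ⊼ 𝟙 B) := by
    rw [as_inv_nat, bmap_id]
  rw [CoEl.act_appR, bmap_comp_right, Category.assoc, reassoc_of% h2, reassoc_of% h3,
    diR_nat_assoc, ← h1]
  simp only [bmap_comp_left, Category.assoc, elim]

theorem intr_and (D : Dual A A') (E : Dual B B') (X : PN P) :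
    (D.el.act ((E.intr A ⊻ 𝟙 A') ≫ (as .or _ _ _).hom)).app X ≫ di X (A ⋏ B) (B' ⋎ A') =
      D.intr X ≫ (E.intr (X ⋏ A) ⊻ 𝟙 A') ≫ (as .or _ _ _).hom ≫ ((as .and X A B).hom ⊻ 𝟙 _) := by
  have h : (𝟙 X ⊼ E.intr A) ≫ di X (A ⋏ B) B' =
      E.intr (X ⋏ A) ≫ ((as .and X A B).hom ⊻ 𝟙 B') :=
    (E.el.hat_and (Δ := some B') X A).symm
  rw [El.act_app, bmap_comp_right]
  simp only [Category.assoc]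
  rw [di_as_or, ← di_nat_assoc, ← bmap_id .or B' A', ← as_nat, ← Category.assoc (D.el.app X)]
  have h' := congrArg (fun f => f ⊻ 𝟙 A') h
  simp only [bmap_comp_left] at h'
  rw [reassoc_of% h']
  rfl

/-- The duality of a conjunction and a disjunction. -/
def and (D : Dual A A') (E : Dual B B') : Dual (A ⋏ B) (B' ⋎ A') where
  el := D.el.act ((E.intr A ⊻ 𝟙 A') ≫ (as .or _ _ _).hom)
  co := E.co.act ((as .and _ _ _).inv ≫ (D.elim B' ⊼ 𝟙 B))
  tri := by
    have h1 : D.el.app (A ⋏ B) ≫ (PN.co .and _ _).hom ≫ (as .and (A ⋎ A') A B).inv =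
        (D.el.app A ≫ (PN.co .and _ _).hom) ⊼ 𝟙 B := by
      have h := D.el.app_and A B
      rw [← Iso.eq_comp_inv] at h
      have h' := reassoc_of% (D.el.app_bmap_as A B)
      have e : D.el.app B = (D.el.app B ≫ (PN.co .and B (A ⋎ A')).hom) ≫
        (PN.co .and (A ⋎ A') B).hom := by simp
      rw [h, e, bmap_comp_right, ← D.el.app_bmap_as, Category.assoc, Category.assoc, co_as_inv]
      have hs := sw_hom .and A (A ⋎ A') B
      have hs2 := reassoc_of% hs
      rw [Category.assoc, ← hs2, sw_sw_assoc, ← bmap_comp_left]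
    -- Naturality of `D.elim` brings the introduction and the elimination of `E` together, for
    -- `tri_and` to cancel. What remains is the identity `tri` of `D`, beside `B`.
    have h2 : ((E.intr A ⊻ 𝟙 A') ⊼ 𝟙 (A ⋏ B)) ≫ (as .and _ A B).inv ≫
        (D.elim (A ⋏ B ⋎ B') ⊼ 𝟙 B) =
        (as .and _ A B).inv ≫ (D.elim A ⊼ 𝟙 B) ≫ (E.intr A ⊼ 𝟙 B) := by
      rw [← bmap_id, ← as_inv_nat_assoc, ← bmap_comp_left, ← bmap_comp_left, elim_nat]
    have h3 := D.tri
    rw [El.act_app, Category.assoc, ← co_nat_assoc, bmap_comp_left, Category.assoc, elim_and,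
      reassoc_of% h2, tri_and, Category.comp_id, reassoc_of% h1, ← bmap_comp_left, Category.assoc]
    rw [elim, h3, bmap_id]
  tri' := by
    have h1 : ((as .and (B' ⋎ A') A B).hom ⊻ 𝟙 (B' ⋎ A')) ≫
        ((as .and (B' ⋎ A') A B).inv ⊻ 𝟙 _) = 𝟙 _ := by
      rw [← bmap_comp_left, Iso.hom_inv_id, bmap_id]
    -- Here naturality of `E.intr` brings the pair of `D` together, for `tri_or`, and the identity
    -- `tri'` of `E` remains.
    have h2 : (E.intr ((B' ⋎ A') ⋏ A) ⊻ 𝟙 A') ≫ (((D.elim B' ⊼ 𝟙 B) ⊻ 𝟙 B') ⊻ 𝟙 A') =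
        (D.elim B' ⊻ 𝟙 A') ≫ (E.intr B' ⊻ 𝟙 A') := by
      rw [← bmap_comp_left, ← bmap_comp_left, intr_nat]
    have h3 := E.tri'
    rw [reassoc_of% intr_and, CoEl.act_app, bmap_comp_left, Category.assoc, reassoc_of% h1,
      ← bmap_id .or B' A', ← as_nat_assoc, reassoc_of% h2, reassoc_of% (D.tri_or B'),
      CoEl.app_or, ← bmap_comp_left, intr, Category.assoc, h3]

/-- An arrow from `A` is determined by its action on the element of `A ∨ A'`. -/
theorem act_injective (D : Dual A A') {C : PN P} {f g : A ⟶ C}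
    (h : D.el.act (f ⊻ 𝟙 A') = D.el.act (g ⊻ 𝟙 A')) : f = g := by
  -- The arrow is recovered from its element by inserting the element next to `A` and eliminating
  -- the dual pair: naturality moves `f` to the end, and `tri` removes the rest.
  have key : ∀ f : A ⟶ C, f = (D.el.act (f ⊻ 𝟙 A')).app A ≫ (PN.co .and _ _).hom ≫ D.elim C := by
    intro f
    rw [El.act_app, Category.assoc, ← co_nat_assoc, ← elim_nat, elim, Category.assoc,
      reassoc_of% D.tri]
  rw [key f, key g, h]

end Dual

/-- De Morgan duals; the disjunction is obtained from the conjunction by symmetry of duality. The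
element is cut-free because all arrows are admissible, and the exchange of signs is recorded for the
later count of letters. -/
theorem exists_dual (A : PN P) : ∃ (A' : PN P) (D : Dual A A'), CF D.el ∧
    ∀ p, pos p A' = neg p A ∧ neg p A' = pos p A := by
  induction A with
  | letter p =>
    exact ⟨_, (Dual.ax p).symm, .ac (.co _ _) (.ax p), fun q => ⟨rfl, rfl⟩⟩
  | negLetter p => exact ⟨_, Dual.ax p, .ax p, fun q => ⟨rfl, rfl⟩⟩
  | bin ξ A B ihA ihB =>
    obtain ⟨A', D, hD, hA⟩ := ihA
    obtain ⟨B', E, hE, hB⟩ := ihB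
    cases ξ
    · exact ⟨_, D.and E, (((Adm.all _).comp (Adm.of_ac (.as _ _ _))).act hD), fun p => by
        simp [pos, neg, hA, hB, add_comm]⟩
    · exact ⟨_, (E.symm.and D.symm).symm, ((Adm.all _).act ((Adm.all _).act ((Adm.all _).act hE))), fun p => by
        simp [pos, neg, hA, hB, add_comm]⟩

/-! ### Formulae with letters from a given set -/

/-- All letters of the formula satisfy `U`. -/
def Within (U : P → Prop) : PN P → Prop
  | letter p => U p
  | negLetter p => U p
  | bin _ A B => Within U A ∧ Within U B

theorem within_iff_atoms {U : P → Prop} {S : PN P} :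
    Within U S ↔ ∀ a ∈ atoms S, Within U a := by
  induction S with
  | letter p => simp [atoms]
  | negLetter p => simp [atoms]
  | bin ξ A B ihA ihB =>
    cases ξ
    · simp [atoms]
    · simp only [Within, ihA, ihB, atoms_or, Multiset.mem_add, or_imp, forall_and]

theorem Within.of_occurs {U : P → Prop} {A : PN P} (h : ∀ p, 0 < pos p A + neg p A → U p) :
    Within U A := by
  induction A with
  | letter p => exact h p (by simp [pos])
  | negLetter p => exact h p (by simp [neg])
  | bin ξ A B ihA ihB =>
    exact ⟨ihA fun p hp => h p (by simp only [pos, neg]; omega),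
      ihB fun p hp => h p (by simp only [pos, neg]; omega)⟩

/-- Every formula contains a letter. Hence, for disjoint `U` and `V`, no formula is within both,
which is how the lemma is mostly used. -/
theorem Within.exists_and {U V : P → Prop} {A : PN P} (h : Within U A) (h' : Within V A) :
    ∃ p, U p ∧ V p := by
  induction A with
  | letter p => exact ⟨p, h, h'⟩
  | negLetter p => exact ⟨p, h, h'⟩
  | bin ξ A B ihA _ => exact ihA h.1 h'.1

theorem within_oo {U : P → Prop} {A : PN P} {R : Option (PN P)} :
    Within U (oo A R) ↔ Within U A ∧ ∀ a ∈ oatoms R, Within U a := by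
  rw [within_iff_atoms, within_iff_atoms (S := A), atoms_oo]
  simp only [Multiset.mem_add, or_imp, forall_and]

/-- The disjuncts of a provable formula cannot be separated by their letters. -/
theorem CF.within_or_within {S : PN P} {x : El S} (hx : CF x) {U V : P → Prop}
    (hUV : ∀ p, U p → ¬ V p) (h : ∀ a ∈ atoms S, Within U a ∨ Within V a) :
    Within U S ∨ Within V S := by
  induction hx with
  | ax p =>
    have h1 := h (negLetter p) (by simp [atoms])
    simpa [Within] using h1
  | ac hσ _ ih =>
    rw [within_iff_atoms, within_iff_atoms (U := V), ← hσ.atoms_eq] at *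
    exact ih h
  | @tens A B Γ Δ x y _ _ ih ih' =>
    -- The conjunction decides the side: a premiss on the other side would put `A` or `B` within
    -- both sets.
    have key : ∀ {U V : P → Prop}, (∀ p, U p → ¬ V p) →
        (∀ a ∈ atoms (oo (oo (A ⋏ B) Δ) Γ), Within U a ∨ Within V a) → Within U (A ⋏ B) →
        (Within U (oo A Γ) ∨ Within V (oo A Γ)) → (Within U (oo B Δ) ∨ Within V (oo B Δ)) →
        Within U (oo (oo (A ⋏ B) Δ) Γ) := by
      intro U V hUV h hAB h1 h2
      rw [within_oo, within_oo]
      have h1' := h1.resolve_right fun h' =>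
        let ⟨p, hp, hp'⟩ := hAB.1.exists_and (within_oo.1 h').1
        hUV p hp hp'
      have h2' := h2.resolve_right fun h' =>
        let ⟨p, hp, hp'⟩ := hAB.2.exists_and (within_oo.1 h').1
        hUV p hp hp'
      exact ⟨⟨hAB, (within_oo.1 h2').2⟩, (within_oo.1 h1').2⟩
    have hAB := h (A ⋏ B) (by simp [atoms])
    have hA : ∀ a ∈ atoms (oo A Γ), Within U a ∨ Within V a := by
      intro a ha
      rw [atoms_oo, Multiset.mem_add] at ha
      rcases ha with ha | ha
      · exact hAB.imp (fun h => within_iff_atoms.1 h.1 a ha) fun h => within_iff_atoms.1 h.1 a ha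
      · exact h a (by simp [ha])
    have hB : ∀ a ∈ atoms (oo B Δ), Within U a ∨ Within V a := by
      intro a ha
      rw [atoms_oo, Multiset.mem_add] at ha
      rcases ha with ha | ha
      · exact hAB.imp (fun h => within_iff_atoms.1 h.2 a ha) fun h => within_iff_atoms.1 h.2 a ha
      · exact h a (by simp [ha])
    rcases hAB with hAB | hAB
    · exact .inl (key hUV h hAB (ih hA) (ih' hB))
    · exact .inr (key (fun p hp hp' => hUV p hp' hp) (fun a ha => (h a ha).symm) hAB (ih hA).symm
        (ih' hB).symm)

/-! ### Linear formulae -/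

/-- No letter occurs twice with the same sign. -/
def Linear (S : PN P) : Prop := ∀ p, pos p S ≤ 1 ∧ neg p S ≤ 1

theorem pos_eq_sum (p : P) (S : PN P) : pos p S = ((atoms S).map (pos p)).sum := by
  induction S with
  | letter p => simp [atoms]
  | negLetter p => simp [atoms]
  | bin ξ A B ihA ihB =>
    cases ξ
    · simp [atoms]
    · simp [pos, ihA, ihB]

theorem neg_eq_sum (p : P) (S : PN P) : neg p S = ((atoms S).map (neg p)).sum := by
  induction S with
  | letter p => simp [atoms]
  | negLetter p => simp [atoms]
  | bin ξ A B ihA ihB =>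
    cases ξ
    · simp [atoms]
    · simp [neg, ihA, ihB]

namespace Linear

theorem ac {S T : PN P} {σ : S ⟶ T} (h : AC σ) (hT : Linear T) : Linear S := fun p => by
  rw [h.pos_eq, h.neg_eq]
  exact hT p

theorem tens_left {A B : PN P} {Γ Δ : Option (PN P)} (h : Linear (oo (oo (A ⋏ B) Δ) Γ)) :
    Linear (oo A Γ) := fun p => by
  have := h p
  cases Γ <;> cases Δ <;> simp only [oo, pos, neg] at this ⊢ <;> omega

theorem tens_right {A B : PN P} {Γ Δ : Option (PN P)} (h : Linear (oo (oo (A ⋏ B) Δ) Γ)) :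
    Linear (oo B Δ) := fun p => by
  have := h p
  cases Γ <;> cases Δ <;> simp only [oo, pos, neg] at this ⊢ <;> omega

/-- A repeated disjunct could contain no letter at all. -/
theorem nodup {S : PN P} (h : Linear S) : (atoms S).Nodup := by
  rw [Multiset.nodup_iff_ne_cons_cons]
  intro a t e
  have ha : Within (fun _ => False) a := .of_occurs fun p hp => by
    have h1 := h p
    rw [pos_eq_sum, neg_eq_sum, e] at h1
    simp only [Multiset.map_cons, Multiset.sum_cons] at h1
    omega
  obtain ⟨p, hp, _⟩ := ha.exists_and ha
  exact hp

end Linear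

/-! ### Splitting -/

/-- A proof of `S` that ends, up to associativity and commutativity, with the introduction of
the conjunction `C ∧ D`, where `U` and `V` hold of the remaining disjuncts of the premisses. -/
def Splits (U V : P → Prop) (C D : PN P) {S : PN P} (x : El S) : Prop :=
  ∃ (G₁ G₂ : Option (PN P)) (x₁ : El (oo C G₁)) (x₂ : El (oo D G₂))
    (τ : oo (oo (C ⋏ D) G₂) G₁ ⟶ S), CF x₁ ∧ CF x₂ ∧ AC τ ∧
      (∀ a ∈ oatoms G₁, Within U a) ∧ (∀ a ∈ oatoms G₂, Within V a) ∧ x = (El.tens x₁ x₂).act τ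

namespace Splits

variable {U V : P → Prop} {C D : PN P}

theorem ac {S T : PN P} {x : El S} (h : Splits U V C D x) {σ : S ⟶ T} (hσ : AC σ) :
    Splits U V C D (x.act σ) := by
  obtain ⟨G₁, G₂, x₁, x₂, τ, h₁, h₂, hτ, hU, hV, rfl⟩ := h
  exact ⟨G₁, G₂, x₁, x₂, τ ≫ σ, h₁, h₂, hτ.comp hσ, hU, hV, El.act_act _ _ _⟩

/-- An arrow on some of the disjuncts of `G` commutes with the rearrangement of disjuncts. -/
theorem exists_rearrange {T A X G W : PN P} {Γ : Option (PN P)} (hT : (atoms (oo A Γ)).Nodup)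
    {τ : T ⟶ oo A Γ} (hτ : AC τ) {e : T ⟶ X ⋎ G} (he : AC e) (h : atoms A ≤ atoms G)
    (g : A ⟶ W) :
    ∃ (R : Option (PN P)) (ρ : G ⟶ oo A R) (τ' : X ⋎ oo W R ⟶ oo W Γ), AC ρ ∧ AC τ' ∧
      τ ≫ oo1 g Γ = e ≫ (𝟙 X ⊻ (ρ ≫ oo1 g R)) ≫ τ' := by
  obtain ⟨R, ρ, hρ⟩ := exists_ac_of_le h
  have hat := (hτ.atoms_eq.symm.trans he.atoms_eq).trans ((AC.id X).map hρ).atoms_eq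
  obtain ⟨κ, hκ⟩ : ∃ κ : OHom (oplus R (some X)) Γ, κ.AC := by
    apply exists_ohom_ac
    simp only [atoms_oo, atoms_or] at hat
    rw [oatoms_oplus, oatoms, ← add_right_inj (atoms A), hat]
    abel
  refine ⟨R, ρ, (co .or _ _).hom ≫ (asc W R (some X)).hom ≫ oo2 (𝟙 W) κ, hρ,
    (AC.co _ _).comp ((AC.asc _ _ _).comp ((AC.id _).oo2 hκ)), ?_⟩
  -- Coherence for distinct disjuncts replaces the unknown `τ` by a rearrangement that isolates `A`
  -- inside `G`.
  have e1 : τ = e ≫ (𝟙 X ⊻ ρ) ≫ (co .or _ _).hom ≫ (asc A R (some X)).hom ≫ oo2 (𝟙 A) κ :=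
    AC.eq_of_nodup hT hτ (he.comp (((AC.id _).map hρ).comp ((AC.co _ _).comp
      ((AC.asc _ _ _).comp ((AC.id _).oo2 hκ)))))
  have e2 := asc_nat g (OHom.id R) (OHom.id (some X))
  rw [OHom.oplus_id] at e2
  have e3 : oo1 g R ⊻ 𝟙 X = oo2 (oo1 g R) (OHom.id (some X)) := rfl
  rw [e1, bmap_comp_right]
  simp only [Category.assoc]
  rw [← co_nat_assoc .or (𝟙 X) (oo1 g R), e3, reassoc_of% e2, oo2_comp, oo2_comp]
  simp

/-- Splitting is preserved by arrows on one part of the context. -/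
theorem act_oo1 (hUV : ∀ p, U p → ¬ V p) (hC : Within U C) (hD : Within V D) {A W : PN P}
    {Γ : Option (PN P)} (hA : Within U A ∧ Within U W ∨ Within V A ∧ Within V W)
    {x : El (oo A Γ)} (hS : (atoms (oo A Γ)).Nodup) (hx : Splits U V C D x)
    (g : A ⟶ W) : Splits U V C D (x.act (oo1 g Γ)) := by
  obtain ⟨G₁, G₂, x₁, x₂, τ, h₁, h₂, hτ, hU, hV, rfl⟩ := hx
  have hat := hτ.atoms_eq
  simp only [atoms_oo] at hat
  have hat1 : atoms (C ⋏ D) = {C ⋏ D} := rfl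
  have hle : atoms A ≤ atoms (C ⋏ D) + oatoms G₂ + oatoms G₁ := hat ▸ Multiset.le_add_right _ _
  have hctx : ∀ {U : P → Prop} {G : PN P} {R : Option (PN P)} {ρ : G ⟶ oo A R}, Within U W →
      (∀ a ∈ atoms G, Within U a) → AC ρ → ∀ a ∈ atoms (oo W R), Within U a := by
    intro U G R ρ hW hG hρ
    rw [hρ.atoms_eq, ← within_iff_atoms, within_oo] at hG
    rw [← within_iff_atoms, within_oo]
    exact ⟨hW, hG.2⟩
  classical
  rw [El.act_act]
  rcases hA with ⟨hA, hW⟩ | ⟨hA, hW⟩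
  -- No disjunct within `U` can come from `C ∧ D`, since `D` is within `V`, nor from `G₂`. So `A`
  -- consists of disjuncts of `G₁`, and `g` can be applied inside the first premiss before the
  -- tensor.
  · have hle' : atoms A ≤ oatoms G₁ := by
      have h1 := Multiset.filter_le_filter (Within U) hle
      rw [Multiset.filter_add, Multiset.filter_add, hat1, Multiset.filter_singleton, if_neg,
        Multiset.filter_eq_self.2 (within_iff_atoms.1 hA), Multiset.filter_eq_self.2 hU,
        Multiset.filter_eq_nil.2] at h1
      · simpa using h1
      · intro a ha ha'
        obtain ⟨p, hp, hp'⟩ := ha'.exists_and (hV a ha)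
        exact hUV p hp hp'
      · intro h
        obtain ⟨p, hp, hp'⟩ := h.2.exists_and hD
        exact hUV p hp hp'
    cases G₁ with
    | none =>
      obtain ⟨a, ha⟩ := exists_mem_atoms A
      exact absurd (Multiset.mem_of_le hle' ha) (Multiset.notMem_zero a)
    | some G =>
      obtain ⟨R, ρ, τ', hρ, hτ', e⟩ := exists_rearrange hS hτ (AC.id _) hle' g
      refine ⟨some (oo W R), G₂, x₁.act (𝟙 C ⊻ (ρ ≫ oo1 g R)), x₂, τ', (Adm.all _).act h₁, h₂,
        hτ', hctx hW hU hρ, hV, ?_⟩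
      have h := El.tens_act x₁ x₂ (𝟙 C) (𝟙 D) (OHom.some (ρ ≫ oo1 g R)) (OHom.id G₂)
      rw [oo2_id, El.act_id, bmap_id, oo2_id] at h
      rw [e, Category.id_comp, ← El.act_act]
      exact congrArg (fun z => El.act z τ') h.symm
  · have hle' : atoms A ≤ oatoms G₂ := by
      have h1 := Multiset.filter_le_filter (Within V) hle
      rw [Multiset.filter_add, Multiset.filter_add, hat1, Multiset.filter_singleton, if_neg,
        Multiset.filter_eq_self.2 (within_iff_atoms.1 hA), Multiset.filter_eq_self.2 hV,
        Multiset.filter_eq_nil.2] at h1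
      · simpa using h1
      · intro a ha ha'
        obtain ⟨p, hp, hp'⟩ := ha'.exists_and (hU a ha)
        exact hUV p hp' hp
      · intro h
        obtain ⟨p, hp, hp'⟩ := h.1.exists_and hC
        exact hUV p hp' hp
    cases G₂ with
    | none =>
      obtain ⟨a, ha⟩ := exists_mem_atoms A
      exact absurd (Multiset.mem_of_le hle' ha) (Multiset.notMem_zero a)
    | some G =>
      -- The tensor leaves `G₁` outermost, so an exchange first brings `G` to the outside.
      obtain ⟨R, ρ, τ', hρ, hτ', e⟩ := exists_rearrange hS hτ (AC.swo _ (some G) G₁) hle' g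
      refine ⟨G₁, some (oo W R), x₁, x₂.act (𝟙 D ⊻ (ρ ≫ oo1 g R)),
        (swo _ (some (oo W R)) G₁).hom ≫ τ', h₁, (Adm.all _).act h₂,
        (AC.swo _ _ _).comp hτ', hU, hctx hW hV hρ, ?_⟩
      have h := El.tens_act x₁ x₂ (𝟙 C) (𝟙 D) (OHom.id G₁) (OHom.some (ρ ≫ oo1 g R))
      rw [oo2_id, El.act_id, bmap_id] at h
      have h' := swo_nat (𝟙 (C ⋏ D)) (OHom.some (ρ ≫ oo1 g R)) (OHom.id G₁)
      rw [oo2_id] at h'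
      rw [e]
      have h2 := congrArg (fun z => El.act z ((swo _ (some (oo W R)) G₁).hom ≫ τ')) h
      refine Eq.trans ?_ h2.symm
      rw [El.act_act, reassoc_of% h']
      rfl

end Splits

/-- In a linear provable formula a conjunction whose conjuncts are separated by the letters can be
introduced last. -/
theorem CF.splits {U V : P → Prop} (hUV : ∀ p, U p → ¬ V p) {C D : PN P} (hC : Within U C)
    (hD : Within V D) {S : PN P} {x : El S} (hx : CF x) (hS : Linear S) (hCD : C ⋏ D ∈ atoms S)
    (h : ∀ a ∈ atoms S, a ≠ C ⋏ D → Within U a ∨ Within V a) : Splits U V C D x := by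
  induction hx with
  | ax p => simp [atoms] at hCD
  | ac hσ _ ih =>
    rw [← hσ.atoms_eq] at hCD h
    exact (ih (hS.ac hσ) hCD h).ac hσ
  | @tens A B Γ Δ x y hx hy ih ih' =>
    have hn := hS.nodup
    have hat : atoms (oo (oo (A ⋏ B) Δ) Γ) = {A ⋏ B} + oatoms Δ + oatoms Γ := by simp [atoms]
    rw [hat] at hn h hCD
    obtain ⟨hn1, -, hn2⟩ := Multiset.nodup_add.1 hn
    obtain ⟨-, -, hn3⟩ := Multiset.nodup_add.1 hn1
    have hΔ : ∀ a ∈ oatoms Δ, a ≠ A ⋏ B := fun a ha e =>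
      Multiset.disjoint_left.1 hn3 (Multiset.mem_singleton.2 e) ha
    have hΓ : ∀ a ∈ oatoms Γ, a ≠ A ⋏ B := fun a ha e =>
      Multiset.disjoint_left.1 hn2 (by simp [e]) ha
    have hΓΔ : ∀ a ∈ oatoms Δ, a ∉ oatoms Γ := fun a ha =>
      Multiset.disjoint_left.1 hn2 (by simp [ha])
    have hsub : ∀ {A : PN P} {R : Option (PN P)}, Within U A ∨ Within V A →
        (∀ a ∈ oatoms R, a ≠ C ⋏ D → Within U a ∨ Within V a) →
        ∀ a ∈ atoms (oo A R), a ≠ C ⋏ D → Within U a ∨ Within V a := by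
      intro A R hA hR a ha hne
      rw [atoms_oo, Multiset.mem_add] at ha
      exact ha.elim (fun ha => hA.imp (fun h => within_iff_atoms.1 h a ha)
        fun h => within_iff_atoms.1 h a ha) fun ha => hR a ha hne
    have hR : ∀ {R : Option (PN P)}, C ⋏ D ∉ oatoms R → ∀ {A}, Within U A ∨ Within V A →
        (∀ a ∈ oatoms R, a ≠ C ⋏ D → Within U a ∨ Within V a) →
        ∀ a ∈ atoms (oo A R), Within U a ∨ Within V a := by
      intro R hne A hA hR a ha
      rw [atoms_oo, Multiset.mem_add] at ha
      exact ha.elim (fun ha => hA.imp (fun h => within_iff_atoms.1 h a ha)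
        fun h => within_iff_atoms.1 h a ha) fun ha => hR a ha fun e => hne (e ▸ ha)
    have hside : ∀ {A B : PN P} {R : Option (PN P)}, Within U (A ⋏ B) ∨ Within V (A ⋏ B) →
        Within U (oo B R) ∨ Within V (oo B R) →
        Within U A ∧ Within U (oo (A ⋏ B) R) ∨ Within V A ∧ Within V (oo (A ⋏ B) R) := by
      intro A B R hAB hB
      simp only [within_oo] at hB ⊢
      rcases hAB with hAB | hAB
      · refine .inl ⟨hAB.1, hAB, (hB.resolve_right fun h' => ?_).2⟩
        obtain ⟨p, hp, hp'⟩ := hAB.2.exists_and h'.1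
        exact hUV p hp hp'
      · refine .inr ⟨hAB.1, hAB, (hB.resolve_left fun h' => ?_).2⟩
        obtain ⟨p, hp, hp'⟩ := hAB.2.exists_and h'.1
        exact hUV p hp' hp
    have h1 : ∀ a ∈ oatoms Γ, a ≠ C ⋏ D → Within U a ∨ Within V a := fun a ha =>
      h a (by simp [ha])
    have h2 : ∀ a ∈ oatoms Δ, a ≠ C ⋏ D → Within U a ∨ Within V a := fun a ha =>
      h a (by simp [ha])
    rw [Multiset.mem_add, Multiset.mem_add, Multiset.mem_singleton] at hCD
    rcases hCD with (hCD | hCD) | hCD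
    · cases hCD
      -- The given tensor already introduces `C ∧ D`; it remains to see that each premiss keeps to
      -- one side.
      have hx' := hx.within_or_within hUV (hR (fun h => hΓ _ h rfl) (.inl hC) h1)
      have hy' := hy.within_or_within hUV (hR (fun h => hΔ _ h rfl) (.inr hD) h2)
      simp only [within_oo] at hx' hy'
      refine ⟨Γ, Δ, x, y, 𝟙 _, hx, hy, .id _, (hx'.resolve_right fun h' => ?_).2,
        (hy'.resolve_left fun h' => ?_).2, (El.act_id _).symm⟩
      · obtain ⟨p, hp, hp'⟩ := hC.exists_and h'.1
        exact hUV p hp hp'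
      · obtain ⟨p, hp, hp'⟩ := hD.exists_and h'.1
        exact hUV p hp' hp
    -- The conjunction belongs to the second premiss, which splits by induction. The first premiss
    -- lies on the side of `A ∧ B`, so inserting it is an arrow confined to that side and `act_oo1`
    -- applies.
    · have hAB : Within U (A ⋏ B) ∨ Within V (A ⋏ B) := h _ (by simp) fun e => hΔ _ hCD e.symm
      have hx' := hx.within_or_within hUV (hR (hΓΔ _ hCD) (hAB.imp And.left And.left) h1)
      have hs := ih' hS.tens_right (by simp [hCD]) (hsub (hAB.imp And.right And.right) h2)
      have hBA : Within U (B ⋏ A) ∨ Within V (B ⋏ A) := hAB.imp And.symm And.symm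
      have hs' := hs.act_oo1 hUV hC hD (W := oo (A ⋏ B) Γ) ?_ hS.tens_right.nodup
        (x.hat B ≫ oo1 (co .and B A).hom Γ)
      · rw [El.tens_comm]
        rw [El.tens, El.act_act (f := oo1 (x.hat B) Δ), oo2_comp, OHom.id_comp]
        exact hs'.ac (.swo _ _ _)
      · have h3 := hside hBA hx'
        simp only [within_oo] at h3 ⊢
        exact h3.imp (fun h => ⟨h.1, h.2.1.symm, h.2.2⟩) fun h => ⟨h.1, h.2.1.symm, h.2.2⟩
    · have hAB : Within U (A ⋏ B) ∨ Within V (A ⋏ B) := h _ (by simp) fun e => hΓ _ hCD e.symm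
      have hy' := hy.within_or_within hUV
        (hR (fun h => hΓΔ _ h hCD) (hAB.imp And.right And.right) h2)
      have hs := ih hS.tens_left (by simp [hCD]) (hsub (hAB.imp And.left And.left) h1)
      exact hs.act_oo1 hUV hC hD (hside hAB hy') hS.tens_left.nodup (y.hat A)

/-- A linear formula has at most one cut-free proof. -/
theorem CF.eq_of_linear {S : PN P} {x y : El S} (hx : CF x) (hy : CF y) (hS : Linear S) :
    x = y := by
  induction hx with
  | ax p =>
    -- A tensor leaves a conjunction among the disjuncts, so without one every cut-free proof is a
    -- rearranged axiom.
    have key : ∀ {S} {y : El S}, CF y → (∀ A B, A ⋏ B ∉ atoms S) →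
        ∃ (q : P) (σ : top q ⟶ S), AC σ ∧ y = (El.ax q).act σ := by
      intro S y hy h
      induction hy with
      | ax q => exact ⟨q, 𝟙 _, .id _, (El.act_id _).symm⟩
      | ac hσ _ ih =>
        rw [← hσ.atoms_eq] at h
        obtain ⟨q, τ, hτ, rfl⟩ := ih h
        exact ⟨q, _, hτ.comp hσ, El.act_act _ _ _⟩
      | @tens A B _ _ _ _ _ _ _ _ => exact absurd (by simp [atoms]) (h A B)
    obtain ⟨q, σ, hσ, rfl⟩ := key hy (fun A B => by simp [atoms])
    have hq : negLetter q ∈ atoms (top p) := hσ.atoms_eq ▸ by simp [atoms]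
    have hqp : q = p := by simpa [atoms] using hq
    subst hqp
    rw [AC.eq_of_nodup hS.nodup hσ (.id _), El.act_id]
  | @ac S T σ x hσ hx ih =>
    obtain ⟨τ, hτ, -, h2⟩ := hσ.exists_inverse
    rw [ih (.ac hτ hy) (hS.ac hσ), El.act_act, h2, El.act_id]
  | @tens A B Γ Δ x₁ x₂ hx₁ hx₂ ih₁ ih₂ =>
    -- By balance, a letter common to both premisses would occur with both signs in each, and so
    -- twice positively in the conclusion.
    have hUV : ∀ p, 0 < pos p (oo A Γ) + neg p (oo A Γ) →
        ¬ 0 < pos p (oo B Δ) + neg p (oo B Δ) := by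
      intro p h1 h2
      have h3 := hS p
      have h4 := hx₁.pos_eq_neg p
      have h5 := hx₂.pos_eq_neg p
      cases Γ <;> cases Δ <;> simp only [oo, pos, neg] at h1 h2 h3 h4 h5 <;> omega
    have hU := Within.of_occurs (A := oo A Γ) fun p hp => hp
    have hV := Within.of_occurs (A := oo B Δ) fun p hp => hp
    rw [within_oo] at hU hV
    have hat : atoms (oo (oo (A ⋏ B) Δ) Γ) = {A ⋏ B} + oatoms Δ + oatoms Γ := by simp [atoms]
    obtain ⟨G₁, G₂, y₁, y₂, τ, h₁, h₂, hτ, hG₁, hG₂, rfl⟩ := hy.splits hUV hU.1 hV.1 hS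
      (by simp [atoms]) (by
        rw [hat]
        simp only [Multiset.mem_add, Multiset.mem_singleton]
        rintro a ((ha | ha) | ha) hne
        · exact absurd ha hne
        · exact .inr (hV.2 a ha)
        · exact .inl (hU.2 a ha))
    have hat' := hτ.atoms_eq
    rw [hat] at hat'
    classical
    -- Both proofs divide the same disjuncts, and filtering by `U` picks out the context of the
    -- first premiss in either division.
    have hdis : ∀ {U V : P → Prop}, (∀ p, U p → ¬ V p) → ∀ {G D G' D' : Multiset (PN P)},
        G + D = G' + D' → (∀ a ∈ G, Within U a) → (∀ a ∈ D, Within V a) →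
        (∀ a ∈ G', Within U a) → (∀ a ∈ D', Within V a) → G = G' := by
      intro U V hUV G D G' D' e hG hD hG' hD'
      have hnil : ∀ {D : Multiset (PN P)}, (∀ a ∈ D, Within V a) → D.filter (Within U) = 0 := by
        intro D hD
        refine Multiset.filter_eq_nil.2 fun a ha ha' => ?_
        obtain ⟨p, hp, hp'⟩ := ha'.exists_and (hD a ha)
        exact hUV p hp hp'
      have e' := congrArg (Multiset.filter (Within U)) e
      rwa [Multiset.filter_add, Multiset.filter_add, hnil hD, hnil hD', add_zero, add_zero,
        Multiset.filter_eq_self.2 hG, Multiset.filter_eq_self.2 hG'] at e'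
    have he : oatoms G₁ + oatoms G₂ = oatoms Γ + oatoms Δ := by
      have e1 : atoms (oo (oo (A ⋏ B) G₂) G₁) = {A ⋏ B} + (oatoms G₁ + oatoms G₂) := by
        rw [atoms_oo, atoms_oo, atoms]
        abel
      rw [e1, add_assoc, add_right_inj] at hat'
      rw [hat', add_comm]
    have e1 := hdis hUV he hG₁ hG₂ hU.2 hV.2
    rw [e1, add_right_inj] at he
    -- With the contexts aligned by `r` and `s`, induction identifies the premisses, and coherence
    -- identifies the final rearrangements.
    obtain ⟨r, hr⟩ := exists_ohom_ac e1
    obtain ⟨s, hs⟩ := exists_ohom_ac he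
    rw [ih₁ (.ac ((AC.id _).oo2 hr) h₁) hS.tens_left, ih₂ (.ac ((AC.id _).oo2 hs) h₂)
      hS.tens_right, El.tens_act, bmap_id]
    exact congrArg _ (AC.eq_of_nodup hS.nodup (((AC.id _).oo2 hs).oo2 hr) hτ)

end PN

namespace PN

open PNFormula

/-! ### Substitution of letters -/

section

variable {P Q : Type u} (s : Q → P)

/-- The substitution of letters in a formula. -/
def subst : PN Q → PN P
  | letter p => letter (s p)
  | negLetter p => negLetter (s p)
  | bin ξ A B => bin ξ (subst A) (subst B)

/-- The substitution of letters in an arrow term. -/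
def substTerm : ∀ {A B : PN Q}, PNTerm A B → PNTerm (subst s A) (subst s B)
  | _, _, .one _ => .one _
  | _, _, .b ξ _ _ _ => .b ξ _ _ _
  | _, _, .bInv ξ _ _ _ => .bInv ξ _ _ _
  | _, _, .cAnd _ _ => .cAnd _ _
  | _, _, .cOr _ _ => .cOr _ _
  | _, _, .d _ _ _ => .d _ _ _
  | _, _, .Del _ _ => .Del _ _
  | _, _, .Sig _ _ => .Sig _ _
  | _, _, .comp f g => .comp (substTerm f) (substTerm g)
  | _, _, .map ξ f g => .map ξ (substTerm f) (substTerm g)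

/-- The equations are schematic in letters, so even a substitution that identifies letters preserves
them. -/
theorem substTerm_eqn {A B : PN Q} {f g : PNTerm A B} (h : PNTerm.Eqn f g) :
    PNTerm.Eqn (substTerm s f) (substTerm s g) := by
  induction h with
  | symm _ ih => exact ih.symm
  | trans _ _ ih ih' => exact ih.trans ih'
  | cong_comp _ _ ih ih' => exact .cong_comp ih ih'
  | cong_map ξ _ _ ih ih' => exact .cong_map ξ ih ih'
  | refl f => exact .refl _
  | comp_one f => exact .comp_one _
  | one_comp f => exact .one_comp _
  | assoc h g f => exact .assoc _ _ _
  | map_one ξ A B => exact .map_one ξ _ _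
  | map_comp ξ g₁ f₁ g₂ f₂ => exact .map_comp ξ _ _ _ _
  | b_nat ξ f g h => exact .b_nat ξ _ _ _
  | cAnd_nat f g => exact .cAnd_nat _ _
  | cOr_nat f g => exact .cOr_nat _ _
  | d_nat f g h => exact .d_nat _ _ _
  | bInv_b ξ A B C => exact .bInv_b ξ _ _ _
  | b_bInv ξ A B C => exact .b_bInv ξ _ _ _
  | pentagon ξ A B C D => exact .pentagon ξ _ _ _ _
  | cAnd_cAnd A B => exact .cAnd_cAnd _ _
  | cOr_cOr A B => exact .cOr_cOr _ _
  | hexagonAnd A B C => exact .hexagonAnd _ _ _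
  | hexagonOr A B C => exact .hexagonOr _ _ _
  | d_and A B C D => exact .d_and _ _ _ _
  | d_or A B C D => exact .d_or _ _ _ _
  | d_bAnd A B C D => exact .d_bAnd _ _ _ _
  | d_bOr A B C D => exact .d_bOr _ _ _ _
  | Del_nat p f => exact .Del_nat _ _
  | Sig_nat p f => exact .Sig_nat _ _
  | b_Del p A B => exact .b_Del _ _ _
  | b_Sig p A B => exact .b_Sig _ _ _
  | d_SigAnd p B C => exact .d_SigAnd _ _ _
  | d_DelOr p B C => exact .d_DelOr _ _ _
  | Sig_Del p => exact .Sig_Del _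
  | Sig'_Del' p => exact .Sig'_Del' _

/-- The substitution of letters in an arrow. -/
def substMap {A B : PN Q} (f : A ⟶ B) : subst s A ⟶ subst s B :=
  Quotient.map (substTerm s) (fun _ _ h => substTerm_eqn s h) f

theorem substMap_comp {A B C : PN Q} (f : A ⟶ B) (g : B ⟶ C) :
    substMap s (f ≫ g) = substMap s f ≫ substMap s g := by
  obtain ⟨f, rfl⟩ := mk_surjective f
  obtain ⟨g, rfl⟩ := mk_surjective g
  rfl

theorem substMap_bmap (ξ : Conn) {A B C D : PN Q} (f : A ⟶ C) (g : B ⟶ D) :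
    substMap s (bmap ξ f g) = bmap ξ (substMap s f) (substMap s g) := by
  obtain ⟨f, rfl⟩ := mk_surjective f
  obtain ⟨g, rfl⟩ := mk_surjective g
  rfl

end

/-! ### Labelled formulae -/

variable {P : Type u} {N : Type}

/-- The formula in which the `k`-th occurrence of a letter is labelled with `φ k`. -/
def lab : (ℕ → N) → PN P → PN (P × N)
  | φ, letter p => letter (p, φ 0)
  | φ, negLetter p => negLetter (p, φ 0)
  | φ, bin ξ A B => bin ξ (lab φ A) (lab (fun k => φ (A.len + k)) B)

theorem subst_lab (φ : ℕ → N) (A : PN P) : subst Prod.fst (lab φ A) = A := by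
  induction A generalizing φ with
  | letter p => rfl
  | negLetter p => rfl
  | bin ξ A B ihA ihB => rw [lab, subst, ihA, ihB]

theorem lab_congr {φ χ : ℕ → N} {A : PN P} (h : ∀ k < A.len, φ k = χ k) : lab φ A = lab χ A := by
  induction A generalizing φ χ with
  | letter p => rw [lab, lab, h 0 Nat.one_pos]
  | negLetter p => rw [lab, lab, h 0 Nat.one_pos]
  | bin ξ A B ihA ihB =>
    rw [lab, lab, ihA fun k hk => h k (Nat.lt_add_right _ hk),
      ihB fun k hk => h _ (Nat.add_lt_add_left hk _)]

/-- Only an inequality, since occurrences of letters other than `p` may also carry the label `c`. -/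
theorem count_lab (φ : ℕ → N) (A : PN P) (p : P) (c : N) [DecidablePred fun k => φ k = c] :
    pos (p, c) (lab φ A) + neg (p, c) (lab φ A) ≤ Nat.count (fun k => φ k = c) A.len := by
  induction A generalizing φ with
  | letter q =>
    simp only [lab, pos, neg, len, Nat.count_succ, Nat.count_zero, Prod.mk.injEq]
    split_ifs <;> simp_all
  | negLetter q =>
    simp only [lab, pos, neg, len, Nat.count_succ, Nat.count_zero, Prod.mk.injEq]
    split_ifs <;> simp_all
  | bin ξ A B ihA ihB =>
    have h1 := ihA φ
    have h2 := ihB fun k => φ (A.len + k)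
    rw [len, Nat.count_add]
    simp only [lab, pos, neg]
    omega

/-- The pair of labellings `φ`, `χ` is constant on the classes of `R`. -/
def Const {m n : ℕ} (R : SplitEq (Fin m) (Fin n)) (φ χ : ℕ → N) : Prop :=
  ∀ u v, R u v → Sum.elim (fun k : Fin m => φ k) (fun k : Fin n => χ k) u =
    Sum.elim (fun k : Fin m => φ k) (fun k : Fin n => χ k) v

namespace Const

open SplitEq

theorem satN {m n : ℕ} {R : SplitEq (Fin m) (Fin n)} {φ χ : ℕ → N} (h : Const R φ χ)
    (θ : N → Prop) : SatN R (fun k => θ (φ k)) (fun k => θ (χ k)) := by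
  intro u v huv
  have h' := congrArg θ (h u v huv)
  rcases u with u | u <;> rcases v with v | v <;> exact h'

theorem of_satN {m n : ℕ} {R : SplitEq (Fin m) (Fin n)} {φ χ : ℕ → N}
    (h : ∀ θ : N → Prop, SatN R (fun k => θ (φ k)) (fun k => θ (χ k))) : Const R φ χ := by
  intro u v huv
  have h' := h (fun c => Sum.elim (fun k : Fin m => φ k) (fun k : Fin n => χ k) u = c) u v huv
  rcases u with u | u <;> rcases v with v | v <;> exact h'.mp rfl

theorem apply_ofEquiv {m n : ℕ} {e : Fin m ≃ Fin n} {φ χ : ℕ → N} (h : Const (ofEquiv e) φ χ)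
    {k : ℕ} (hk : k < m) : φ k = χ (e ⟨k, hk⟩) :=
  h (Sum.inl ⟨k, hk⟩) (Sum.inr (e ⟨k, hk⟩)) rfl

theorem tensor {a b d e : ℕ} {R : SplitEq (Fin a) (Fin d)} {S : SplitEq (Fin b) (Fin e)}
    {φ χ : ℕ → N} (h : Const (tensor R S) φ χ) :
    Const R φ χ ∧ Const S (fun k => φ (a + k)) (fun k => χ (d + k)) :=
  ⟨of_satN fun θ => ((satN_tensor R S _ _).1 (h.satN θ)).1,
    of_satN fun θ => ((satN_tensor R S _ _).1 (h.satN θ)).2⟩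

theorem capRight {a : ℕ} {φ χ : ℕ → N} (h : Const (capRight a) φ χ) :
    (∀ k < a, φ k = χ k) ∧ χ a = χ (a + 1) :=
  ⟨fun k hk => (((satN_capRight _ _).1 (h.satN fun c => φ k = c)).1 k hk).mp rfl,
    ((satN_capRight _ _).1 (h.satN fun c => χ a = c)).2.mp rfl⟩

theorem cupLeft {a : ℕ} {φ χ : ℕ → N} (h : Const (cupLeft a) φ χ) :
    φ 0 = φ 1 ∧ ∀ k < a, φ (2 + k) = χ k :=
  ⟨((satN_cupLeft _ _).1 (h.satN fun c => φ 0 = c)).1.mp rfl,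
    fun k hk => (((satN_cupLeft _ _).1 (h.satN fun c => φ (2 + k) = c)).2 k hk).mp rfl⟩

/-- A middle point takes the label of any outer point in its class of the glued relation. Applying
`satN_star` to each predicate on labels would not do, as it gives unrelated middle predicates and
not one labelling. -/
theorem star {a b c : ℕ} {Q : SplitEq (Fin b) (Fin c)} {R : SplitEq (Fin a) (Fin b)}
    {φ χ : ℕ → N} (h : Const (star Q R) φ χ) : ∃ ψ : ℕ → N, Const R φ ψ ∧ Const Q ψ χ := by
  classical
  let l : Fin a ⊕ Fin c → N := Sum.elim (fun k => φ k) (fun k => χ k)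
  let m : Fin a ⊕ Fin c → Fin a ⊕ (Fin b ⊕ Fin c) := Sum.map id Sum.inr
  -- A closed loop in the middle reaches no outer point; `φ 0` serves as an arbitrary label for it.
  let θ : Fin a ⊕ (Fin b ⊕ Fin c) → N := fun w =>
    if h : ∃ u, glueSetoid Q R (m u) w then l h.choose else φ 0
  have hθ : ∀ u, θ (m u) = l u := by
    intro u
    have hu : ∃ v, glueSetoid Q R (m v) (m u) := ⟨u, (glueSetoid Q R).refl _⟩
    simp only [θ, dif_pos hu]
    exact h _ _ hu.choose_spec
  have hg : ∀ u v, Glue Q R u v → θ u = θ v := by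
    intro u v huv
    have huv' : glueSetoid Q R u v := Relation.TransGen.single huv
    by_cases hu : ∃ w, glueSetoid Q R (m w) u
    · have hv : ∃ w, glueSetoid Q R (m w) v := hu.imp fun w hw => (glueSetoid Q R).trans hw huv'
      simp only [θ, dif_pos hu, dif_pos hv]
      exact h _ _ ((glueSetoid Q R).trans hu.choose_spec
        ((glueSetoid Q R).trans huv' ((glueSetoid Q R).symm hv.choose_spec)))
    · have hv : ¬ ∃ w, glueSetoid Q R (m w) v := fun hv =>
        hu (hv.imp fun w hw => (glueSetoid Q R).trans hw ((glueSetoid Q R).symm huv'))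
      simp only [θ, dif_neg hu, dif_neg hv]
  refine ⟨fun k => if h : k < b then θ (.inr (.inl ⟨k, h⟩)) else φ 0, ?_, ?_⟩
  · intro u v huv
    have e : ∀ w : Fin a ⊕ Fin b, Sum.elim (fun k : Fin a => φ k) (fun k : Fin b =>
        if h : (k : ℕ) < b then θ (.inr (.inl ⟨k, h⟩)) else φ 0) w =
        θ (Sum.map id Sum.inl w) := by
      rintro (w | w)
      · exact (hθ (.inl w)).symm
      · simp
    rw [e, e]
    exact hg _ _ (.lower huv)
  · intro u v huv
    have e : ∀ w : Fin b ⊕ Fin c, Sum.elim (fun k : Fin b =>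
        if h : (k : ℕ) < b then θ (.inr (.inl ⟨k, h⟩)) else φ 0) (fun k : Fin c => χ k) w =
        θ (Sum.inr w) := by
      rintro (w | w)
      · simp
      · exact (hθ (.inr w)).symm
    rw [e, e]
    exact hg _ _ (.upper huv)

end Const

open SplitEq

/-! ### Lifting of arrows to labelled formulae -/

/-- A lifted generator has its own source and target, which agree with the labelled formulae only up
to a proved equation, and erasing labels returns the original formulae in the same sense. Hence the
transport, and `HEq` in place of equality. -/
theorem exists_lift_of_eq {A B : PN P} {A' B' : PN (P × N)} (f' : A' ⟶ B') {f : A ⟶ B}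
    (h : HEq (substMap Prod.fst f') f) {φ χ : ℕ → N} (hA : A' = lab φ A) (hB : B' = lab χ B) :
    ∃ g : lab φ A ⟶ lab χ B, HEq (substMap Prod.fst g) f := by
  subst hA hB
  exact ⟨f', h⟩

theorem heq_comp {A B C A' B' C' : PN P} (hA : A' = A) (hB : B' = B) (hC : C' = C) {f : A ⟶ B}
    {g : B ⟶ C} {f' : A' ⟶ B'} {g' : B' ⟶ C'} (hf : HEq f' f) (hg : HEq g' g) :
    HEq (f' ≫ g') (f ≫ g) := by
  subst hA hB hC
  cases hf
  cases hg
  rfl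

theorem heq_bmap (ξ : Conn) {A B C D A' B' C' D' : PN P} (hA : A' = A) (hB : B' = B) (hC : C' = C)
    (hD : D' = D) {f : A ⟶ C} {g : B ⟶ D} {f' : A' ⟶ C'} {g' : B' ⟶ D'} (hf : HEq f' f)
    (hg : HEq g' g) : HEq (bmap ξ f' g') (bmap ξ f g) := by
  subst hA hB hC hD
  cases hf
  cases hg
  rfl

theorem heq_mk₁ {S T : PN P → PN P} (F : ∀ A, PNTerm (S A) (T A)) {A A' : PN P} (hA : A' = A) :
    HEq (mk (F A')) (mk (F A)) := by
  subst hA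
  rfl

theorem heq_mk₂ {S T : PN P → PN P → PN P} (F : ∀ A B, PNTerm (S A B) (T A B)) {A A' B B' : PN P}
    (hA : A' = A) (hB : B' = B) : HEq (mk (F A' B')) (mk (F A B)) := by
  subst hA hB
  rfl

theorem heq_mk₃ {S T : PN P → PN P → PN P → PN P} (F : ∀ A B C, PNTerm (S A B C) (T A B C))
    {A A' B B' C C' : PN P} (hA : A' = A) (hB : B' = B) (hC : C' = C) :
    HEq (mk (F A' B' C')) (mk (F A B C)) := by
  subst hA hB hC
  rfl

/-- An arrow lifts to labelled formulae when the labelling is constant on the classes of its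
graph. -/
theorem exists_lift {A B : PN P} (t : PNTerm A B) (φ χ : ℕ → N) (h : Const t.graph φ χ) :
    ∃ f : lab φ A ⟶ lab χ B, HEq (substMap Prod.fst f) (mk t) := by
  induction t generalizing φ χ with
  | one A =>
    exact exists_lift_of_eq (f := mk (.one A)) (mk (.one (lab φ A))) (heq_mk₁ .one (subst_lab _ _)) rfl
      (lab_congr fun k hk => h.apply_ofEquiv hk)
  | b ξ A B C =>
    refine exists_lift_of_eq (f := mk (.b ξ A B C))
      (mk (.b ξ (lab φ A) (lab (fun k => φ (A.len + k)) B) (lab (fun k => φ (A.len + (B.len + k))) C)))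
      (heq_mk₃ (.b ξ) (subst_lab _ _) (subst_lab _ _) (subst_lab _ _)) rfl ?_
    have h' : ∀ k < A.len + (B.len + C.len), φ k = χ k := fun k hk => h.apply_ofEquiv hk
    refine congrArg₂ (bin ξ) (congrArg₂ (bin ξ) (lab_congr fun k hk => h' k (by omega))
      (lab_congr fun k hk => h' _ (by omega))) (lab_congr fun k hk => ?_)
    exact (h' (A.len + (B.len + k)) (by omega)).trans
      (congrArg χ (Nat.add_assoc A.len B.len k).symm)
  | bInv ξ A B C =>
    refine exists_lift_of_eq (f := mk (.bInv ξ A B C)) (mk (.bInv ξ (lab χ A)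
      (lab (fun k => χ (A.len + k)) B) (lab (fun k => χ (A.len + (B.len + k))) C)))
      (heq_mk₃ (.bInv ξ) (subst_lab _ _) (subst_lab _ _) (subst_lab _ _)) ?_ rfl
    have h' : ∀ k < A.len + B.len + C.len, φ k = χ k := fun k hk => h.apply_ofEquiv hk
    refine congrArg₂ (bin ξ) (congrArg₂ (bin ξ) (lab_congr fun k hk => (h' k (by omega)).symm)
      (lab_congr fun k hk => (h' _ (by omega)).symm)) (lab_congr fun k hk => ?_)
    refine Eq.trans ?_ (h' _ (Nat.add_lt_add_left hk _)).symm
    exact congrArg χ (Nat.add_assoc A.len B.len k).symm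
  | cAnd A B =>
    refine exists_lift_of_eq (f := mk (.cAnd A B))
      (mk (.cAnd (lab φ A) (lab (fun k => φ (A.len + k)) B)))
      (heq_mk₂ .cAnd (subst_lab _ _) (subst_lab _ _)) rfl ?_
    refine congrArg₂ (bin .and) (lab_congr fun k hk => ?_) (lab_congr fun k hk => ?_)
    · have := (h.apply_ofEquiv (k := A.len + k) (Nat.add_lt_add_left hk _)).trans
        (congrArg χ (finAddFlip_val _))
      simpa using this
    · have := (h.apply_ofEquiv (k := k) (Nat.lt_add_right _ hk)).trans
        (congrArg χ (finAddFlip_val _))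
      simpa [hk, add_comm] using this
  | cOr A B =>
    refine exists_lift_of_eq (f := mk (.cOr A B))
      (mk (.cOr (lab χ A) (lab (fun k => χ (A.len + k)) B)))
      (heq_mk₂ .cOr (subst_lab _ _) (subst_lab _ _)) ?_ rfl
    refine congrArg₂ (bin .or) (lab_congr fun k hk => ?_) (lab_congr fun k hk => ?_)
    · have := (h.apply_ofEquiv (k := k) (Nat.lt_add_right _ hk)).trans
        (congrArg χ (finAddFlip_val _))
      simpa [hk, add_comm] using this.symm
    · have := (h.apply_ofEquiv (k := B.len + k) (Nat.add_lt_add_left hk _)).trans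
        (congrArg χ (finAddFlip_val _))
      simpa using this.symm
  | d A B C =>
    refine exists_lift_of_eq (f := mk (.d A B C))
      (mk (.d (lab φ A) (lab (fun k => φ (A.len + k)) B) (lab (fun k => φ (A.len + (B.len + k))) C)))
      (heq_mk₃ (.d) (subst_lab _ _) (subst_lab _ _) (subst_lab _ _)) rfl ?_
    have h' : ∀ k < A.len + (B.len + C.len), φ k = χ k := fun k hk => h.apply_ofEquiv hk
    refine congrArg₂ (bin .or) (congrArg₂ (bin .and) (lab_congr fun k hk => h' k (by omega))
      (lab_congr fun k hk => h' _ (by omega))) (lab_congr fun k hk => ?_)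
    exact (h' (A.len + (B.len + k)) (by omega)).trans
      (congrArg χ (Nat.add_assoc A.len B.len k).symm)
  | Del p A =>
    -- The two ends of the cap form one class, so the new letter has the same label in both
    -- occurrences, as a crown requires.
    obtain ⟨h1, h2⟩ := h.capRight
    refine exists_lift_of_eq (f := mk (.Del p A)) (mk (.Del (p, χ A.len) (lab φ A))) (heq_mk₁ (.Del p) (subst_lab _ _))
      rfl (congrArg₂ (bin .and) (lab_congr h1) (congrArg₂ (bin .or) rfl ?_))
    rw [h2]
    rfl
  | Sig p A =>
    obtain ⟨h1, h2⟩ := h.cupLeft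
    refine exists_lift_of_eq (f := mk (.Sig p A)) (mk (.Sig (p, φ 0) (lab χ A))) (heq_mk₁ (.Sig p) (subst_lab _ _))
      (congrArg₂ (bin .or) (congrArg₂ (bin .and) rfl ?_) (lab_congr fun k hk => (h2 k hk).symm)) rfl
    rw [h1]
    rfl
  | comp f g ihf ihg =>
    -- The intermediate formula has no labels yet; its labelling is read off from the glued classes.
    obtain ⟨ψ, h1, h2⟩ := h.star
    obtain ⟨f', hf⟩ := ihf _ _ h2
    obtain ⟨g', hg⟩ := ihg _ _ h1
    refine ⟨g' ≫ f', ?_⟩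
    rw [substMap_comp]
    exact heq_comp (subst_lab _ _) (subst_lab _ _) (subst_lab _ _) hg hf
  | map ξ f g ihf ihg =>
    obtain ⟨h1, h2⟩ := h.tensor
    obtain ⟨f', hf⟩ := ihf _ _ h1
    obtain ⟨g', hg⟩ := ihg _ _ h2
    refine ⟨bmap ξ f' g', ?_⟩
    refine (heq_of_eq (substMap_bmap _ ξ f' g')).trans ?_
    exact heq_bmap ξ (subst_lab _ _) (subst_lab _ _) (subst_lab _ _) (subst_lab _ _) hf hg

/-- The positions labelled with a class inject into that class, which has two elements; no position
within range is labelled `none`. -/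
theorem count_add_count_le {m n : ℕ} {R : SplitEq (Fin m) (Fin n)} (hR : R.IsBrauerian)
    {φ χ : ℕ → Option (Quotient R)} (hφ : ∀ k : Fin m, φ k = some (Quotient.mk R (.inl k)))
    (hχ : ∀ k : Fin n, χ k = some (Quotient.mk R (.inr k))) (c : Option (Quotient R))
    [DecidablePred fun k => φ k = c] [DecidablePred fun k => χ k = c] :
    Nat.count (fun k => φ k = c) m + Nat.count (fun k => χ k = c) n ≤ 2 := by
  let := Nat.CountSet.fintype (fun k => φ k = c) m
  let := Nat.CountSet.fintype (fun k => χ k = c) n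
  rw [Nat.count_eq_card_fintype, Nat.count_eq_card_fintype, ← Fintype.card_sum,
    ← Nat.card_eq_fintype_card]
  cases c with
  | none =>
    have : IsEmpty ({k // k < m ∧ φ k = none} ⊕ {k // k < n ∧ χ k = none}) := by
      refine ⟨?_⟩
      rintro (⟨k, hk, h⟩ | ⟨k, hk, h⟩)
      · rw [hφ ⟨k, hk⟩] at h
        exact nomatch h
      · rw [hχ ⟨k, hk⟩] at h
        exact nomatch h
    simp
  | some c =>
    obtain ⟨w, rfl⟩ := Quotient.exists_rep c
    have hw : {v | R v w}.ncard = 2 := hR _ (R.mem_classes w)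
    rw [← hw, ← Nat.card_coe_set_eq]
    refine Nat.card_le_card_of_injective (Sum.elim
      (fun k => ⟨.inl ⟨k.1, k.2.1⟩, Quotient.exact (Option.some.inj ((hφ _).symm.trans k.2.2))⟩)
      (fun k => ⟨.inr ⟨k.1, k.2.1⟩, Quotient.exact (Option.some.inj ((hχ _).symm.trans k.2.2))⟩))
      ?_
    rintro (⟨k, hk⟩ | ⟨k, hk⟩) (⟨l, hl⟩ | ⟨l, hl⟩) h <;> simp_all

/-- Arrows of `PN` with the same graph are equal. -/
theorem faithful_G (P : Type u) : (PN.G P).Faithful := by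
  refine ⟨fun {A B} f g h => ?_⟩
  obtain ⟨s, rfl⟩ := mk_surjective f
  obtain ⟨t, rfl⟩ := mk_surjective g
  have hst : s.graph = t.graph := congrArg Subtype.val h
  classical
  let R := s.graph
  -- Each position is labelled with its class. Labellings are functions on all numbers, so `none`
  -- fills the values beyond the length.
  let φ : ℕ → Option (Quotient R) := fun k =>
    if h : k < A.len then some (Quotient.mk R (.inl ⟨k, h⟩)) else none
  let χ : ℕ → Option (Quotient R) := fun k =>
    if h : k < B.len then some (Quotient.mk R (.inr ⟨k, h⟩)) else none
  have hφ : ∀ k : Fin A.len, φ k = some (Quotient.mk R (.inl k)) := fun k => by simp [φ]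
  have hχ : ∀ k : Fin B.len, χ k = some (Quotient.mk R (.inr k)) := fun k => by simp [χ]
  have hc : Const s.graph φ χ := by
    have e : ∀ u, Sum.elim (fun k : Fin A.len => φ k) (fun k : Fin B.len => χ k) u =
        some (Quotient.mk R u) := by
      rintro (u | u)
      · exact hφ u
      · exact hχ u
    intro u v huv
    rw [e, e, Quotient.sound huv]
  obtain ⟨f', hf⟩ := exists_lift s φ χ hc
  obtain ⟨g', hg⟩ := exists_lift t φ χ (hst ▸ hc)
  obtain ⟨A', D, hD, hA'⟩ := exists_dual (lab φ A)
  have hcf : ∀ f : lab φ A ⟶ lab χ B, CF (D.el.act (f ⊻ 𝟙 A')) := fun f => (Adm.all _).act hD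
  -- The dual `A'` has the letters of the labelled `A` with signs exchanged, so a labelled letter
  -- occurs at most twice in all. The formula is provable, hence balanced, and at most one
  -- occurrence of each sign is left.
  have hl : Linear (lab χ B ⋎ A') := by
    rintro ⟨p, c⟩
    have h1 := (hcf f').pos_eq_neg (p, c)
    have h2 := count_lab φ A p c
    have h3 := count_lab χ B p c
    have h4 := count_add_count_le s.graph_isBrauerian hφ hχ c
    have h5 := hA' (p, c)
    simp only [pos, neg] at h1 ⊢
    omega
  have e : f' = g' := D.act_injective ((hcf f').eq_of_linear (hcf g') hl)
  subst e
  exact eq_of_heq (hf.symm.trans hg)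

end PN

theorem mainTheorem2 (P : Type u) : (PN.G P).Faithful :=
  PN.faithful_G P
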